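/- **Conventions.** For $s=\frac12$ let $\mathcal S_{1/2}(\mathbf R^n)$ be the Gelfand–Shilov space of Roumieu type, i.e. all $f\in C^\infty(\mathbf R^n)$ such that, for some $h>0$, $\sup_{\alpha,\beta,x}|x^\beta\partial^\alpha f(x)|\,h^{-|\alpha+\beta|}(\alpha!\,\beta!)^{-1/2}<\infty$, with its inductive limit topology, and let $\mathcal S_{1/2}'(\mathbf R^n)$ be its dual. The short-time Fourier transform is $$V_\phi f(x,\xi)=(2\pi)^{-n/2}\int f(y)\,\overline{\phi(y-x)}\,e^{-i\langle y,\xi\rangle}\,dy ,$$ extended to $f\in\mathcal S_{1/2}'(\mathbf R^n)$, $\phi\in\mathcal S_{1/2}(\mathbf R^n)$ by duality, and to $f,\phi\in\mathcal S_{1/2}'(\mathbf R^n)$, giving an element of $\mathcal S_{1/2}'(\mathbf R^{2n})$, by continuity. A weight on $\mathbf R^n$ is a positive $\omega\in L^\infty_{loc}$ with $1/\omega\in L^\infty_{loc}$; $\omega\in\mathscr P_E(\mathbf R^n)$ means that moreover $\omega(x+y)\le C_0\,\omega(x)v(y)$ for all $x,y$, for some weight $v$ and some constant $C_0$. A Young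 function is a convex $\Phi_0:[0,\infty]\to[0,\infty]$ with $\Phi_0(0)=0$ and $\lim_{t\to\infty}\Phi_0(t)=\Phi_0(\infty)=\infty$; a quasi-Young function is one of the form $\Phi(t)=\Phi_0(t^{p})$ with $\Phi_0$ a Young function and $p\in(0,1]$. For a $[0,\infty]$-valued $F$ let $\|F\|_{L^\Phi}=\inf\{\lambda>0:\int\Phi(F(x)/\lambda)\,dx\le1\}\in[0,\infty]$. Then - $\|F\|_{L^{\Phi,\Psi}_{(\omega)}}$ is obtained from $|F(x,\xi)|\,\omega(x,\xi)$ by taking the $L^\Phi$-norm in $x$ and then the $L^\Psi$-norm in $\xi$; - $\|F\|_{L^{\Phi,\Psi}_{*,(\omega)}}$ is obtained from it by taking the $L^\Psi$-norm in $\xi$ and then the $L^\Phi$-norm in $x$; - $\|F\|_{L^{\Phi_1,\Phi_2,\Psi_1,\Psi_2}_{(\omega_0)}}$ is obtained from $|F(x,\xi,\eta,y)|\,\omega_0(x,\xi,\eta,y)$ by taking successively the $L^{\Phi_1}$-norm in $x$, the $L^{\Phi_2}$-norm in $\xi$, the $L^{\Psi_1}$-norm in $\eta$ and the $L^{\Psi_2}$-norm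 in $y$. With the Gaussian window $\phi_0(x)=\pi^{-n/4}e^{-|x|^2/2}$ on $\mathbf R^n$, the spaces $M^{\Phi,\Psi}_{(\omega)}(\mathbf R^d)$, $W^{\Phi,\Psi}_{(\omega)}(\mathbf R^d)$ ($n=d$) and $M^{\Phi_1,\Phi_2,\Psi_1,\Psi_2}_{(\omega_0)}(\mathbf R^{2d})$ ($n=2d$) consist of the $f\in\mathcal S_{1/2}'$ for which $\|V_{\phi_0}f\|$ in $L^{\Phi,\Psi}_{(\omega)}$, $L^{\Phi,\Psi}_{*,(\omega)}$, respectively $L^{\Phi_1,\Phi_2,\Psi_1,\Psi_2}_{(\omega_0)}$, is finite, and these quantities are their norms. All norms take values in $[0,\infty]$, and $0\cdot\infty=0$. **Theorem.** Let $\Phi_1,\Phi_2,\Psi_1,\Psi_2$ be quasi-Young functions, $\omega_0\in\mathscr P_E(\mathbf R^{4d})$, $\omega_1,\omega_2\in\mathscr P_E(\mathbf R^{2d})$ and $C>0$. Consider the conditions $$\text{(a)}\quad \omega_0(x,\xi,\eta,-y)\le C\,\omega_1(y-x,\eta)\,\omega_2(y,\xi+\eta)\qquad\text{for all }x,y,\xi,\eta\in\mathbf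 R^d,$$ $$\text{(b)}\quad \omega_1(y-x,\eta)\,\omega_2(y,\xi+\eta)\le C\,\omega_0(x,\xi,\eta,-y)\qquad\text{for all }x,y,\xi,\eta\in\mathbf R^d.$$ 1. If (a) holds, then for all $f_1,f_2\in\mathcal S_{1/2}'(\mathbf R^d)$ and $\phi_1,\phi_2\in\mathcal S_{1/2}(\mathbf R^d)$, with $\phi=V_{\phi_1}\phi_2$, $$\|V_\phi(V_{f_1}f_2)\|_{L^{\Phi_1,\Phi_2,\Psi_1,\Psi_2}_{(\omega_0)}}\le C\,\|V_{\phi_1}f_1\|_{L^{\Phi_1,\Psi_1}_{(\omega_1)}}\|V_{\phi_2}f_2\|_{L^{\Psi_2,\Phi_2}_{*,(\omega_2)}} .$$ 2. If (b) holds, then for all such $f_1,f_2,\phi_1,\phi_2$ and $\phi=V_{\phi_1}\phi_2$, $$\|V_{\phi_1}f_1\|_{L^{\Phi_1,\Psi_1}_{(\omega_1)}}\|V_{\phi_2}f_2\|_{L^{\Psi_2,\Phi_2}_{*,(\omega_2)}}\le C\,\|V_\phi(V_{f_1}f_2)\|_{L^{\Phi_1,\Phi_2,\Psi_1,\Psi_2}_{(\omega_0)}}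 .$$ 3. Suppose that (a) and (b) hold. If $f_1\in M^{\Phi_1,\Psi_1}_{(\omega_1)}(\mathbf R^d)$ and $f_2\in W^{\Psi_2,\Phi_2}_{(\omega_2)}(\mathbf R^d)$, then $V_{f_1}f_2\in M^{\Phi_1,\Phi_2,\Psi_1,\Psi_2}_{(\omega_0)}(\mathbf R^{2d})$. If $f_1,f_2\in\mathcal S_{1/2}'(\mathbf R^d)\setminus\{0\}$, then $$f_1\in M^{\Phi_1,\Psi_1}_{(\omega_1)}(\mathbf R^d)\ \text{ and }\ f_2\in W^{\Psi_2,\Phi_2}_{(\omega_2)}(\mathbf R^d)\iff V_{f_1}f_2\in M^{\Phi_1,\Phi_2,\Psi_1,\Psi_2}_{(\omega_0)}(\mathbf R^{2d}).$$ Moreover there is a constant $c>0$, independent of $f_1,f_2$, such that for all $f_1,f_2\in\mathcal S_{1/2}'(\mathbf R^d)$ $$c^{-1}\|f_1\|_{M^{\Phi_1,\Psi_1}_{(\omega_1)}}\|f_2\|_{W^{\Psi_2,\Phi_2}_{(\omega_2)}}\le\|V_{f_1}f_2\|_{M^{\Phi_1,\Phi_2,\Psi_1,\Psi_2}_{(\omega_0)}}\le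 c\,\|f_1\|_{M^{\Phi_1,\Psi_1}_{(\omega_1)}}\|f_2\|_{W^{\Psi_2,\Phi_2}_{(\omega_2)}} .$$ -/

import Mathlib

open MeasureTheory Filter Topology
open scoped NNReal ENNReal InnerProductSpace ComplexConjugate

/-- Euclidean space `ℝ^d`. -/
abbrev Rd (d : ℕ) : Type := EuclideanSpace ℝ (Fin d)

/-- Euclidean space `ℝ^d × ℝ^d = ℝ^{2d}`, with the Euclidean inner product. -/
abbrev R2d (d : ℕ) : Type := WithLp 2 (Rd d × Rd d)

section GelfandShilov

variable {V : Type*} [NormedAddCommGroup V] [NormedSpace ℝ V]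

/-- `GSBound h M f` says that the Gelfand-Shilov seminorm `‖f‖_{S_{1/2,h}}` is at most `M`.
Powers of the norm of `x` and norms of Fréchet derivatives replace monomials `x^β` and partial
derivatives `∂^α f`; in finite dimension this changes the seminorms only by rescaling `h` by a
dimensional factor, so it gives the same space and the same topology. -/
def GSBound (h M : ℝ) (f : V → ℂ) : Prop :=
  ∀ (k n : ℕ) (x : V),
    ‖x‖ ^ k * ‖iteratedFDeriv ℝ n f x‖ ≤ M * (h ^ (k + n) * Real.sqrt ((k.factorial : ℝ) * (n.factorial : ℝ)))

theorem GSBound.mono {h h' M : ℝ} {f : V → ℂ} (hf : GSBound h M f) (h0 : 0 ≤ h) (hh : h ≤ h') :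
    GSBound h' M f := by
  intro k n x
  have hM : 0 ≤ M := by
    have := hf 0 0 x
    simp at this
    exact le_trans (norm_nonneg _) this
  refine (hf k n x).trans ?_
  gcongr

variable (V) in
/-- The Gelfand-Shilov space `S_{1/2}(V)` of Roumieu type. -/
def GelfandShilov : Submodule ℂ (V → ℂ) where
  carrier := {f | ContDiff ℝ ((⊤ : ℕ∞) : WithTop ℕ∞) f ∧ ∃ h : ℝ, 0 < h ∧ ∃ M : ℝ, GSBound h M f}
  zero_mem' := by
    refine ⟨contDiff_const, 1, one_pos, 0, fun k n x => ?_⟩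
    have h0 : iteratedFDeriv ℝ n (0 : V → ℂ) = 0 := iteratedFDeriv_fun_zero
    simp [h0]
  add_mem' := by
    rintro f g ⟨hf, h₁, hh₁, M₁, hM₁⟩ ⟨hg, h₂, hh₂, M₂, hM₂⟩
    refine ⟨hf.add hg, max h₁ h₂, lt_max_of_lt_left hh₁, M₁ + M₂, fun k n x => ?_⟩
    have e : iteratedFDeriv ℝ n (f + g) x = iteratedFDeriv ℝ n f x + iteratedFDeriv ℝ n g x :=
      iteratedFDeriv_add_apply ((hf.of_le (by exact_mod_cast le_top)).contDiffAt)
        ((hg.of_le (by exact_mod_cast le_top)).contDiffAt)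
    have b₁ := hM₁.mono hh₁.le (le_max_left h₁ h₂) k n x
    have b₂ := hM₂.mono hh₂.le (le_max_right h₁ h₂) k n x
    rw [e, add_mul]
    refine le_trans ?_ (add_le_add b₁ b₂)
    rw [← mul_add]
    gcongr
    exact norm_add_le _ _
  smul_mem' := by
    rintro c f ⟨hf, h, hh, M, hM⟩
    refine ⟨hf.const_smul c, h, hh, ‖c‖ * M, fun k n x => ?_⟩
    have e : iteratedFDeriv ℝ n (c • f) x = c • iteratedFDeriv ℝ n f x :=
      iteratedFDeriv_const_smul_apply ((hf.of_le (by exact_mod_cast le_top)).contDiffAt)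
    rw [e, norm_smul, mul_assoc]
    have := mul_le_mul_of_nonneg_left (hM k n x) (norm_nonneg c)
    linarith

/-- `u` belongs to the dual `S_{1/2}'(V)`: it is a linear functional on `S_{1/2}(V)`, continuous for
the inductive limit topology, that is, bounded on each of the normed spaces `S_{1/2,h}(V)`. -/
structure IsGSDistribution (u : GelfandShilov V → ℂ) : Prop where
  linear : IsLinearMap ℂ u
  bounded : ∀ h : ℝ, 0 < h → ∃ C : ℝ, ∀ (θ : GelfandShilov V) (M : ℝ),
    GSBound h M (θ : V → ℂ) → ‖u θ‖ ≤ C * M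

open Classical in
/-- The value `⟨u, g⟩` of a functional on `S_{1/2}(V)` at a function `g` that belongs to
`S_{1/2}(V)` (with value `0` at other functions). -/
noncomputable def gsPair (u : GelfandShilov V → ℂ) (g : V → ℂ) : ℂ :=
  if hg : g ∈ GelfandShilov V then u ⟨g, hg⟩ else 0

end GelfandShilov

section STFT

variable {V : Type*} [NormedAddCommGroup V] [InnerProductSpace ℝ V]

/-- The character `y ↦ e^{-i⟨y,ξ⟩}`. -/
noncomputable def expNeg (ξ y : V) : ℂ := Complex.exp (-(Complex.I * ((⟪y, ξ⟫_ℝ : ℝ) : ℂ)))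

variable (V) in
/-- The normalizing factor `(2π)^{-dim V/2}` of the Fourier transform. -/
noncomputable def fourierConst : ℂ :=
  (((2 * Real.pi) ^ (-(Module.finrank ℝ V : ℝ) / 2) : ℝ) : ℂ)

/-- The short-time Fourier transform `V_φ f` of a function `f`. -/
noncomputable def stftFun [MeasureSpace V] (φ f : V → ℂ) (x ξ : V) : ℂ :=
  fourierConst V * ∫ y, f y * conj (φ (y - x)) * expNeg ξ y

/-- The short-time Fourier transform `V_φ u (x,ξ) = F(u conj(φ(· - x)))(ξ)` of a functional `u` on
`S_{1/2}` with window `φ` in `S_{1/2}`. -/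
noncomputable def stft (φ : V → ℂ) (u : GelfandShilov V → ℂ) (x ξ : V) : ℂ :=
  fourierConst V * gsPair u (fun y => conj (φ (y - x)) * expNeg ξ y)

variable (V) in
/-- The standard Gaussian window `π^{-dim V/4} e^{-|x|²/2}`. -/
noncomputable def gaussWindow (x : V) : ℂ :=
  ((Real.pi ^ (-(Module.finrank ℝ V : ℝ) / 4) * Real.exp (-‖x‖ ^ 2 / 2) : ℝ) : ℂ)

end STFT

/-- The short-time Fourier transform `V_{φ₁} φ₂`, as a function on `ℝ^{2d}`. -/
noncomputable def stftFun2 {d : ℕ} (φ₁ φ₂ : Rd d → ℂ) (X : R2d d) : ℂ :=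
  stftFun φ₁ φ₂ X.fst X.snd

/-- The kernel `K_Θ(y,z) = (F₂Θ)(y - z, y)`, where `F₂` is the partial Fourier transform in the
second variable. -/
noncomputable def stftKernel {d : ℕ} (Θ : R2d d → ℂ) (y z : Rd d) : ℂ :=
  fourierConst (Rd d) * ∫ ξ : Rd d, Θ (WithLp.toLp 2 (y - z, ξ)) * expNeg ξ y

/-- The short-time Fourier transform `V_{f₁} f₂` of `f₂ ∈ S_{1/2}'(ℝ^d)` with
`f₁ ∈ S_{1/2}'(ℝ^d)` as window, a functional on `S_{1/2}(ℝ^{2d})`: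
`⟨V_{f₁} f₂, Θ⟩ = ⟨f₂ ⊗ conj f₁, K_Θ⟩`, that is,
`(2π)^{-d/2} ∫∫∫ f₂(y) conj(f₁(y - x)) e^{-i⟨y,ξ⟩} Θ(x,ξ) dy dx dξ` when `f₁`, `f₂` are functions.
The tensor product is evaluated iteratively, with `⟨conj f₁, k⟩ = conj ⟨f₁, conj k⟩`. -/
noncomputable def stftDist {d : ℕ} (f₁ f₂ : GelfandShilov (Rd d) → ℂ) :
    GelfandShilov (R2d d) → ℂ := fun Θ =>
  gsPair f₂ (fun y => conj (gsPair f₁ (fun z => conj (stftKernel (Θ : R2d d → ℂ) y z))))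

section Weights

variable {G : Type*} [AddGroup G] [TopologicalSpace G] [MeasureSpace G]

/-- A weight: a positive function `ω` with `ω` and `1/ω` in `L^∞_loc`. -/
structure IsWeight (ω : G → ℝ) : Prop where
  pos : ∀ x, 0 < ω x
  aemeasurable : AEMeasurable ω
  bounded : ∀ K : Set G, IsCompact K → ∃ M : ℝ, ∀ᵐ x ∂(volume.restrict K), ω x ≤ M
  bounded_inv : ∀ K : Set G, IsCompact K → ∃ M : ℝ, ∀ᵐ x ∂(volume.restrict K), (ω x)⁻¹ ≤ M

/-- The class `P_E` of moderate weights. -/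
structure IsModerateWeight (ω : G → ℝ) : Prop where
  weight : IsWeight ω
  moderate : ∃ v : G → ℝ, IsWeight v ∧ ∃ C : ℝ, ∀ x y, ω (x + y) ≤ C * (ω x * v y)

end Weights

/-- Young functions `[0,∞] → [0,∞]`. -/
structure IsYoung (Φ : ℝ≥0∞ → ℝ≥0∞) : Prop where
  convex : ∀ s₁ s₂ t₁ t₂ : ℝ≥0, s₁ + s₂ = 1 →
    Φ ((s₁ * t₁ + s₂ * t₂ : ℝ≥0) : ℝ≥0∞) ≤ s₁ * Φ t₁ + s₂ * Φ t₂
  zero : Φ 0 = 0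
  top : Φ ⊤ = ⊤
  tendsto : Tendsto (fun t : ℝ≥0 => Φ t) atTop (𝓝 ⊤)

/-- Quasi-Young functions: `Φ(t) = Φ₀(t^p)` with `Φ₀` a Young function and `0 < p ≤ 1`. -/
def IsQuasiYoung (Φ : ℝ≥0∞ → ℝ≥0∞) : Prop :=
  ∃ p : ℝ, 0 < p ∧ p ≤ 1 ∧ ∃ Φ₀ : ℝ≥0∞ → ℝ≥0∞, IsYoung Φ₀ ∧ ∀ t, Φ t = Φ₀ (t ^ p)

/-- The Luxemburg (quasi-)norm `inf {λ > 0 | ∫ Φ(F/λ) ≤ 1}` of a `[0,∞]`-valued function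
(equal to `∞` if no such `λ` exists). -/
noncomputable def orliczNorm {α : Type*} [MeasureSpace α] (Φ : ℝ≥0∞ → ℝ≥0∞) (F : α → ℝ≥0∞) :
    ℝ≥0∞ :=
  ⨅ (l : ℝ≥0) (_ : 0 < l) (_ : ∫⁻ x, Φ (F x / (l : ℝ≥0∞)) ≤ 1), (l : ℝ≥0∞)

section OrliczModulation

variable {d : ℕ}

/-- `‖F‖_{L^{Φ,Ψ}_{(ω)}(ℝ^{2d})}`: first the `Φ`-norm in `x`, then the `Ψ`-norm in `ξ`. -/
noncomputable def mixedNorm (Φ Ψ : ℝ≥0∞ → ℝ≥0∞) (ω : Rd d × Rd d → ℝ) (F : Rd d → Rd d → ℂ) :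
    ℝ≥0∞ :=
  orliczNorm Ψ fun ξ => orliczNorm Φ fun x => ‖F x ξ‖ₑ * ENNReal.ofReal (ω (x, ξ))

/-- `‖F‖_{L^{Φ,Ψ}_{*,(ω)}(ℝ^{2d})}`: the `L^{Ψ,Φ}`-norm after interchanging the variables. -/
noncomputable def mixedNormStar (Φ Ψ : ℝ≥0∞ → ℝ≥0∞) (ω : Rd d × Rd d → ℝ)
    (F : Rd d → Rd d → ℂ) : ℝ≥0∞ :=
  mixedNorm Ψ Φ (fun p => ω (p.2, p.1)) (fun x ξ => F ξ x)

/-- `‖F‖_{L^{Φ₁,Φ₂,Ψ₁,Ψ₂}_{(ω)}(ℝ^{4d})}` of `F((x,ξ),(η,y))`: the norms are taken successively in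
`x` (`Φ₁`), `ξ` (`Φ₂`), `η` (`Ψ₁`), `y` (`Ψ₂`). -/
noncomputable def mixedNorm4 (Φ₁ Φ₂ Ψ₁ Ψ₂ : ℝ≥0∞ → ℝ≥0∞) (ω : Rd d × Rd d × Rd d × Rd d → ℝ)
    (F : R2d d → R2d d → ℂ) : ℝ≥0∞ :=
  orliczNorm Ψ₂ fun y => orliczNorm Ψ₁ fun η => orliczNorm Φ₂ fun ξ => orliczNorm Φ₁ fun x =>
    ‖F (WithLp.toLp 2 (x, ξ)) (WithLp.toLp 2 (η, y))‖ₑ * ENNReal.ofReal (ω (x, ξ, η, y))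

/-- The norm of the Orlicz modulation space `M^{Φ,Ψ}_{(ω)}(ℝ^d)`. -/
noncomputable def modNorm (Φ Ψ : ℝ≥0∞ → ℝ≥0∞) (ω : Rd d × Rd d → ℝ)
    (u : GelfandShilov (Rd d) → ℂ) : ℝ≥0∞ :=
  mixedNorm Φ Ψ ω (stft (gaussWindow (Rd d)) u)

/-- The norm of the Orlicz modulation space `W^{Φ,Ψ}_{(ω)}(ℝ^d)`. -/
noncomputable def wienerNorm (Φ Ψ : ℝ≥0∞ → ℝ≥0∞) (ω : Rd d × Rd d → ℝ)
    (u : GelfandShilov (Rd d) → ℂ) : ℝ≥0∞ :=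
  mixedNormStar Φ Ψ ω (stft (gaussWindow (Rd d)) u)

/-- The norm of the Orlicz modulation space `M^{Φ₁,Φ₂,Ψ₁,Ψ₂}_{(ω)}(ℝ^{2d})`. -/
noncomputable def modNorm4 (Φ₁ Φ₂ Ψ₁ Ψ₂ : ℝ≥0∞ → ℝ≥0∞) (ω : Rd d × Rd d × Rd d × Rd d → ℝ)
    (u : GelfandShilov (R2d d) → ℂ) : ℝ≥0∞ :=
  mixedNorm4 Φ₁ Φ₂ Ψ₁ Ψ₂ ω (stft (gaussWindow (R2d d)) u)

/-- The space `M^{Φ,Ψ}_{(ω)}(ℝ^d)`. -/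
def ModSpace (Φ Ψ : ℝ≥0∞ → ℝ≥0∞) (ω : Rd d × Rd d → ℝ) : Set (GelfandShilov (Rd d) → ℂ) :=
  {u | IsGSDistribution u ∧ modNorm Φ Ψ ω u < ⊤}

/-- The space `W^{Φ,Ψ}_{(ω)}(ℝ^d)`. -/
def WienerSpace (Φ Ψ : ℝ≥0∞ → ℝ≥0∞) (ω : Rd d × Rd d → ℝ) : Set (GelfandShilov (Rd d) → ℂ) :=
  {u | IsGSDistribution u ∧ wienerNorm Φ Ψ ω u < ⊤}

/-- The space `M^{Φ₁,Φ₂,Ψ₁,Ψ₂}_{(ω)}(ℝ^{2d})`. -/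
def ModSpace4 (Φ₁ Φ₂ Ψ₁ Ψ₂ : ℝ≥0∞ → ℝ≥0∞) (ω : Rd d × Rd d × Rd d × Rd d → ℝ) :
    Set (GelfandShilov (R2d d) → ℂ) :=
  {u | IsGSDistribution u ∧ modNorm4 Φ₁ Φ₂ Ψ₁ Ψ₂ ω u < ⊤}

end OrliczModulation

/-! ### Factorials, moments and Gaussians. -/

section Elementary

/-! Everything rests on one pointwise identity. With window V_{φ₁}φ₂, the short-time Fourier
transform of V_{f₁}f₂ at ((x,ξ),(η,y)) has modulus |V_{φ₁}f₁(-y-x,η)| · |V_{φ₂}f₂(-y,ξ+η)|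
(`enorm_stft_stftDist`). The successive norms in x, ξ, η, y then act on one factor at a time, after
a reflection or a translation, so the mixed norm of the product is exactly the product of the two
norms (`orlicz4_mul`). Conditions (a) and (b) compare the weights pointwise, which gives the first
two inequalities. A factor ∞ may be pulled out of a Luxemburg norm because the functions in question
vanish or are bounded below on an open set (`orliczNorm_mul`).

For distributions the identity is read off the kernel: if Θ is a time-frequency shift of V_{φ₁}φ₂,
partial Fourier inversion splits K_Θ into a shift of φ₁ times a shift of φ₂ (`stftKernel_tfShift`).
It remains to know that V_{φ₁}φ₂ is an admissible window (`stftFun2_mem`) and that V_{f₁}f₂ is a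
distribution (`isGSDistribution_stftDist`). Both follow from `synthesis`: superpositions of shifts
with Gaussian-decaying coefficients converge as Bochner integrals in a Banach space of jets, and
distributions extend to that space by Hahn–Banach. The inversion formula
`integral_tfCoeff_mul_tfShift` supplies such superpositions.

The last claim uses the Gaussian on ℝ^{2d} as window instead of V_g g. One transform is dominated by
a Gaussian convolution of the other. For orders p < 1 Minkowski's inequality fails, so
`rpow_le_convolution` first upgrades this to a convolution bound for p-th powers by a maximal
function argument; then `orlicz4_moderate_convolution_le` applies a Minkowski inequality (up to
constants) in each variable. The converse membership uses that nonzero distributions have nonzero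
norms (`modNorm_ne_zero`, `wienerNorm_ne_zero`). -/

theorem sqrt_factorial_mul_le {n j : ℕ} (hj : j ≤ n) :
    √(j.factorial : ℝ) * √((n - j).factorial : ℝ) ≤ √(n.factorial : ℝ) := by
  rw [← Real.sqrt_mul (by positivity)]
  apply Real.sqrt_le_sqrt
  exact_mod_cast Nat.le_of_dvd (Nat.factorial_pos n) (Nat.factorial_mul_factorial_dvd_factorial hj)

/-- The inequality t^k/k! ≤ e^t at t = 2br², followed by a square root. Since b is free, a power is
paid for by √k! and Gaussian growth at an arbitrarily small rate. -/
theorem pow_le_sqrt_factorial_mul_exp {b : ℝ} (hb : 0 < b) (r : ℝ) (k : ℕ) :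
    r ^ k ≤ (√(2 * b))⁻¹ ^ k * √(k.factorial : ℝ) * Real.exp (b * r ^ 2) := by
  have h1 := Real.pow_div_factorial_le_exp (2 * b * r ^ 2) (by positivity) k
  have hk : (0 : ℝ) < k.factorial := by exact_mod_cast k.factorial_pos
  rw [div_le_iff₀ hk] at h1
  have hs : 0 < √(2 * b) := Real.sqrt_pos.2 (by positivity)
  have h2 : (√(2 * b) * r) ^ k ≤ √(k.factorial : ℝ) * Real.exp (b * r ^ 2) := by
    apply le_of_sq_le_sq _ (by positivity)
    rw [mul_pow (√(k.factorial : ℝ)), Real.sq_sqrt hk.le, ← Real.exp_nat_mul, ← pow_mul, mul_comm k 2,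
      pow_mul, mul_pow, Real.sq_sqrt (by positivity)]
    push_cast
    rw [mul_comm (k.factorial : ℝ), ← mul_assoc 2 b]
    exact h1
  rw [mul_pow] at h2
  rw [inv_pow, mul_assoc, ← div_eq_inv_mul, le_div_iff₀ (by positivity)]
  linarith

/-- Weighted by 1/k!, the even moments sum to an exponential. With t = r²/(4h²), the bound √(2k)! ≤
2^k k! leaves the k-th term at most M 2^{-k}, whence the factor 2. -/
theorem decay_of_moments {r s M h : ℝ} (hh : 0 < h) (hM0 : 0 ≤ M)
    (H : ∀ k : ℕ, r ^ k * s ≤ M * (h ^ k * √(k.factorial : ℝ))) :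
    s ≤ 2 * M * Real.exp (-(4 * h ^ 2)⁻¹ * r ^ 2) := by
  set t := (4 * h ^ 2)⁻¹ * r ^ 2 with ht
  have e : -(4 * h ^ 2)⁻¹ * r ^ 2 = -t := by rw [ht]; ring
  rw [e, Real.exp_neg, ← div_eq_mul_inv, le_div_iff₀ (Real.exp_pos _)]
  have hsum : HasSum (fun k : ℕ => t ^ k / k.factorial * s) (Real.exp t * s) := by
    rw [Real.exp_eq_exp_ℝ]
    exact (NormedSpace.expSeries_div_hasSum_exp t).mul_right s
  have hgeo : HasSum (fun k : ℕ => M * (1 / 2 : ℝ) ^ k) (M * 2) := hasSum_geometric_two.mul_left M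
  rw [mul_comm s, mul_comm 2]
  refine hasSum_le (fun k => ?_) hsum hgeo
  have h2 := H (2 * k)
  have hk : (0 : ℝ) < k.factorial := by exact_mod_cast k.factorial_pos
  -- (2k)! is the central binomial coefficient, at most 4^k, times k!².
  have hf : √((2 * k).factorial : ℝ) ≤ 2 ^ k * k.factorial := by
    rw [Real.sqrt_le_left (by positivity)]
    have h3 := Nat.factorial_two_mul_le k
    have h4 : ((2 * k).factorial : ℝ) ≤ (2 * k) ^ k * k.factorial := by exact_mod_cast h3
    have h5 : (2 * k).factorial ≤ (2 ^ k * k.factorial) ^ 2 := by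
      have := Nat.centralBinom_eq_two_mul_choose k
      have h6 := Nat.choose_le_two_pow (2 * k) k
      have h7 := Nat.choose_mul_factorial_mul_factorial (n := 2 * k) (k := k) (by omega)
      rw [show 2 * k - k = k by omega] at h7
      rw [← h7]
      calc _ ≤ 2 ^ (2 * k) * k.factorial * k.factorial := by gcongr
        _ = _ := by ring
    exact_mod_cast h5
  have h8 : r ^ (2 * k) * s ≤ M * (h ^ (2 * k) * (2 ^ k * k.factorial)) :=
    h2.trans (by gcongr)
  have : t ^ k / k.factorial * s = ((4 * h ^ 2) ^ k)⁻¹ / k.factorial * (r ^ (2 * k) * s) := by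
    rw [ht, mul_pow, inv_pow, pow_mul]; ring
  rw [this]
  calc _ ≤ ((4 * h ^ 2) ^ k)⁻¹ / k.factorial * (M * (h ^ (2 * k) * (2 ^ k * k.factorial))) := by
        gcongr
    _ = _ := by
        rw [pow_mul, mul_pow, one_div, inv_pow, show (4 : ℝ) = 2 * 2 by norm_num, mul_pow]
        field_simp

theorem neg_mul_norm_sub_sq_le {V : Type*} [SeminormedAddCommGroup V] {a : ℝ} (ha : 0 ≤ a) (x y : V) :
    -a * ‖y - x‖ ^ 2 ≤ -(a / 2) * ‖y‖ ^ 2 + a * ‖x‖ ^ 2 := by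
  have h1 : ‖y‖ ≤ ‖y - x‖ + ‖x‖ := by simpa using norm_add_le (y - x) x
  have h2 : ‖y‖ ^ 2 ≤ 2 * ‖y - x‖ ^ 2 + 2 * ‖x‖ ^ 2 := by
    have := pow_le_pow_left₀ (norm_nonneg y) h1 2
    nlinarith [sq_nonneg (‖y - x‖ - ‖x‖)]
  nlinarith

end Elementary

/-! ### Derivative estimates and Gaussian decay. -/

section DerivBound

variable {V : Type*} [NormedAddCommGroup V] [NormedSpace ℝ V]

/-- The derivatives of `f` at `x` grow at most like `A h^n √n!`. -/
def DerivBound (h A : ℝ) (f : V → ℂ) (x : V) : Prop :=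
  ∀ n : ℕ, ‖iteratedFDeriv ℝ n f x‖ ≤ A * (h ^ n * √(n.factorial : ℝ))

/-- The derivatives of `f` obey `‖D^n f(x)‖ ≤ M h^n √n! e^{-a|x|²}`. -/
def GaussBound (a h M : ℝ) (f : V → ℂ) : Prop :=
  ∀ x, DerivBound h (M * Real.exp (-a * ‖x‖ ^ 2)) f x

theorem DerivBound.nonneg {h A : ℝ} {f : V → ℂ} {x : V} (H : DerivBound h A f x) : 0 ≤ A := by
  have := H 0
  simp at this
  exact (norm_nonneg _).trans this

theorem DerivBound.mono {h h' A A' : ℝ} {f : V → ℂ} {x : V} (H : DerivBound h A f x) (h0 : 0 ≤ h)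
    (hh : h ≤ h') (hA : A ≤ A') : DerivBound h' A' f x := fun n =>
  (H n).trans (by have := H.nonneg.trans hA; gcongr)

/-- In the Leibniz formula √i! √(n-i)! ≤ √n!, so the binomial coefficients recombine to (h₁ + h₂)^n.
-/
theorem DerivBound.mul {h₁ h₂ A B : ℝ} {f g : V → ℂ} {x : V} (hf : ContDiff ℝ ((⊤ : ℕ∞) : WithTop ℕ∞) f)
    (hg : ContDiff ℝ ((⊤ : ℕ∞) : WithTop ℕ∞) g) (h₁0 : 0 ≤ h₁) (h₂0 : 0 ≤ h₂)
    (H₁ : DerivBound h₁ A f x) (H₂ : DerivBound h₂ B g x) :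
    DerivBound (h₁ + h₂) (A * B) (fun y => f y * g y) x := by
  intro n
  have hA := H₁.nonneg
  have hB := H₂.nonneg
  refine (norm_iteratedFDeriv_mul_le hf hg x
    (n := n) (by exact_mod_cast le_top)).trans ?_
  rw [add_pow, Finset.sum_mul, Finset.mul_sum]
  refine Finset.sum_le_sum fun i hi => ?_
  have hi' : i ≤ n := by simpa [Nat.lt_succ_iff] using hi
  calc _ ≤ (n.choose i : ℝ) * (A * (h₁ ^ i * √(i.factorial : ℝ))) *
        (B * (h₂ ^ (n - i) * √((n - i).factorial : ℝ))) := by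
        gcongr
        · exact H₁ i
        · exact H₂ (n - i)
    _ = A * B * (h₁ ^ i * h₂ ^ (n - i) * n.choose i) * (√(i.factorial : ℝ) * √((n - i).factorial : ℝ)) := by ring
    _ ≤ A * B * (h₁ ^ i * h₂ ^ (n - i) * n.choose i) * √(n.factorial : ℝ) := by
        gcongr
        exact sqrt_factorial_mul_le hi'
    _ = _ := by ring

theorem DerivBound.add {h A B : ℝ} {f g : V → ℂ} {x : V} (hf : ContDiff ℝ ((⊤ : ℕ∞) : WithTop ℕ∞) f)
    (hg : ContDiff ℝ ((⊤ : ℕ∞) : WithTop ℕ∞) g) (H₁ : DerivBound h A f x) (H₂ : DerivBound h B g x) :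
    DerivBound h (A + B) (fun y => f y + g y) x := by
  intro n
  have e : iteratedFDeriv ℝ n (fun y => f y + g y) x = iteratedFDeriv ℝ n f x + iteratedFDeriv ℝ n g x :=
    iteratedFDeriv_add_apply ((hf.of_le (by exact_mod_cast le_top)).contDiffAt)
      ((hg.of_le (by exact_mod_cast le_top)).contDiffAt)
  rw [e, add_mul]
  exact (norm_add_le _ _).trans (add_le_add (H₁ n) (H₂ n))

theorem DerivBound.const_mul {h A : ℝ} {f : V → ℂ} {x : V} (hf : ContDiff ℝ ((⊤ : ℕ∞) : WithTop ℕ∞) f)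
    (H : DerivBound h A f x) (c : ℂ) : DerivBound h (‖c‖ * A) (fun y => c * f y) x := by
  intro n
  have e : iteratedFDeriv ℝ n (fun y => c * f y) x = c • iteratedFDeriv ℝ n f x :=
    iteratedFDeriv_const_smul_apply (a := c) ((hf.of_le (by exact_mod_cast le_top)).contDiffAt)
  rw [e, norm_smul, mul_assoc]
  exact mul_le_mul_of_nonneg_left (H n) (norm_nonneg c)

theorem DerivBound.conj {h A : ℝ} {f : V → ℂ} {x : V} (H : DerivBound h A f x) :
    DerivBound h A (fun y => conj (f y)) x := by
  intro n
  have := Complex.conjLIE.norm_iteratedFDeriv_comp_left (𝕜 := ℝ) f x n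
  exact this.trans_le (H n)

theorem DerivBound.comp_sub {h A : ℝ} {f : V → ℂ} {x y : V} (H : DerivBound h A f (y - x)) :
    DerivBound h A (fun z => f (z - x)) y := by
  intro n
  rw [iteratedFDeriv_comp_sub]
  exact H n

theorem GaussBound.nonneg {a h M : ℝ} {f : V → ℂ} (H : GaussBound a h M f) : 0 ≤ M := by
  have := (H 0).nonneg
  simpa using this

theorem GaussBound.mono {a a' h h' M M' : ℝ} {f : V → ℂ} (H : GaussBound a h M f) (h0 : 0 ≤ h)
    (ha : a' ≤ a) (hh : h ≤ h') (hM : M ≤ M') : GaussBound a' h' M' f := fun x => by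
  have := H.nonneg.trans hM
  refine (H x).mono h0 hh ?_
  gcongr

/-- For each fixed order n, `decay_of_moments` sums the polynomial moments of the n-th derivative.
-/
theorem GSBound.gaussBound {h M : ℝ} {f : V → ℂ} (hh : 0 < h) (H : GSBound h M f) :
    GaussBound (4 * h ^ 2)⁻¹ h (2 * M) f := by
  intro x n
  have hM : 0 ≤ M := by
    have := H 0 0 x
    simp at this
    exact (norm_nonneg _).trans this
  have := decay_of_moments (r := ‖x‖) (s := ‖iteratedFDeriv ℝ n f x‖)
    (M := M * (h ^ n * √(n.factorial : ℝ))) hh (by positivity) (fun k => by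
      refine (H k n x).trans (le_of_eq ?_)
      rw [Real.sqrt_mul (by positivity), pow_add]; ring)
  refine this.trans (le_of_eq ?_)
  ring

theorem GaussBound.gsBound {a h h' M : ℝ} {f : V → ℂ} (ha : 0 < a) (h0 : 0 ≤ h) (hh : h ≤ h')
    (hh' : (√(2 * a))⁻¹ ≤ h') (H : GaussBound a h M f) : GSBound h' M f := by
  intro k n x
  have hM := H.nonneg
  have h'0 : 0 ≤ h' := h0.trans hh
  have h1 := pow_le_sqrt_factorial_mul_exp ha ‖x‖ k
  calc ‖x‖ ^ k * ‖iteratedFDeriv ℝ n f x‖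
      ≤ ((√(2 * a))⁻¹ ^ k * √(k.factorial : ℝ) * Real.exp (a * ‖x‖ ^ 2)) *
        (M * Real.exp (-a * ‖x‖ ^ 2) * (h ^ n * √(n.factorial : ℝ))) := by
        gcongr
        exact H x n
    _ = (√(2 * a))⁻¹ ^ k * √(k.factorial : ℝ) * (M * (h ^ n * √(n.factorial : ℝ))) *
        (Real.exp (a * ‖x‖ ^ 2) * Real.exp (-a * ‖x‖ ^ 2)) := by ring
    _ = (√(2 * a))⁻¹ ^ k * √(k.factorial : ℝ) * (M * (h ^ n * √(n.factorial : ℝ))) := by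
        rw [← Real.exp_add]; simp
    _ ≤ h' ^ k * √(k.factorial : ℝ) * (M * (h' ^ n * √(n.factorial : ℝ))) := by gcongr
    _ = _ := by rw [Real.sqrt_mul (by positivity), pow_add]; ring

/-- The working description of the space: Gaussian decay replaces the powers of ‖x‖, which suits
products, translations and superpositions. -/
theorem mem_gelfandShilov_iff {f : V → ℂ} : f ∈ GelfandShilov V ↔
    ContDiff ℝ ((⊤ : ℕ∞) : WithTop ℕ∞) f ∧ ∃ a > 0, ∃ h > 0, ∃ M, GaussBound a h M f := by
  constructor
  · rintro ⟨hf, h, hh, M, H⟩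
    exact ⟨hf, _, by positivity, h, hh, _, H.gaussBound hh⟩
  · rintro ⟨hf, a, ha, h, hh, M, H⟩
    exact ⟨hf, max h (√(2 * a))⁻¹, lt_max_of_lt_left hh, M,
      H.gsBound ha hh.le (le_max_left _ _) (le_max_right _ _)⟩

theorem IsGSDistribution.exists_gaussBound {u : GelfandShilov V → ℂ} (hu : IsGSDistribution u) {a h : ℝ}
    (ha : 0 < a) (hh : 0 < h) : ∃ C : ℝ, 0 ≤ C ∧ ∀ (θ : GelfandShilov V) (M : ℝ),
      GaussBound a h M (θ : V → ℂ) → ‖u θ‖ ≤ C * M := by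
  obtain ⟨C, hC⟩ := hu.bounded (max h (√(2 * a))⁻¹) (lt_max_of_lt_left hh)
  refine ⟨max C 0, le_max_right _ _, fun θ M H => ?_⟩
  refine (hC θ M (H.gsBound ha hh.le (le_max_left _ _) (le_max_right _ _))).trans ?_
  have := H.nonneg
  gcongr
  exact le_max_left _ _

theorem conj_mem_gelfandShilov {f : V → ℂ} (hf : f ∈ GelfandShilov V) :
    (fun y => conj (f y)) ∈ GelfandShilov V := by
  rw [mem_gelfandShilov_iff] at hf ⊢
  obtain ⟨hf, a, ha, h, hh, M, H⟩ := hf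
  exact ⟨Complex.conjCLE.contDiff.comp hf, a, ha, h, hh, M, fun x => (H x).conj⟩

theorem GaussBound.norm_le {a h M : ℝ} {f : V → ℂ} (H : GaussBound a h M f) (x : V) :
    ‖f x‖ ≤ M * Real.exp (-a * ‖x‖ ^ 2) := by
  simpa using H x 0

end DerivBound

/-! ### Time-frequency shifts of a window. -/

section Shift

variable {V : Type*} [NormedAddCommGroup V] [InnerProductSpace ℝ V]

/-- The time-frequency shift `y ↦ conj (φ (y - x)) e^{-i⟨y,ξ⟩}`. -/
noncomputable def tfShift (φ : V → ℂ) (x ξ y : V) : ℂ := conj (φ (y - x)) * expNeg ξ y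

theorem expNeg_eq (ξ : V) : expNeg ξ = (fun t : ℝ => Complex.exp ((-Complex.I) * t)) ∘ innerSL ℝ ξ := by
  ext y
  simp [expNeg, real_inner_comm]

theorem contDiff_expNeg (ξ : V) : ContDiff ℝ ((⊤ : ℕ∞) : WithTop ℕ∞) (expNeg ξ) := by
  rw [expNeg_eq]
  refine ContDiff.comp ?_ (innerSL ℝ ξ).contDiff
  exact Complex.contDiff_exp.comp (contDiff_const.mul Complex.ofRealCLM.contDiff)

/-- The character is t ↦ e^{-it} composed with the functional ⟨ξ, ·⟩, whose norm is ‖ξ‖. -/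
theorem norm_iteratedFDeriv_expNeg_le (ξ y : V) (n : ℕ) :
    ‖iteratedFDeriv ℝ n (expNeg ξ) y‖ ≤ ‖ξ‖ ^ n := by
  rw [expNeg_eq]
  have hc : ContDiff ℝ ((⊤ : ℕ∞) : WithTop ℕ∞) (fun t : ℝ => Complex.exp ((-Complex.I) * t)) :=
    Complex.contDiff_exp.comp (contDiff_const.mul Complex.ofRealCLM.contDiff)
  rw [ContinuousLinearMap.iteratedFDeriv_comp_right (innerSL ℝ ξ) hc y (i := n) (by exact_mod_cast le_top)]
  refine (ContinuousMultilinearMap.norm_compContinuousLinearMap_le _ _).trans ?_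
  rw [norm_iteratedFDeriv_eq_norm_iteratedDeriv, Finset.prod_const, Finset.card_univ, Fintype.card_fin,
    innerSL_apply_norm]
  have : ∀ n : ℕ, iteratedDeriv n (fun t : ℝ => Complex.exp ((-Complex.I) * t)) =
      fun t : ℝ => (-Complex.I) ^ n * Complex.exp ((-Complex.I) * t) := by
    intro n
    induction n with
    | zero => simp
    | succ n ih =>
      rw [iteratedDeriv_succ, ih]
      ext t
      have h1 : HasDerivAt (fun t : ℝ => Complex.exp ((-Complex.I) * t))
          (Complex.exp ((-Complex.I) * t) * ((-Complex.I) * 1)) t :=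
        (((hasDerivAt_id _).ofReal_comp).const_mul _).cexp
      rw [(h1.const_mul _).deriv]
      ring
  rw [this]
  have e : ‖Complex.exp (-Complex.I * ((innerSL ℝ ξ y : ℝ) : ℂ))‖ = 1 := by
    rw [Complex.norm_exp]; simp
  rw [norm_mul, e, norm_pow]
  simp

theorem norm_expNeg (ξ y : V) : ‖expNeg ξ y‖ = 1 := by
  rw [expNeg, Complex.norm_exp]; simp

theorem derivBound_expNeg {b : ℝ} (hb : 0 < b) (ξ y : V) :
    DerivBound (√(2 * b))⁻¹ (Real.exp (b * ‖ξ‖ ^ 2)) (expNeg ξ) y := fun n =>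
  (norm_iteratedFDeriv_expNeg_le ξ y n).trans
    ((pow_le_sqrt_factorial_mul_exp hb ‖ξ‖ n).trans (le_of_eq (by ring)))

theorem contDiff_tfShift {φ : V → ℂ} (hφ : ContDiff ℝ ((⊤ : ℕ∞) : WithTop ℕ∞) φ) (x ξ : V) :
    ContDiff ℝ ((⊤ : ℕ∞) : WithTop ℕ∞) (tfShift φ x ξ) :=
  (Complex.conjCLE.contDiff.comp (hφ.comp (contDiff_id.sub contDiff_const))).mul (contDiff_expNeg ξ)

theorem GaussBound.comp_sub {a h M : ℝ} {φ : V → ℂ} (ha : 0 ≤ a) (h0 : 0 ≤ h) (H : GaussBound a h M φ) (x : V) :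
    GaussBound (a / 2) h (M * Real.exp (a * ‖x‖ ^ 2)) (fun y => φ (y - x)) := by
  intro y
  refine ((H (y - x)).mono h0 le_rfl ?_).comp_sub
  have := H.nonneg
  rw [mul_assoc, ← Real.exp_add]
  gcongr
  linarith [neg_mul_norm_sub_sq_le ha x y]

/-- The rate a/2 and the constant `h + (√(2 * b))⁻¹` do not depend on (x, ξ): all shifts lie in one
space, and their size grows at most like a Gaussian of rate b. The condition a ≤ b absorbs the
growth e^{a‖x‖²} caused by the translation. -/
theorem gaussBound_tfShift {a b h M : ℝ} {φ : V → ℂ} (hφ : ContDiff ℝ ((⊤ : ℕ∞) : WithTop ℕ∞) φ)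
    (ha : 0 < a) (hab : a ≤ b) (h0 : 0 ≤ h) (H : GaussBound a h M φ) (x ξ : V) :
    GaussBound (a / 2) (h + (√(2 * b))⁻¹) (M * Real.exp (b * (‖x‖ ^ 2 + ‖ξ‖ ^ 2))) (tfShift φ x ξ) := by
  intro y
  have h1 := DerivBound.mul (Complex.conjCLE.contDiff.comp (hφ.comp (contDiff_id.sub contDiff_const)))
    (contDiff_expNeg ξ) h0 (by positivity) (H.comp_sub ha.le h0 x y).conj
    (derivBound_expNeg (ha.trans_le hab) ξ y)
  refine DerivBound.mono h1 (by positivity) le_rfl ?_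
  have := H.nonneg
  have e : M * Real.exp (b * (‖x‖ ^ 2 + ‖ξ‖ ^ 2)) * Real.exp (-(a / 2) * ‖y‖ ^ 2) =
    M * Real.exp (b * ‖x‖ ^ 2) * Real.exp (-(a / 2) * ‖y‖ ^ 2) * Real.exp (b * ‖ξ‖ ^ 2) := by
    rw [mul_add, Real.exp_add]; ring
  rw [e]
  gcongr

theorem tfShift_mem {φ : V → ℂ} (hφ : φ ∈ GelfandShilov V) (x ξ : V) : tfShift φ x ξ ∈ GelfandShilov V := by
  rw [mem_gelfandShilov_iff] at hφ ⊢
  obtain ⟨hf, a, ha, h, hh, M, H⟩ := hφ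
  exact ⟨contDiff_tfShift hf x ξ, a / 2, by positivity, _, by positivity, _, gaussBound_tfShift hf ha le_rfl hh.le H x ξ⟩

end Shift

/-! ### Continuity of the shifts in their parameters. -/

section ShiftContinuity

variable {V : Type*} [NormedAddCommGroup V] [InnerProductSpace ℝ V]

theorem sqrt_succ_factorial_le (n : ℕ) :
    √((n + 1).factorial : ℝ) ≤ 2 ^ n * √(n.factorial : ℝ) := by
  rw [Nat.factorial_succ, Nat.cast_mul, Real.sqrt_mul (by positivity)]
  gcongr
  rw [Real.sqrt_le_left (by positivity)]
  have h1 : n + 1 ≤ 2 ^ n := Nat.lt_two_pow_self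
  have h2 : n + 1 ≤ (2 ^ n) ^ 2 := h1.trans (Nat.le_self_pow (by norm_num) _)
  exact_mod_cast h2

/-- Mean value inequality for the n-th derivative on the segment between the two points. The bound
√(n+1)! ≤ 2^n √n! is why h becomes 2h. -/
theorem GaussBound.translate_sub {a h M R : ℝ} {φ : V → ℂ} (hφ : ContDiff ℝ ((⊤ : ℕ∞) : WithTop ℕ∞) φ)
    (ha : 0 ≤ a) (h0 : 0 ≤ h) (H : GaussBound a h M φ) {x x₀ : V} (hx : ‖x‖ ≤ R) (hx₀ : ‖x₀‖ ≤ R) :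
    GaussBound (a / 2) (2 * h) (M * h * Real.exp (a * R ^ 2) * ‖x - x₀‖) (fun y => φ (y - x) - φ (y - x₀)) := by
  intro y n
  have hc : ∀ z : V, ContDiffAt ℝ n (fun y => φ (y - z)) y := fun z =>
    ((hφ.comp (contDiff_id.sub contDiff_const)).of_le (by exact_mod_cast le_top)).contDiffAt
  have e : iteratedFDeriv ℝ n (fun y => φ (y - x) - φ (y - x₀)) y =
      iteratedFDeriv ℝ n φ (y - x) - iteratedFDeriv ℝ n φ (y - x₀) := by
    rw [← iteratedFDeriv_comp_sub n x, ← iteratedFDeriv_comp_sub n x₀]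
    exact iteratedFDeriv_sub_apply (hc x) (hc x₀)
  have hM := H.nonneg
  set B := M * (h ^ (n + 1) * √((n + 1).factorial : ℝ)) * (Real.exp (a * R ^ 2) * Real.exp (-(a / 2) * ‖y‖ ^ 2))
    with hB
  have hd : ∀ z ∈ segment ℝ x₀ x, ‖z‖ ≤ R := by
    intro z hz
    have : segment ℝ x₀ x ⊆ Metric.closedBall 0 R :=
      (convex_closedBall (0 : V) R).segment_subset (by simpa using hx₀) (by simpa using hx)
    simpa using this hz
  have hmv : ‖iteratedFDeriv ℝ n φ (y - x) - iteratedFDeriv ℝ n φ (y - x₀)‖ ≤ B * ‖x - x₀‖ := by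
    have hdiff : Differentiable ℝ (iteratedFDeriv ℝ n φ) :=
      hφ.differentiable_iteratedFDeriv (by exact_mod_cast ENat.natCast_lt_top n)
    have key := (convex_segment (𝕜 := ℝ) (y - x₀) (y - x)).norm_image_sub_le_of_norm_fderiv_le (𝕜 := ℝ)
      (f := iteratedFDeriv ℝ n φ) (C := B) (fun w _ => hdiff w) (fun w hw => ?_)
      (left_mem_segment ℝ _ _) (right_mem_segment ℝ _ _)
    · have e2 : (y - x) - (y - x₀) = -(x - x₀) := by abel
      rw [e2, norm_neg] at key
      exact key
    · have hw' : y - w ∈ segment ℝ x₀ x := by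
        rw [segment_eq_image] at hw ⊢
        obtain ⟨t, ht, rfl⟩ := hw
        exact ⟨t, ht, by module⟩
      have hzR := hd _ hw'
      rw [norm_fderiv_iteratedFDeriv]
      refine (H w (n + 1)).trans ?_
      have e3 := neg_mul_norm_sub_sq_le ha (y - w) y
      rw [sub_sub_cancel] at e3
      have e4 : Real.exp (-a * ‖w‖ ^ 2) ≤ Real.exp (a * R ^ 2) * Real.exp (-(a / 2) * ‖y‖ ^ 2) := by
        rw [← Real.exp_add]
        apply Real.exp_le_exp.2
        have : a * ‖y - w‖ ^ 2 ≤ a * R ^ 2 := by gcongr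
        linarith
      calc _ ≤ M * (Real.exp (a * R ^ 2) * Real.exp (-(a / 2) * ‖y‖ ^ 2)) *
            (h ^ (n + 1) * √((n + 1).factorial : ℝ)) := by gcongr
        _ = B := by rw [hB]; ring
  rw [e]
  refine hmv.trans ?_
  have h5 := sqrt_succ_factorial_le n
  calc B * ‖x - x₀‖ ≤ M * (h ^ (n + 1) * (2 ^ n * √(n.factorial : ℝ))) *
        (Real.exp (a * R ^ 2) * Real.exp (-(a / 2) * ‖y‖ ^ 2)) * ‖x - x₀‖ := by
        rw [hB]; gcongr
    _ = _ := by rw [mul_pow, pow_succ]; ring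

/-- Order zero uses |e^{it} - 1| ≤ |t|, which costs the factor ‖y‖. In higher order the constant 1
disappears, and powers of ‖ζ‖ are at most ‖ζ‖ because ‖ζ‖ ≤ 1. -/
theorem derivBound_expNeg_sub_one {ζ : V} (hζ : ‖ζ‖ ≤ 1) (y : V) :
    DerivBound 1 (‖ζ‖ * (1 + ‖y‖)) (fun y => expNeg ζ y - 1) y := by
  intro n
  rw [one_pow, one_mul]
  rcases n with _ | n
  · simp only [norm_iteratedFDeriv_zero, Nat.factorial_zero, Nat.cast_one, Real.sqrt_one, mul_one]
    have h1 : ‖expNeg ζ y - 1‖ ≤ |⟪y, ζ⟫_ℝ| := by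
      have := Real.norm_exp_I_mul_ofReal_sub_one_le (x := -⟪y, ζ⟫_ℝ)
      rw [expNeg]
      simpa using this
    refine h1.trans ((abs_real_inner_le_norm y ζ).trans ?_)
    nlinarith [norm_nonneg ζ, norm_nonneg y]
  · have e : iteratedFDeriv ℝ (n + 1) (fun y => expNeg ζ y - 1) y = iteratedFDeriv ℝ (n + 1) (expNeg ζ) y := by
      have := iteratedFDeriv_sub_apply (𝕜 := ℝ) (i := n + 1) (f := expNeg ζ) (g := fun _ : V => (1 : ℂ)) (x := y)
        ((contDiff_expNeg ζ).of_le (by exact_mod_cast le_top)).contDiffAt contDiffAt_const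
      have h0 := iteratedFDeriv_const_of_ne (𝕜 := ℝ) (E := V) (n := n + 1) (by omega) (1 : ℂ)
      rw [h0, Pi.zero_apply, sub_zero] at this
      exact this
    rw [e]
    refine (norm_iteratedFDeriv_expNeg_le ζ y (n + 1)).trans ?_
    have h1 : ‖ζ‖ ^ (n + 1) ≤ ‖ζ‖ := by
      simpa using pow_le_of_le_one (norm_nonneg ζ) hζ (Nat.succ_ne_zero n)
    have h2 : (1 : ℝ) ≤ √((n + 1).factorial : ℝ) := by
      rw [Real.one_le_sqrt]
      exact_mod_cast Nat.factorial_pos (n + 1)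
    have h3 := norm_nonneg y
    have h4 := norm_nonneg ζ
    calc _ ≤ ‖ζ‖ * 1 * 1 := by linarith
      _ ≤ _ := by gcongr; linarith

theorem expNeg_add (ξ η y : V) : expNeg (ξ + η) y = expNeg ξ y * expNeg η y := by
  rw [expNeg, expNeg, expNeg, ← Complex.exp_add, inner_add_right]
  congr 1
  push_cast
  ring

theorem one_add_le_exp {c r : ℝ} (hc : 0 < c) : 1 + r ≤ (1 + c⁻¹) * Real.exp (c * r ^ 2) := by
  have h1 := Real.add_one_le_exp (c * r ^ 2)
  have h2 : (1 + c⁻¹) * (c * r ^ 2 + 1) ≤ (1 + c⁻¹) * Real.exp (c * r ^ 2) := by gcongr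
  refine le_trans ?_ h2
  have : (1 + c⁻¹) * (c * r ^ 2 + 1) = c * r ^ 2 + 1 + r ^ 2 + c⁻¹ := by field_simp; ring
  rw [this]
  have h3 : r ≤ r ^ 2 + 1 / 4 := by nlinarith [sq_nonneg (r - 1 / 2)]
  have h4 : (1 : ℝ) ≤ c + c⁻¹ + 1 := by have := inv_pos.2 hc; linarith
  have h5 : r ≤ c * r ^ 2 + (4 * c)⁻¹ := by
    have : c * r ^ 2 + (4 * c)⁻¹ - r = c * (r - (2 * c)⁻¹) ^ 2 := by field_simp; ring
    have := mul_nonneg hc.le (sq_nonneg (r - (2 * c)⁻¹))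
    linarith
  have h6 : (4 * c)⁻¹ ≤ c⁻¹ := by gcongr; linarith
  nlinarith [sq_nonneg r]

theorem gaussBound_tfShift_sub {a h M : ℝ} {φ : V → ℂ} (hφ : ContDiff ℝ ((⊤ : ℕ∞) : WithTop ℕ∞) φ)
    (ha : 0 < a) (h0 : 0 ≤ h) (H : GaussBound a h M φ) (x₀ ξ₀ : V) :
    ∃ C : ℝ, 0 ≤ C ∧ ∀ x ξ : V, ‖x - x₀‖ ≤ 1 → ‖ξ - ξ₀‖ ≤ 1 →
      GaussBound (a / 4) (2 * h + (√2)⁻¹ + 1) (C * (‖x - x₀‖ + ‖ξ - ξ₀‖))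
        (fun y => tfShift φ x ξ y - tfShift φ x₀ ξ₀ y) := by
  set R := ‖x₀‖ + 1
  set S := ‖ξ₀‖ + 1
  have hM := H.nonneg
  set C₁ := M * h * Real.exp (a * R ^ 2) * Real.exp (S ^ 2)
  set C₂ := M * Real.exp (a * R ^ 2) * Real.exp (S ^ 2) * (1 + (a / 4)⁻¹)
  refine ⟨C₁ + C₂, by positivity, fun x ξ hx hξ y => ?_⟩
  have hxR : ‖x‖ ≤ R := by
    have := norm_add_le (x - x₀) x₀
    rw [sub_add_cancel] at this
    linarith
  have hξS : ‖ξ‖ ≤ S := by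
    have := norm_add_le (ξ - ξ₀) ξ₀
    rw [sub_add_cancel] at this
    linarith
  have hφc : ∀ z : V, ContDiff ℝ ((⊤ : ℕ∞) : WithTop ℕ∞) (fun y => φ (y - z)) := fun z =>
    hφ.comp (contDiff_id.sub contDiff_const)
  have hcc : ∀ z : V, ContDiff ℝ ((⊤ : ℕ∞) : WithTop ℕ∞) (fun y => conj (φ (y - z))) := fun z =>
    Complex.conjCLE.contDiff.comp (hφc z)
  have hexp : ∀ ζ : V, ‖ζ‖ ≤ S → DerivBound (√2)⁻¹ (Real.exp (S ^ 2)) (expNeg ζ) y := fun ζ hζ => by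
    have := derivBound_expNeg one_pos ζ y
    rw [mul_one] at this
    refine this.mono (by positivity) le_rfl ?_
    rw [one_mul]
    gcongr
  have hd1 : ContDiff ℝ ((⊤ : ℕ∞) : WithTop ℕ∞) (fun y => conj (φ (y - x) - φ (y - x₀))) :=
    Complex.conjCLE.contDiff.comp ((hφc x).sub (hφc x₀))
  have hd2 : ContDiff ℝ ((⊤ : ℕ∞) : WithTop ℕ∞) (fun y => expNeg (ξ - ξ₀) y - 1) :=
    (contDiff_expNeg _).sub contDiff_const
  have t1 := DerivBound.mul hd1 (contDiff_expNeg ξ) (by positivity) (by positivity)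
    (H.translate_sub hφ ha.le h0 hxR (x₀ := x₀) (by simp [R]) y).conj (hexp ξ hξS)
  have t2 := DerivBound.mul ((hcc x₀).mul (contDiff_expNeg ξ₀)) hd2 (by positivity) zero_le_one
    (DerivBound.mul (hcc x₀) (contDiff_expNeg ξ₀) h0 (by positivity) (H.comp_sub ha.le h0 x₀ y).conj
      (hexp ξ₀ (by simp [S]))) (derivBound_expNeg_sub_one hξ y)
  -- Telescoping: the window moves with the frequency fixed at ξ, then the frequency moves with the
  -- window fixed at x₀.
  have e : (fun y => tfShift φ x ξ y - tfShift φ x₀ ξ₀ y) = fun y =>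
      (conj (φ (y - x) - φ (y - x₀)) * expNeg ξ y) +
      (conj (φ (y - x₀)) * expNeg ξ₀ y * (expNeg (ξ - ξ₀) y - 1)) := by
    ext y
    have := expNeg_add ξ₀ (ξ - ξ₀) y
    rw [add_sub_cancel] at this
    simp only [tfShift, map_sub]
    rw [this]
    ring
  rw [e]
  have hs : 0 ≤ (√2)⁻¹ := by positivity
  have f1 := t1.mono (A' := C₁ * ‖x - x₀‖ * Real.exp (-(a / 4) * ‖y‖ ^ 2)) (h' := 2 * h + (√2)⁻¹ + 1)
    (by positivity) (by linarith) (by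
      calc _ = C₁ * ‖x - x₀‖ * Real.exp (-(a / 2) * ‖y‖ ^ 2) := by ring
        _ ≤ _ := by
          gcongr
          linarith)
  -- The linear factor 1 + ‖y‖ is absorbed by e^{a‖y‖²/4}, which lowers the decay rate from a/2 to
  -- a/4.
  have f2 := t2.mono (A' := C₂ * ‖ξ - ξ₀‖ * Real.exp (-(a / 4) * ‖y‖ ^ 2)) (h' := 2 * h + (√2)⁻¹ + 1)
    (by positivity) (by linarith) (by
      have h1 := one_add_le_exp (c := a / 4) (r := ‖y‖) (by positivity)
      calc _ ≤ M * Real.exp (a * R ^ 2) * Real.exp (-(a / 2) * ‖y‖ ^ 2) * Real.exp (S ^ 2) *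
            (‖ξ - ξ₀‖ * ((1 + (a / 4)⁻¹) * Real.exp (a / 4 * ‖y‖ ^ 2))) := by
              gcongr
              simp [R]
        _ = C₂ * ‖ξ - ξ₀‖ * (Real.exp (-(a / 2) * ‖y‖ ^ 2) * Real.exp (a / 4 * ‖y‖ ^ 2)) := by ring
        _ = _ := by rw [← Real.exp_add]; congr 2; ring)
  refine (f1.add (hd1.mul (contDiff_expNeg ξ)) (((hcc x₀).mul (contDiff_expNeg ξ₀)).mul hd2) f2).mono
    (by positivity) le_rfl ?_
  rw [← add_mul]
  gcongr
  have : 0 ≤ C₁ := by positivity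
  have : 0 ≤ C₂ := by positivity
  nlinarith [norm_nonneg (x - x₀), norm_nonneg (ξ - ξ₀)]

end ShiftContinuity

/-! ### Embedding of Gaussian-bounded functions in a Banach space of jets. -/

section Embedding

section Weight

variable {V : Type*} [NormedAddCommGroup V]

/-- The weight which normalizes the derivative of order `i.1` at `i.2`. -/
noncomputable def jetWeight (a h : ℝ) (i : ℕ × V) : ℝ :=
  Real.exp (a * ‖i.2‖ ^ 2) / (h ^ i.1 * √(i.1.factorial : ℝ))

theorem jetWeight_pos {a h : ℝ} (hh : 0 < h) (i : ℕ × V) : 0 < jetWeight a h i := by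
  have := i.1.factorial_pos
  rw [jetWeight]
  positivity

theorem jetWeight_inv (a h : ℝ) (i : ℕ × V) :
    (jetWeight a h i)⁻¹ = Real.exp (-a * ‖i.2‖ ^ 2) * (h ^ i.1 * √(i.1.factorial : ℝ)) := by
  rw [jetWeight, inv_div, neg_mul, Real.exp_neg]
  ring

end Weight

variable {V : Type*} [NormedAddCommGroup V] [NormedSpace ℝ V]

variable (V) in
/-- The Banach space of bounded families of multilinear maps in which the derivatives of
a Gelfand-Shilov function are recorded. -/
abbrev JetSpace : Type _ := lp (fun i : ℕ × V => V [×i.1]→L[ℝ] ℂ) ⊤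

theorem gaussBound_iff_jetWeight {a h M : ℝ} (hh : 0 < h) {f : V → ℂ} :
    GaussBound a h M f ↔ ∀ i : ℕ × V, ‖(jetWeight a h i : ℝ) • iteratedFDeriv ℝ i.1 f i.2‖ ≤ M := by
  have key : ∀ i : ℕ × V, ‖(jetWeight a h i : ℝ) • iteratedFDeriv ℝ i.1 f i.2‖ ≤ M ↔
      ‖iteratedFDeriv ℝ i.1 f i.2‖ ≤ M * Real.exp (-a * ‖i.2‖ ^ 2) * (h ^ i.1 * √(i.1.factorial : ℝ)) := by
    intro i
    have hw := jetWeight_pos (a := a) hh i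
    rw [norm_smul, Real.norm_of_nonneg hw.le, mul_assoc, ← jetWeight_inv, ← div_eq_mul_inv, le_div_iff₀ hw,
      mul_comm]
  constructor
  · intro H i
    exact (key i).2 (H i.2 i.1)
  · intro H x n
    exact (key (n, x)).1 (H (n, x))

variable (V) in
/-- The functions which obey a bound `‖D^n f(x)‖ ≤ M h^n √n! e^{-a|x|²}`. -/
def gaussBoundSubmodule (a h : ℝ) : Submodule ℂ (V → ℂ) where
  carrier := {f | ContDiff ℝ ((⊤ : ℕ∞) : WithTop ℕ∞) f ∧ ∃ M, GaussBound a h M f}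
  zero_mem' := by
    refine ⟨contDiff_const, 0, fun x n => ?_⟩
    have h0 : iteratedFDeriv ℝ n (0 : V → ℂ) = 0 := iteratedFDeriv_fun_zero
    simp [h0]
  add_mem' := by
    rintro f g ⟨hf, M, hM⟩ ⟨hg, M', hM'⟩
    refine ⟨hf.add hg, M + M', fun x => ?_⟩
    rw [add_mul]
    exact (hM x).add hf hg (hM' x)
  smul_mem' := by
    rintro c f ⟨hf, M, hM⟩
    refine ⟨hf.const_smul c, ‖c‖ * M, fun x => ?_⟩
    rw [mul_assoc]
    exact (hM x).const_mul hf c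

theorem gaussBoundSubmodule_le {a h : ℝ} (ha : 0 < a) (hh : 0 < h) :
    gaussBoundSubmodule V a h ≤ GelfandShilov V := by
  rintro f ⟨hf, M, hM⟩
  exact mem_gelfandShilov_iff.2 ⟨hf, a, ha, h, hh, M, hM⟩

/-- The family of all normalized derivatives of a function. -/
noncomputable def jet {a h : ℝ} (hh : 0 < h) : gaussBoundSubmodule V a h →ₗ[ℂ] JetSpace V where
  toFun f := ⟨fun i => (jetWeight a h i : ℝ) • iteratedFDeriv ℝ i.1 (f : V → ℂ) i.2, by
    obtain ⟨M, hM⟩ := f.2.2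
    refine memℓp_infty ⟨M, ?_⟩
    rintro _ ⟨i, rfl⟩
    exact (gaussBound_iff_jetWeight hh).1 hM i⟩
  map_add' f g := by
    ext1
    funext i
    have e : iteratedFDeriv ℝ i.1 ((f : V → ℂ) + (g : V → ℂ)) i.2 =
        iteratedFDeriv ℝ i.1 (f : V → ℂ) i.2 + iteratedFDeriv ℝ i.1 (g : V → ℂ) i.2 :=
      iteratedFDeriv_add_apply ((f.2.1.of_le (by exact_mod_cast le_top)).contDiffAt)
        ((g.2.1.of_le (by exact_mod_cast le_top)).contDiffAt)
    change jetWeight a h i • iteratedFDeriv ℝ i.1 ((f : V → ℂ) + (g : V → ℂ)) i.2 = _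
    rw [e, smul_add]
    rfl
  map_smul' c f := by
    ext1
    funext i
    have e : iteratedFDeriv ℝ i.1 (c • (f : V → ℂ)) i.2 = c • iteratedFDeriv ℝ i.1 (f : V → ℂ) i.2 :=
      iteratedFDeriv_const_smul_apply ((f.2.1.of_le (by exact_mod_cast le_top)).contDiffAt)
    change jetWeight a h i • iteratedFDeriv ℝ i.1 (c • (f : V → ℂ)) i.2 = _
    rw [e, smul_comm]
    rfl

theorem jet_apply {a h : ℝ} (hh : 0 < h) (f : gaussBoundSubmodule V a h) (i : ℕ × V) :
    jet hh f i = (jetWeight a h i : ℝ) • iteratedFDeriv ℝ i.1 (f : V → ℂ) i.2 := rfl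

/-- The weight makes the supremum norm of the jet the best constant in the Gaussian bound, so
boundedness of a distribution becomes boundedness in norm on the range of `jet`. -/
theorem norm_jet_le_iff {a h M : ℝ} (hh : 0 < h) (f : gaussBoundSubmodule V a h) (hM : 0 ≤ M) :
    ‖jet hh f‖ ≤ M ↔ GaussBound a h M (f : V → ℂ) := by
  rw [gaussBound_iff_jetWeight hh]
  constructor
  · intro H i
    rw [← jet_apply hh]
    exact (lp.norm_apply_le_norm (by simp) _ i).trans H
  · intro H
    exact lp.norm_le_of_forall_le hM H

theorem jet_injective {a h : ℝ} (hh : 0 < h) : Function.Injective (jet (V := V) (a := a) hh) := by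
  rw [injective_iff_map_eq_zero]
  intro f hf
  have := (norm_jet_le_iff hh f le_rfl).1 (by rw [hf, norm_zero])
  ext x
  have := this.norm_le x
  simpa using this

theorem gsPair_of_mem {u : GelfandShilov V → ℂ} {f : V → ℂ} (hf : f ∈ GelfandShilov V) :
    gsPair u f = u ⟨f, hf⟩ := by
  rw [gsPair, dif_pos hf]

/-- A distribution factors through a continuous functional on the space of jets. -/
theorem IsGSDistribution.exists_functional {u : GelfandShilov V → ℂ} (hu : IsGSDistribution u) {a h : ℝ}
    (ha : 0 < a) (hh : 0 < h) :
    ∃ F : JetSpace V →L[ℂ] ℂ, ∀ f : gaussBoundSubmodule V a h, F (jet hh f) = gsPair u (f : V → ℂ) := by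
  obtain ⟨C, hC0, hC⟩ := hu.exists_gaussBound ha hh
  let u₀ : gaussBoundSubmodule V a h →ₗ[ℂ] ℂ :=
    { toFun := fun f => u ⟨f, gaussBoundSubmodule_le ha hh f.2⟩
      map_add' := fun f g => hu.linear.map_add ⟨f, gaussBoundSubmodule_le ha hh f.2⟩
        ⟨g, gaussBoundSubmodule_le ha hh g.2⟩
      map_smul' := fun c f => hu.linear.map_smul c ⟨f, gaussBoundSubmodule_le ha hh f.2⟩ }
  let e := LinearEquiv.ofInjective (jet (V := V) (a := a) hh) (jet_injective hh)
  let g : (jet (V := V) (a := a) hh).range →ₗ[ℂ] ℂ := u₀.comp e.symm.toLinearMap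
  have hg : ∀ x, ‖g x‖ ≤ C * ‖x‖ := by
    intro x
    obtain ⟨f, rfl⟩ := e.surjective x
    have h1 : g (e f) = u₀ f := by simp [g]
    rw [h1]
    have h2 : ‖e f‖ = ‖jet hh f‖ := rfl
    rw [h2]
    exact hC ⟨f, gaussBoundSubmodule_le ha hh f.2⟩ _ ((norm_jet_le_iff hh f (norm_nonneg _)).1 le_rfl)
  -- Hahn–Banach extends the functional from the range of `jet` to the whole complete space, where
  -- it commutes with Bochner integrals.
  obtain ⟨F, hF, -⟩ := exists_extension_norm_eq _ (g.mkContinuous C hg)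
  refine ⟨F, fun f => ?_⟩
  have h1 := hF (e f)
  have h2 : ((e f : (jet (V := V) (a := a) hh).range) : JetSpace V) = jet hh f := rfl
  rw [h2] at h1
  rw [h1, gsPair_of_mem (gaussBoundSubmodule_le ha hh f.2)]
  simp [g, u₀]

/-- A Bochner integral of jets is the jet of the integrated function. -/
theorem exists_jet_eq_integral {a h : ℝ} (ha : 0 < a) (hh : 0 < h) {T : Type*} [MeasurableSpace T] {μ : Measure T}
    (f : T → gaussBoundSubmodule V a h) (hf : Integrable (fun t => jet hh (f t)) μ) :
    ∃ g : gaussBoundSubmodule V a h, (∀ y, (g : V → ℂ) y = ∫ t, (f t : V → ℂ) y ∂μ) ∧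
      jet hh g = ∫ t, jet hh (f t) ∂μ := by
  set I := ∫ t, jet hh (f t) ∂μ with hI
  have hint : ∀ n y, Integrable (fun t => iteratedFDeriv ℝ n (f t : V → ℂ) y) μ := by
    intro n y
    have h1 := ((lp.evalCLM ℂ (fun i : ℕ × V => V [×i.1]→L[ℝ] ℂ) ⊤ (n, y)).integrable_comp hf).smul
      ((jetWeight a h (n, y))⁻¹ : ℝ)
    refine h1.congr (Eventually.of_forall fun t => ?_)
    have hw := (jetWeight_pos (a := a) hh (n, y)).ne'
    change (jetWeight a h (n, y))⁻¹ • (jet hh (f t) (n, y)) = _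
    rw [jet_apply, inv_smul_smul₀ hw]
  have hIi : ∀ i : ℕ × V, I i = (jetWeight a h i : ℝ) • ∫ t, iteratedFDeriv ℝ i.1 (f t : V → ℂ) i.2 ∂μ := by
    intro i
    have h1 := (lp.evalCLM ℂ (fun i : ℕ × V => V [×i.1]→L[ℝ] ℂ) ⊤ i).integral_comp_comm hf
    rw [← integral_smul]
    exact h1.symm
  -- The candidate for the Taylor series integrates every derivative in t. Differentiation under the
  -- integral is dominated by the jet norm times a constant depending on the order.
  let p : V → FormalMultilinearSeries ℝ V ℂ := fun y n => ∫ t, iteratedFDeriv ℝ n (f t : V → ℂ) y ∂μ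
  have hbound : ∀ n t y, ‖iteratedFDeriv ℝ n (f t : V → ℂ) y‖ ≤
      ‖jet hh (f t)‖ * (h ^ n * √(n.factorial : ℝ)) := by
    intro n t y
    refine ((norm_jet_le_iff hh (f t) (norm_nonneg _)).1 le_rfl y n).trans ?_
    gcongr
    refine mul_le_of_le_one_right (norm_nonneg _) (Real.exp_le_one_iff.2 ?_)
    have := mul_nonneg ha.le (sq_nonneg ‖y‖)
    linarith
  have hder : ∀ (n : ℕ) y, HasFDerivAt (fun y => p y n) (p y n.succ).curryLeft y := by
    intro n y
    have hL := ContinuousLinearMap.integral_comp_comm (μ := μ) (𝕜 := ℝ) (Fₗ := V →L[ℝ] V [×n]→L[ℝ] ℂ)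
      ((continuousMultilinearCurryLeftEquiv ℝ (fun _ : Fin (n + 1) => V) ℂ).toContinuousLinearEquiv :
        (V [×n + 1]→L[ℝ] ℂ) →L[ℝ] (V →L[ℝ] V [×n]→L[ℝ] ℂ)) (hint (n + 1) y)
    have hcl : (p y n.succ).curryLeft = ∫ t, (iteratedFDeriv ℝ (n + 1) (f t : V → ℂ) y).curryLeft ∂μ := hL.symm
    rw [hcl]
    refine hasFDerivAt_integral_of_dominated_of_fderiv_le (s := Set.univ)
      (bound := fun t => ‖jet hh (f t)‖ * (h ^ (n + 1) * √((n + 1).factorial : ℝ)))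
      (F' := fun y t => (iteratedFDeriv ℝ (n + 1) (f t : V → ℂ) y).curryLeft)
      univ_mem (Eventually.of_forall fun x => (hint n x).1) (hint n y) ?_ ?_
      (hf.norm.mul_const _) ?_
    · exact (continuousMultilinearCurryLeftEquiv ℝ (fun _ : Fin (n + 1) => V) ℂ).continuous.comp_aestronglyMeasurable
        (hint (n + 1) y).1
    · refine Eventually.of_forall fun t x _ => ?_
      rw [ContinuousMultilinearMap.curryLeft_norm]
      exact hbound (n + 1) t x
    · refine Eventually.of_forall fun t x _ => ?_
      exact (f t).2.1.ftaylorSeries.fderiv n (by exact_mod_cast ENat.natCast_lt_top n) x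
  have hT : HasFTaylorSeriesUpTo ((⊤ : ℕ∞) : WithTop ℕ∞) (fun y => ∫ t, (f t : V → ℂ) y ∂μ) p := by
    refine ⟨fun y => ?_, fun n _ y => hder n y, fun n _ => ?_⟩
    · have hL := ContinuousLinearMap.integral_comp_comm (μ := μ)
        ((continuousMultilinearCurryFin0 ℝ V ℂ).toContinuousLinearEquiv :
          (V [×0]→L[ℝ] ℂ) →L[ℝ] ℂ) (hint 0 y)
      refine hL.symm.trans ?_
      congr 1
    · exact continuous_iff_continuousAt.2 fun y => (hder n y).continuousAt
  have hg1 : ContDiff ℝ ((⊤ : ℕ∞) : WithTop ℕ∞) (fun y => ∫ t, (f t : V → ℂ) y ∂μ) := hT.contDiff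
  have hg2 : ∀ i : ℕ × V, I i =
      (jetWeight a h i : ℝ) • iteratedFDeriv ℝ i.1 (fun y => ∫ t, (f t : V → ℂ) y ∂μ) i.2 := by
    intro i
    rw [hIi, ← hT.eq_iteratedFDeriv (by exact_mod_cast le_top) i.2]
  refine ⟨⟨fun y => ∫ t, (f t : V → ℂ) y ∂μ, hg1, ‖I‖, ?_⟩, fun y => rfl, ?_⟩
  · rw [gaussBound_iff_jetWeight hh]
    intro i
    rw [← hg2]
    exact lp.norm_apply_le_norm (by simp) _ i
  · ext1
    funext i
    rw [jet_apply, hg2]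

end Embedding

/-! ### Superpositions of time-frequency shifts. -/

section Synthesis

variable {V : Type*} [NormedAddCommGroup V] [InnerProductSpace ℝ V]

/-- All time-frequency shifts of a window lie in one of the spaces of functions with Gaussian bounds,
with slowly growing norms and continuous dependence. -/
theorem exists_tfShift_bound {φ : V → ℂ} (hφ : φ ∈ GelfandShilov V) {b : ℝ} (hb : 0 < b) :
    ∃ a > 0, ∃ h, ∃ hh : 0 < h, ∃ C : ℝ, 0 ≤ C ∧ ∃ S : V × V → gaussBoundSubmodule V a h,
      (∀ Z : V × V, (S Z : V → ℂ) = tfShift φ Z.1 Z.2) ∧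
      (∀ Z : V × V, GaussBound a h (C * Real.exp (b * (‖Z.1‖ ^ 2 + ‖Z.2‖ ^ 2))) (tfShift φ Z.1 Z.2)) ∧
      Continuous fun Z : V × V => jet hh (S Z) := by
  rw [mem_gelfandShilov_iff] at hφ
  obtain ⟨hf, a₁, ha₁, h, hh, M, H₁⟩ := hφ
  -- `gaussBound_tfShift` needs a decay rate at most b.
  set a := min a₁ b
  have ha : 0 < a := lt_min ha₁ hb
  have H : GaussBound a h M φ := H₁.mono hh.le (min_le_left _ _) le_rfl le_rfl
  have hs : 0 ≤ (√2)⁻¹ := by positivity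
  have hsb : 0 ≤ (√(2 * b))⁻¹ := by positivity
  -- One h, large enough for the shifts and for their differences, so that size and continuity are
  -- measured in the same space.
  have hb1 : ∀ Z : V × V, GaussBound (a / 4) (2 * h + (√2)⁻¹ + 1 + (√(2 * b))⁻¹)
      (M * Real.exp (b * (‖Z.1‖ ^ 2 + ‖Z.2‖ ^ 2))) (tfShift φ Z.1 Z.2) := fun Z =>
    (gaussBound_tfShift hf ha (min_le_right _ _) hh.le H Z.1 Z.2).mono (by positivity) (by linarith)
      (by linarith) le_rfl
  have hh' : 0 < 2 * h + (√2)⁻¹ + 1 + (√(2 * b))⁻¹ := by positivity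
  refine ⟨a / 4, by positivity, _, hh', M, H.nonneg,
    fun Z => ⟨tfShift φ Z.1 Z.2, contDiff_tfShift hf _ _, _, hb1 Z⟩, fun Z => rfl, hb1, ?_⟩
  rw [continuous_iff_continuousAt]
  intro Z₀
  obtain ⟨C, hC0, hC⟩ := gaussBound_tfShift_sub hf ha hh.le H Z₀.1 Z₀.2
  rw [ContinuousAt, tendsto_iff_norm_sub_tendsto_zero]
  refine squeeze_zero' (g := fun Z : V × V => C * (‖Z.1 - Z₀.1‖ + ‖Z.2 - Z₀.2‖))
    (Eventually.of_forall fun _ => norm_nonneg _) ?_ ?_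
  · filter_upwards [Metric.closedBall_mem_nhds Z₀ one_pos] with Z hZ
    rw [mem_closedBall_iff_norm, Prod.norm_def, max_le_iff] at hZ
    rw [← map_sub, norm_jet_le_iff hh' _ (by positivity)]
    exact (hC Z.1 Z.2 hZ.1 hZ.2).mono (by positivity) le_rfl (by linarith) le_rfl
  · have : Continuous fun Z : V × V => C * (‖Z.1 - Z₀.1‖ + ‖Z.2 - Z₀.2‖) := by fun_prop
    simpa using this.tendsto Z₀

theorem continuous_gsPair_tfShift {φ : V → ℂ} (hφ : φ ∈ GelfandShilov V) {u : GelfandShilov V → ℂ}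
    (hu : IsGSDistribution u) : Continuous fun Z : V × V => gsPair u (tfShift φ Z.1 Z.2) := by
  obtain ⟨a, ha, h, hh, C, hC, S, hS, hSb, hSc⟩ := exists_tfShift_bound hφ one_pos
  obtain ⟨F, hF⟩ := hu.exists_functional ha hh
  have := F.continuous.comp hSc
  refine this.congr fun Z => ?_
  rw [Function.comp_apply, hF, hS]

/-- The rate b > 0 is arbitrary. Hence the transform of a distribution can be integrated against any
Gaussian-decaying coefficient, however slow the decay. -/
theorem norm_gsPair_tfShift_le {φ : V → ℂ} (hφ : φ ∈ GelfandShilov V) {u : GelfandShilov V → ℂ}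
    (hu : IsGSDistribution u) {b : ℝ} (hb : 0 < b) : ∃ C : ℝ, 0 ≤ C ∧ ∀ x ξ : V,
      ‖gsPair u (tfShift φ x ξ)‖ ≤ C * Real.exp (b * (‖x‖ ^ 2 + ‖ξ‖ ^ 2)) := by
  obtain ⟨a, ha, h, hh, C, hC, S, hS, hSb, hSc⟩ := exists_tfShift_bound hφ hb
  obtain ⟨C', hC', hu'⟩ := hu.exists_gaussBound ha hh
  refine ⟨C' * C, by positivity, fun x ξ => ?_⟩
  have := hu' ⟨tfShift φ x ξ, tfShift_mem hφ x ξ⟩ _ (hSb (x, ξ))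
  rw [gsPair_of_mem (tfShift_mem hφ x ξ)]
  linarith

variable [FiniteDimensional ℝ V] [MeasurableSpace V] [BorelSpace V]

/-- Superpositions of time-frequency shifts with Gaussian coefficients are Gelfand-Shilov functions, and
distributions can be applied under the integral sign. -/
theorem synthesis {φ : V → ℂ} (hφ : φ ∈ GelfandShilov V) {b : ℝ} (hb : 0 < b) {T : Type*} [MeasurableSpace T]
    {μ : Measure T} {c : T → ℂ} {Z : T → V × V} (hZ : Measurable Z) (hc : AEStronglyMeasurable c μ)
    (hint : Integrable (fun t => ‖c t‖ * Real.exp (b * (‖(Z t).1‖ ^ 2 + ‖(Z t).2‖ ^ 2))) μ) :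
    (fun y => ∫ t, c t * tfShift φ (Z t).1 (Z t).2 y ∂μ) ∈ GelfandShilov V ∧
    (∀ u : GelfandShilov V → ℂ, IsGSDistribution u →
      gsPair u (fun y => ∫ t, c t * tfShift φ (Z t).1 (Z t).2 y ∂μ) =
        ∫ t, c t * gsPair u (tfShift φ (Z t).1 (Z t).2) ∂μ) := by
  obtain ⟨a, ha, h, hh, C, hC, S, hS, hSb, hSc⟩ := exists_tfShift_bound hφ hb
  have hcont : Integrable (fun t => jet hh (c t • S (Z t))) μ := by
    have e : ∀ t, jet hh (c t • S (Z t)) = c t • jet hh (S (Z t)) := fun t => map_smul _ _ _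
    simp_rw [e]
    -- The hypothesis `hint` dominates the norms of the jets, so their Bochner integral exists.
    refine Integrable.mono' (hint.const_mul C) (hc.smul (hSc.stronglyMeasurable.comp_measurable hZ).aestronglyMeasurable)
      (Eventually.of_forall fun t => ?_)
    rw [norm_smul]
    have h1 := (norm_jet_le_iff hh (S (Z t)) (M := C * Real.exp (b * (‖(Z t).1‖ ^ 2 + ‖(Z t).2‖ ^ 2)))
      (by positivity)).2 (by rw [hS]; exact hSb (Z t))
    calc _ ≤ ‖c t‖ * (C * Real.exp (b * (‖(Z t).1‖ ^ 2 + ‖(Z t).2‖ ^ 2))) := by gcongr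
      _ = _ := by ring
  obtain ⟨g, hg1, hg2⟩ := exists_jet_eq_integral ha hh (fun t => c t • S (Z t)) hcont
  have hg : (fun y => ∫ t, c t * tfShift φ (Z t).1 (Z t).2 y ∂μ) = g := by
    ext y
    rw [hg1]
    refine integral_congr_ae (Eventually.of_forall fun t => ?_)
    simp [hS]
  refine ⟨hg ▸ gaussBoundSubmodule_le ha hh g.2, fun u hu => ?_⟩
  obtain ⟨F, hF⟩ := hu.exists_functional ha hh
  rw [hg, ← hF, hg2, ← F.integral_comp_comm hcont]
  refine integral_congr_ae (Eventually.of_forall fun t => ?_)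
  change F (jet hh (c t • S (Z t))) = _
  rw [map_smul, map_smul, hF, hS, smul_eq_mul]

end Synthesis

/-! ### Fourier inversion and reconstruction from the short-time Fourier transform. -/

section Fourier

variable {V : Type*} [NormedAddCommGroup V] [InnerProductSpace ℝ V]

theorem conj_expNeg (ξ y : V) : conj (expNeg ξ y) = expNeg (-ξ) y := by
  rw [expNeg, expNeg, ← Complex.exp_conj]
  simp

theorem expNeg_swap (ξ y : V) : expNeg ξ y = expNeg y ξ := by
  rw [expNeg, expNeg, real_inner_comm]

theorem expNeg_add_right (ξ y z : V) : expNeg ξ (y + z) = expNeg ξ y * expNeg ξ z := by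
  rw [expNeg_swap, expNeg_add, expNeg_swap y, expNeg_swap z]

theorem continuous_expNeg_uncurry : Continuous fun p : V × V => expNeg p.1 p.2 := by
  unfold expNeg
  fun_prop

theorem exists_common_gaussBound {f g : V → ℂ} (hf : f ∈ GelfandShilov V) (hg : g ∈ GelfandShilov V) :
    ∃ a > 0, ∃ h > 0, ∃ M M' : ℝ, GaussBound a h M f ∧ GaussBound a h M' g := by
  rw [mem_gelfandShilov_iff] at hf hg
  obtain ⟨hf, a, ha, h, hh, M, H⟩ := hf
  obtain ⟨hg, a', ha', h', hh', M', H'⟩ := hg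
  exact ⟨min a a', lt_min ha ha', max h h', lt_max_of_lt_left hh, M, M',
    H.mono hh.le (min_le_left _ _) (le_max_left _ _) le_rfl,
    H'.mono hh'.le (min_le_right _ _) (le_max_right _ _) le_rfl⟩

theorem GelfandShilov.bounded {f : V → ℂ} (hf : f ∈ GelfandShilov V) : ∃ B : ℝ, 0 ≤ B ∧ ∀ y, ‖f y‖ ≤ B := by
  rw [mem_gelfandShilov_iff] at hf
  obtain ⟨hc, a, ha, h, hh, M, H⟩ := hf
  refine ⟨M, H.nonneg, fun y => (H.norm_le y).trans (mul_le_of_le_one_right H.nonneg (Real.exp_le_one_iff.2 ?_))⟩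
  have := mul_nonneg ha.le (sq_nonneg ‖y‖)
  linarith

theorem continuous_tfShift_uncurry {φ : V → ℂ} (hφ : Continuous φ) (y : V) :
    Continuous fun Z : V × V => tfShift φ Z.1 Z.2 y := by
  unfold tfShift
  exact (Complex.continuous_conj.comp (hφ.comp (by fun_prop))).mul
    (continuous_expNeg_uncurry.comp (by fun_prop : Continuous fun p : V × V => (p.2, y)))

theorem norm_tfShift (φ : V → ℂ) (x ξ y : V) : ‖tfShift φ x ξ y‖ = ‖φ (y - x)‖ := by
  rw [tfShift, norm_mul, norm_expNeg, RCLike.norm_conj, mul_one]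

/-- No membership is needed: for c ≠ 0 the functions f and cf belong to the space together, and
outside it `gsPair` takes the default value 0 on both sides. -/
theorem gsPair_const_mul {u : GelfandShilov V → ℂ} (hu : IsGSDistribution u) (c : ℂ) (f : V → ℂ) :
    gsPair u (fun y => c * f y) = c * gsPair u f := by
  rcases eq_or_ne c 0 with rfl | hc
  · have h0 : (fun y => (0 : ℂ) * f y) = ((0 : GelfandShilov V) : V → ℂ) := by ext; simp
    rw [h0, gsPair_of_mem (0 : GelfandShilov V).2, zero_mul]
    exact (hu.linear.mk' u).map_zero
  · by_cases hf : f ∈ GelfandShilov V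
    · have h1 : (fun y => c * f y) ∈ GelfandShilov V := (GelfandShilov V).smul_mem c hf
      rw [gsPair_of_mem h1, gsPair_of_mem hf]
      exact hu.linear.map_smul c ⟨f, hf⟩
    · have h1 : (fun y => c * f y) ∉ GelfandShilov V := fun h => hf <| by
        have := (GelfandShilov V).smul_mem c⁻¹ h
        convert this using 1
        ext y
        simp [hc]
      rw [gsPair, gsPair, dif_neg h1, dif_neg hf, mul_zero]

variable [FiniteDimensional ℝ V] [MeasurableSpace V] [BorelSpace V]

theorem integrable_gauss {a : ℝ} (ha : 0 < a) : Integrable fun v : V => Real.exp (-a * ‖v‖ ^ 2) := by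
  have := (GaussianFourier.integrable_cexp_neg_mul_sq_norm_add (V := V) (b := a) (by simpa using ha) 0 0).norm
  refine this.congr (Eventually.of_forall fun v => ?_)
  simp [Complex.norm_exp, ← Complex.ofReal_pow]

/-- The unnormalized inverse Fourier transform `∫ f(t) e^{i⟨t,ξ⟩} dt`. -/
noncomputable def cFourier (f : V → ℂ) (ξ : V) : ℂ := ∫ t, f t * conj (expNeg ξ t)

open FourierTransform in
theorem cFourier_eq (f : V → ℂ) (ξ : V) : cFourier f ξ = 𝓕 f ((-(2 * Real.pi)⁻¹ : ℝ) • ξ) := by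
  rw [Real.fourier_eq', cFourier]
  congr 1
  ext t
  rw [smul_eq_mul, mul_comm, conj_expNeg, expNeg, inner_smul_right, inner_neg_right]
  congr 2
  have : -2 * Real.pi * (-(2 * Real.pi)⁻¹ * ⟪t, ξ⟫_ℝ) = ⟪t, ξ⟫_ℝ := by
    field_simp
  rw [this]
  push_cast
  ring

open FourierTransform in
-- The inversion theorem for the normalization e^{-2πi⟨t,w⟩}, rescaled by w = -ξ/(2π); the Jacobian
-- is the constant on the right.
theorem fourier_inversion {f : V → ℂ} (hf : Continuous f) (hfi : Integrable f) (hF : Integrable (cFourier f)) (y : V) :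
    ∫ ξ, cFourier f ξ * expNeg ξ y = ((2 * Real.pi) ^ Module.finrank ℝ V : ℝ) * f y := by
  have hpi := Real.pi_pos
  have hF' : Integrable (𝓕 f) := by
    have h1 := hF.comp_smul (R := -(2 * Real.pi)) (by simp [hpi.ne'])
    refine h1.congr (Eventually.of_forall fun w => ?_)
    simp only [cFourier_eq, smul_smul]
    rw [show -(2 * Real.pi)⁻¹ * -(2 * Real.pi) = 1 by field_simp, one_smul]
  have hinv := congrFun (hf.fourierInv_fourier_eq hfi hF') y
  rw [Real.fourierInv_eq'] at hinv
  have hsc := Measure.integral_comp_smul (volume : Measure V)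
    (fun v => Complex.exp (↑(2 * Real.pi * ⟪v, y⟫_ℝ) * Complex.I) • 𝓕 f v) (-(2 * Real.pi)⁻¹)
  rw [hinv] at hsc
  have e1 : |((-(2 * Real.pi)⁻¹) ^ Module.finrank ℝ V)⁻¹| = (2 * Real.pi) ^ Module.finrank ℝ V := by
    rw [← inv_pow, inv_neg, inv_inv, abs_pow, abs_neg, abs_of_pos (by positivity)]
  rw [e1, Complex.real_smul] at hsc
  rw [← hsc]
  congr 1
  ext ξ
  rw [cFourier_eq, smul_eq_mul, mul_comm, expNeg, inner_smul_left]
  congr 2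
  have : 2 * Real.pi * ((starRingEnd ℝ) (-(2 * Real.pi)⁻¹) * ⟪ξ, y⟫_ℝ) = -⟪y, ξ⟫_ℝ := by
    rw [real_inner_comm]
    simp only [conj_trivial]
    field_simp
  rw [this]
  push_cast
  ring

open FourierTransform in
/-- Gaussian decay of the Fourier transform. -/
theorem norm_cFourier_le {a h : ℝ} (ha : 0 < a) (hh : 0 < h) : ∃ δ > 0, ∃ C : ℝ, 0 ≤ C ∧
    ∀ (f : V → ℂ) (M : ℝ), ContDiff ℝ ((⊤ : ℕ∞) : WithTop ℕ∞) f → GaussBound a h M f →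
      ∀ ξ, ‖cFourier f ξ‖ ≤ C * M * Real.exp (-δ * ‖ξ‖ ^ 2) := by
  set G := ∫ v : V, Real.exp (-a * ‖v‖ ^ 2)
  have hG : 0 ≤ G := integral_nonneg fun _ => (Real.exp_pos _).le
  have hpi := Real.pi_pos
  -- One factor 2 per order comes from the estimate for `𝓕`, another from the n + 1 ≤ 2^n terms of
  -- its sum; `max h 1` makes h^i ≤ (max h 1)^n for all i ≤ n.
  set K := 4 * max h 1 with hK
  have h1K : 1 ≤ max h 1 := le_max_right _ _
  have hK0 : 0 < K := by positivity
  refine ⟨(4 * K ^ 2)⁻¹ * ((2 * Real.pi)⁻¹) ^ 2, by positivity, 2 * G, by positivity, fun f M hf H ξ => ?_⟩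
  have hM := H.nonneg
  have hint : ∀ n, Integrable fun v => ‖iteratedFDeriv ℝ n f v‖ := fun n => by
    have hc : Continuous (iteratedFDeriv ℝ n f) := hf.continuous_iteratedFDeriv (by exact_mod_cast le_top)
    refine Integrable.mono' ((integrable_gauss (V := V) ha).const_mul (M * (h ^ n * √(n.factorial : ℝ))))
      hc.norm.aestronglyMeasurable (Eventually.of_forall fun v => ?_)
    rw [norm_norm]
    refine (H v n).trans (le_of_eq (by ring))
  have hintb : ∀ n, ∫ v, ‖iteratedFDeriv ℝ n f v‖ ≤ M * (h ^ n * √(n.factorial : ℝ)) * G := fun n => by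
    rw [← integral_const_mul]
    refine integral_mono (hint n) ((integrable_gauss ha).const_mul _) fun v => ?_
    exact (H v n).trans (le_of_eq (by ring))
  set w : V := (-(2 * Real.pi)⁻¹ : ℝ) • ξ with hw
  have hmom : ∀ n : ℕ, ‖w‖ ^ n * ‖𝓕 f w‖ ≤ (M * G) * (K ^ n * √(n.factorial : ℝ)) := by
    intro n
    have h1 := Real.pow_mul_norm_iteratedFDeriv_fourier_le (f := f) (K := 0) (N := ⊤) hf
      (fun k n hk _ => by
        have hk0 : k = 0 := by simpa using hk
        subst hk0
        simpa using hint n) (k := 0) (n := n) (by simp) (by exact_mod_cast le_top) w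
    simp only [pow_zero, one_mul, norm_iteratedFDeriv_zero, zero_add, Finset.range_one, Finset.singleton_product,
      Finset.sum_map, Function.Embedding.coeFn_mk, CharP.cast_eq_zero, mul_zero] at h1
    refine h1.trans ?_
    have h2 : ∀ i ∈ Finset.range (n + 1), ∫ v, ‖iteratedFDeriv ℝ i f v‖ ≤
        M * (max h 1 ^ n * √(n.factorial : ℝ)) * G := by
      intro i hi
      have hi' : i ≤ n := by simpa [Nat.lt_succ_iff] using hi
      refine (hintb i).trans ?_
      have : h ^ i ≤ max h 1 ^ n :=
        (pow_le_pow_left₀ hh.le (le_max_left h 1) i).trans (pow_le_pow_right₀ h1K hi')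
      gcongr
    have h3 : ((n + 1 : ℕ) : ℝ) ≤ 2 ^ n := by exact_mod_cast Nat.lt_two_pow_self
    calc _ ≤ (2 : ℝ) ^ n * ∑ i ∈ Finset.range (n + 1), M * (max h 1 ^ n * √(n.factorial : ℝ)) * G := by
          gcongr with i hi
          exact h2 i hi
      _ = (2 : ℝ) ^ n * (((n + 1 : ℕ) : ℝ) * (M * (max h 1 ^ n * √(n.factorial : ℝ)) * G)) := by
          rw [Finset.sum_const, Finset.card_range, nsmul_eq_mul]
      _ ≤ (2 : ℝ) ^ n * (2 ^ n * (M * (max h 1 ^ n * √(n.factorial : ℝ)) * G)) := by gcongr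
      _ = _ := by
          rw [hK, mul_pow, show (4 : ℝ) = 2 * 2 by norm_num, mul_pow]; ring
  have := decay_of_moments hK0 (by positivity) hmom
  rw [cFourier_eq]
  refine this.trans (le_of_eq ?_)
  have hn : ‖w‖ ^ 2 = ((2 * Real.pi)⁻¹) ^ 2 * ‖ξ‖ ^ 2 := by
    rw [hw, norm_smul, mul_pow, norm_neg, Real.norm_of_nonneg (by positivity)]
  rw [hn]
  ring_nf

/-- The analysis coefficient `∫ θ(t) φ(t - x) e^{i⟨t,ξ⟩} dt`. -/
noncomputable def tfCoeff (θ φ : V → ℂ) (Z : V × V) : ℂ := cFourier (fun t => θ t * φ (t - Z.1)) Z.2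

/-- Of the joint decay of θ(t) φ(t - x), the part e^{-a‖t‖²/2} is kept for the Fourier transform in
t and the rest yields e^{-a‖x‖²/4}. The constants depend only on a and h, which later gives bounds
uniform in θ. -/
theorem norm_tfCoeff_le {a h : ℝ} (ha : 0 < a) (hh : 0 < h) : ∃ δ > 0, ∃ C : ℝ, 0 ≤ C ∧
    ∀ (θ φ : V → ℂ) (M M' : ℝ), ContDiff ℝ ((⊤ : ℕ∞) : WithTop ℕ∞) θ → ContDiff ℝ ((⊤ : ℕ∞) : WithTop ℕ∞) φ →
      GaussBound a h M θ → GaussBound a h M' φ →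
      ∀ Z, ‖tfCoeff θ φ Z‖ ≤ C * (M * M') * Real.exp (-δ * (‖Z.1‖ ^ 2 + ‖Z.2‖ ^ 2)) := by
  obtain ⟨δ, hδ, C, hC, H⟩ := norm_cFourier_le (V := V) (a := a / 2) (h := h + h) (by positivity) (by positivity)
  refine ⟨min δ (a / 4), lt_min hδ (by positivity), C, hC, fun θ φ M M' hθ hφ bθ bφ Z => ?_⟩
  have hM := bθ.nonneg
  have hM' := bφ.nonneg
  have hφc : ContDiff ℝ ((⊤ : ℕ∞) : WithTop ℕ∞) fun t => φ (t - Z.1) := hφ.comp (contDiff_id.sub contDiff_const)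
  refine (H _ (M * M' * Real.exp (-(a / 4) * ‖Z.1‖ ^ 2)) (hθ.mul hφc) (fun t => ?_) Z.2).trans ?_
  · refine (DerivBound.mul hθ hφc hh.le hh.le (bθ t) (bφ (t - Z.1)).comp_sub).mono (by positivity) le_rfl ?_
    have h1 := neg_mul_norm_sub_sq_le (a := a / 2) (by positivity) t Z.1
    rw [norm_sub_rev] at h1
    have h2 : 0 ≤ a / 2 * ‖t - Z.1‖ ^ 2 := by positivity
    calc _ = M * M' * (Real.exp (-a * ‖t‖ ^ 2) * Real.exp (-a * ‖t - Z.1‖ ^ 2)) := by ring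
      _ ≤ M * M' * (Real.exp (-(a / 4) * ‖Z.1‖ ^ 2) * Real.exp (-(a / 2) * ‖t‖ ^ 2)) := by
        rw [← Real.exp_add, ← Real.exp_add]
        exact mul_le_mul_of_nonneg_left (Real.exp_le_exp.2 (by linarith)) (by positivity)
      _ = _ := by ring
  · calc _ = C * (M * M') * (Real.exp (-(a / 4) * ‖Z.1‖ ^ 2) * Real.exp (-δ * ‖Z.2‖ ^ 2)) := by ring
      _ ≤ _ := by
        rw [← Real.exp_add]
        gcongr
        have h1 : min δ (a / 4) * ‖Z.1‖ ^ 2 ≤ a / 4 * ‖Z.1‖ ^ 2 := by gcongr; exact min_le_right _ _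
        have h2 : min δ (a / 4) * ‖Z.2‖ ^ 2 ≤ δ * ‖Z.2‖ ^ 2 := by gcongr; exact min_le_left _ _
        linarith

theorem integrable_gauss_prod {a : ℝ} (ha : 0 < a) :
    Integrable fun Z : V × V => Real.exp (-a * (‖Z.1‖ ^ 2 + ‖Z.2‖ ^ 2)) := by
  have := (integrable_gauss (V := V) ha).mul_prod (integrable_gauss (V := V) ha)
  refine this.congr (Eventually.of_forall fun Z => ?_)
  simp only [mul_add, Real.exp_add]

theorem aestronglyMeasurable_tfCoeff {θ φ : V → ℂ} (hθ : Continuous θ) (hφ : Continuous φ) :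
    AEStronglyMeasurable (tfCoeff θ φ) := by
  have hc : Continuous fun p : (V × V) × V => θ p.2 * φ (p.2 - p.1.1) * conj (expNeg p.1.2 p.2) := by
    refine ((hθ.comp continuous_snd).mul (hφ.comp (by fun_prop))).mul ?_
    exact Complex.continuous_conj.comp (continuous_expNeg_uncurry.comp (by fun_prop : Continuous
      fun p : (V × V) × V => (p.1.2, p.2)))
  exact (hc.stronglyMeasurable.aestronglyMeasurable (μ := (volume : Measure (V × V)).prod volume)).integral_prod_right'

theorem GelfandShilov.integrable {f : V → ℂ} (hf : f ∈ GelfandShilov V) : Integrable f := by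
  rw [mem_gelfandShilov_iff] at hf
  obtain ⟨hc, a, ha, h, hh, M, H⟩ := hf
  exact Integrable.mono' ((integrable_gauss ha).const_mul M) hc.continuous.aestronglyMeasurable
    (Eventually.of_forall H.norm_le)

theorem tfCoeff_decay {θ φ : V → ℂ} (hθ : θ ∈ GelfandShilov V) (hφ : φ ∈ GelfandShilov V) :
    ∃ δ > 0, ∃ C : ℝ, 0 ≤ C ∧ ∀ Z, ‖tfCoeff θ φ Z‖ ≤ C * Real.exp (-δ * (‖Z.1‖ ^ 2 + ‖Z.2‖ ^ 2)) := by
  obtain ⟨a, ha, h, hh, M, M', H, H'⟩ := exists_common_gaussBound hθ hφ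
  obtain ⟨δ, hδ, C, hC, hb⟩ := norm_tfCoeff_le (V := V) ha hh
  exact ⟨δ, hδ, C * (M * M'), mul_nonneg hC (mul_nonneg H.nonneg H'.nonneg), hb θ φ M M' hθ.1 hφ.1 H H'⟩

/-- The constant in the inversion formula of the short-time Fourier transform. -/
noncomputable def tfNorm (φ : V → ℂ) : ℂ := ((2 * Real.pi) ^ Module.finrank ℝ V * ∫ t, ‖φ t‖ ^ 2 : ℝ)

theorem tfNorm_ne_zero {φ : V → ℂ} (hφ : φ ∈ GelfandShilov V) {x : V} (hx : φ x ≠ 0) : tfNorm φ ≠ 0 := by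
  have hpi := Real.pi_pos
  have hc := hφ.1.continuous
  obtain ⟨B, hB, hb⟩ := GelfandShilov.bounded hφ
  have hi : Integrable fun t => ‖φ t‖ ^ 2 := by
    refine Integrable.mono' ((GelfandShilov.integrable hφ).norm.const_mul B) (hc.norm.pow 2).aestronglyMeasurable
      (Eventually.of_forall fun t => ?_)
    rw [Real.norm_of_nonneg (by positivity), sq]
    exact mul_le_mul_of_nonneg_right (hb t) (norm_nonneg _)
  have : 0 < ∫ t, ‖φ t‖ ^ 2 := by
    rw [integral_pos_iff_support_of_nonneg (fun t => by positivity) hi]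
    exact (hc.norm.pow 2).isOpen_support.measure_pos volume ⟨x, by simpa using hx⟩
  rw [tfNorm]
  exact_mod_cast (by positivity : (2 * Real.pi) ^ Module.finrank ℝ V * ∫ t, ‖φ t‖ ^ 2 ≠ 0)

theorem integrable_tfCoeff_mul {θ φ : V → ℂ} (hθ : θ ∈ GelfandShilov V) (hφ : φ ∈ GelfandShilov V) (y : V) :
    Integrable fun Z : V × V => tfCoeff θ φ Z * tfShift φ Z.1 Z.2 y := by
  obtain ⟨δ, hδ, C, hC, hb⟩ := tfCoeff_decay hθ hφ
  obtain ⟨B, hB, hφb⟩ := GelfandShilov.bounded hφ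
  refine Integrable.mono' ((integrable_gauss_prod (V := V) hδ).const_mul (C * B))
    ((aestronglyMeasurable_tfCoeff hθ.1.continuous hφ.1.continuous).mul
      (continuous_tfShift_uncurry hφ.1.continuous y).aestronglyMeasurable) (Eventually.of_forall fun Z => ?_)
  rw [norm_mul, norm_tfShift]
  calc _ ≤ C * Real.exp (-δ * (‖Z.1‖ ^ 2 + ‖Z.2‖ ^ 2)) * B := by
        gcongr
        · exact hb Z
        · exact hφb _
    _ = _ := by ring

/-- The inversion formula of the short-time Fourier transform. -/
theorem integral_tfCoeff_mul_tfShift {θ φ : V → ℂ} (hθ : θ ∈ GelfandShilov V) (hφ : φ ∈ GelfandShilov V) (y : V) :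
    ∫ Z : V × V, tfCoeff θ φ Z * tfShift φ Z.1 Z.2 y = tfNorm φ * θ y := by
  have hi := integrable_tfCoeff_mul hθ hφ y
  obtain ⟨δ, hδ, C, hC, hb⟩ := tfCoeff_decay hθ hφ
  obtain ⟨B, hB, hφb⟩ := GelfandShilov.bounded hφ
  have hcθ := hθ.1.continuous
  have hcφ := hφ.1.continuous
  rw [Measure.volume_eq_prod] at hi ⊢
  rw [integral_prod _ hi]
  have hmeas : AEStronglyMeasurable (tfCoeff θ φ) ((volume : Measure V).prod volume) :=
    aestronglyMeasurable_tfCoeff hcθ hcφ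
  have hcoefc : ∀ x, Integrable fun ξ => tfCoeff θ φ (x, ξ) := by
    intro x
    have hmx : AEStronglyMeasurable (fun ξ => tfCoeff θ φ (x, ξ)) := by
      have hc : Continuous fun p : V × V => θ p.2 * φ (p.2 - x) * conj (expNeg p.1 p.2) := by
        refine ((hcθ.comp continuous_snd).mul (hcφ.comp (by fun_prop))).mul ?_
        exact Complex.continuous_conj.comp continuous_expNeg_uncurry
      exact (hc.stronglyMeasurable.aestronglyMeasurable (μ := (volume : Measure V).prod volume)).integral_prod_right'
    refine Integrable.mono' ((integrable_gauss (V := V) hδ).const_mul C) hmx (Eventually.of_forall fun ξ => ?_)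
    refine (hb (x, ξ)).trans (mul_le_mul_of_nonneg_left (Real.exp_le_exp.2 ?_) hC)
    nlinarith [mul_nonneg hδ.le (sq_nonneg ‖x‖)]
  -- For fixed x this is Fourier inversion in ξ; what remains is the integral of |φ(y - x)|² over x.
  have hin : ∀ x, ∫ ξ, tfCoeff θ φ (x, ξ) * tfShift φ x ξ y =
      ((2 * Real.pi) ^ Module.finrank ℝ V : ℝ) * θ y * (φ (y - x) * conj (φ (y - x))) := by
    intro x
    have hi1 : Integrable fun t => θ t * φ (t - x) :=
      (GelfandShilov.integrable hθ).mul_bdd (c := B) (hcφ.comp (by fun_prop)).aestronglyMeasurable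
        (Eventually.of_forall fun t => hφb _)
    have := fourier_inversion (f := fun t => θ t * φ (t - x)) (hcθ.mul (hcφ.comp (by fun_prop))) hi1 (hcoefc x) y
    have e : ∀ ξ, tfCoeff θ φ (x, ξ) * tfShift φ x ξ y =
        conj (φ (y - x)) * (cFourier (fun t => θ t * φ (t - x)) ξ * expNeg ξ y) := fun ξ => by
      simp only [tfCoeff, tfShift]; ring
    simp_rw [e]
    rw [integral_const_mul, this]
    ring
  simp_rw [hin]
  rw [integral_const_mul, tfNorm]
  have e2 : ∀ z : ℂ, z * conj z = ((‖z‖ ^ 2 : ℝ) : ℂ) := fun z => by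
    rw [Complex.mul_conj, Complex.normSq_eq_norm_sq]
  simp_rw [e2]
  rw [integral_complex_ofReal, integral_sub_left_eq_self (fun t => ‖φ t‖ ^ 2)]
  push_cast
  ring

/-- Half of the Gaussian decay is spent on the weight; the other half leaves the integrability that
`synthesis` requires. -/
theorem integrable_tfCoeff_exp {θ φ : V → ℂ} (hθ : θ ∈ GelfandShilov V) (hφ : φ ∈ GelfandShilov V) :
    ∃ b > 0, Integrable fun Z : V × V => ‖tfCoeff θ φ Z‖ * Real.exp (b * (‖Z.1‖ ^ 2 + ‖Z.2‖ ^ 2)) := by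
  obtain ⟨δ, hδ, C, hC, hb⟩ := tfCoeff_decay hθ hφ
  refine ⟨δ / 2, by positivity, ?_⟩
  refine Integrable.mono' ((integrable_gauss_prod (V := V) (half_pos hδ)).const_mul C)
    ((aestronglyMeasurable_tfCoeff hθ.1.continuous hφ.1.continuous).norm.mul
      (by fun_prop : Continuous fun Z : V × V => Real.exp (δ / 2 * (‖Z.1‖ ^ 2 + ‖Z.2‖ ^ 2))).aestronglyMeasurable)
    (Eventually.of_forall fun Z => ?_)
  rw [norm_mul, norm_norm, Real.norm_of_nonneg (Real.exp_pos _).le]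
  calc _ ≤ C * Real.exp (-δ * (‖Z.1‖ ^ 2 + ‖Z.2‖ ^ 2)) * Real.exp (δ / 2 * (‖Z.1‖ ^ 2 + ‖Z.2‖ ^ 2)) := by
        gcongr
        exact hb Z
    _ = _ := by
        rw [mul_assoc, ← Real.exp_add]
        ring_nf

/-- A distribution is recovered from its short-time Fourier transform. -/
theorem IsGSDistribution.tfNorm_mul_gsPair {u : GelfandShilov V → ℂ} (hu : IsGSDistribution u) {θ φ : V → ℂ}
    (hθ : θ ∈ GelfandShilov V) (hφ : φ ∈ GelfandShilov V) :
    tfNorm φ * gsPair u θ = ∫ Z : V × V, tfCoeff θ φ Z * gsPair u (tfShift φ Z.1 Z.2) := by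
  obtain ⟨b, hb, hint⟩ := integrable_tfCoeff_exp hθ hφ
  have := (synthesis hφ hb (Z := id) measurable_id
    (aestronglyMeasurable_tfCoeff hθ.1.continuous hφ.1.continuous) hint).2 u hu
  simp only [id] at this
  rw [← this, ← gsPair_const_mul hu]
  congr 1
  ext y
  exact (integral_tfCoeff_mul_tfShift hθ hφ y).symm

/-- By the reconstruction formula `tfNorm φ` times any value of u vanishes, and `tfNorm φ` is
nonzero since φ is. -/
theorem IsGSDistribution.eq_zero_of_tfShift {u : GelfandShilov V → ℂ} (hu : IsGSDistribution u) {φ : V → ℂ}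
    (hφ : φ ∈ GelfandShilov V) {x : V} (hx : φ x ≠ 0) (H : ∀ x ξ, gsPair u (tfShift φ x ξ) = 0) : u = 0 := by
  ext θ
  have h1 := hu.tfNorm_mul_gsPair θ.2 hφ
  simp only [H, mul_zero, integral_zero, mul_eq_zero, tfNorm_ne_zero hφ hx, false_or] at h1
  rwa [gsPair_of_mem θ.2] at h1

end Fourier

/-! ### Complex Gaussians in the Gelfand–Shilov space. -/

section ComplexGaussian

variable {V : Type*} [NormedAddCommGroup V] [NormedSpace ℝ V]

theorem norm_iteratedFDeriv_clm_le {F : Type*} [NormedAddCommGroup F] [NormedSpace ℝ F] (L : V →L[ℝ] F) (x : V) :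
    ‖iteratedFDeriv ℝ 0 L x‖ ≤ ‖L‖ * ‖x‖ ∧ ‖iteratedFDeriv ℝ 1 L x‖ ≤ ‖L‖ ∧
      ∀ n, ‖iteratedFDeriv ℝ (n + 2) L x‖ = 0 := by
  have h : fderiv ℝ L = fun _ => L := by ext1 x; exact L.fderiv
  refine ⟨by simpa using L.le_opNorm x, ?_, fun n => ?_⟩
  · rw [← norm_iteratedFDeriv_fderiv, h, norm_iteratedFDeriv_zero]
  · rw [← norm_iteratedFDeriv_fderiv, h, iteratedFDeriv_const_of_ne (by omega)]
    simp

theorem hasFDerivAt_exp_quadratic (B : V →L[ℝ] V →L[ℝ] ℂ) (x : V) :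
    HasFDerivAt (fun x => Complex.exp (-(B x x))) (Complex.exp (-(B x x)) • (-(B + B.flip)) x) x := by
  have h1 : HasFDerivAt (fun x => B x x) (B x + B.flip x) x := by
    have := B.hasFDerivAt_of_bilinear (hasFDerivAt_id x) (hasFDerivAt_id x)
    refine this.congr_fderiv ?_
    ext v
    simp
  refine h1.neg.cexp.congr_fderiv ?_
  ext v
  simp

/-- Since f' = f·L with L linear, the Leibniz formula has two terms only: ‖f^{(n+1)}‖ ≤
K‖x‖‖f^{(n)}‖ + nK‖f^{(n-1)}‖. The shape (‖x‖ + √n)^n survives this recursion because the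
coefficient n + 1 is the square of √(n+1), and one root is absorbed in the power. -/
theorem norm_iteratedFDeriv_exp_quadratic_le (B : V →L[ℝ] V →L[ℝ] ℂ) : ∃ K : ℝ, 1 ≤ K ∧ ∀ (n : ℕ) (x : V),
    ‖iteratedFDeriv ℝ n (fun x => Complex.exp (-(B x x))) x‖ ≤
      ‖Complex.exp (-(B x x))‖ * (K ^ n * (‖x‖ + √n) ^ n) := by
  set f : V → ℂ := fun x => Complex.exp (-(B x x)) with hf
  set L : V →L[ℝ] V →L[ℝ] ℂ := -(B + B.flip) with hL
  have hfc : ContDiff ℝ ((⊤ : ℕ∞) : WithTop ℕ∞) f := by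
    refine Complex.contDiff_exp.comp (ContDiff.neg ?_)
    exact B.contDiff.clm_apply contDiff_id
  have hfd : fderiv ℝ f = fun x => f x • L x := by
    ext1 x
    exact (hasFDerivAt_exp_quadratic B x).fderiv
  set K := max 1 ‖L‖ with hK
  have hK1 : 1 ≤ K := le_max_left _ _
  have hLK : ‖L‖ ≤ K := le_max_right _ _
  refine ⟨K, hK1, fun n x => ?_⟩
  have hrec : ∀ n, ‖iteratedFDeriv ℝ (n + 1) f x‖ ≤
      K * ‖x‖ * ‖iteratedFDeriv ℝ n f x‖ + n * K * ‖iteratedFDeriv ℝ (n - 1) f x‖ := by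
    intro n
    obtain ⟨l0, l1, l2⟩ := norm_iteratedFDeriv_clm_le L x
    rw [← norm_iteratedFDeriv_fderiv, hfd]
    refine (norm_iteratedFDeriv_smul_le (n := n) hfc L.contDiff x (by exact_mod_cast le_top)).trans ?_
    rw [Finset.sum_range_succ]
    have e1 : (n.choose n : ℝ) * ‖iteratedFDeriv ℝ n f x‖ * ‖iteratedFDeriv ℝ (n - n) L x‖ ≤
        K * ‖x‖ * ‖iteratedFDeriv ℝ n f x‖ := by
      rw [Nat.choose_self, Nat.sub_self, Nat.cast_one, one_mul, mul_comm]
      gcongr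
      exact l0.trans (by gcongr)
    have e2 : ∑ i ∈ Finset.range n, (n.choose i : ℝ) * ‖iteratedFDeriv ℝ i f x‖ * ‖iteratedFDeriv ℝ (n - i) L x‖ ≤
        n * K * ‖iteratedFDeriv ℝ (n - 1) f x‖ := by
      rcases n with _ | m
      · simp
      · rw [Finset.sum_range_succ, Finset.sum_eq_zero, zero_add]
        · rw [Nat.choose_succ_self_right, Nat.add_sub_cancel, Nat.add_sub_cancel_left]
          calc _ ≤ ((m + 1 : ℕ) : ℝ) * ‖iteratedFDeriv ℝ m f x‖ * K := by
                gcongr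
                exact l1.trans hLK
            _ = _ := by ring
        · intro i hi
          rw [Finset.mem_range] at hi
          obtain ⟨j, hj⟩ : ∃ j, m + 1 - i = j + 2 := ⟨m - 1 - i, by omega⟩
          rw [hj, l2, mul_zero]
    linarith
  -- Two consecutive orders are carried along, as the recursion has depth two.
  have hstep : ∀ n, ‖iteratedFDeriv ℝ n f x‖ ≤ ‖f x‖ * (K ^ n * (‖x‖ + √n) ^ n) ∧
      ‖iteratedFDeriv ℝ (n + 1) f x‖ ≤ ‖f x‖ * (K ^ (n + 1) * (‖x‖ + √((n + 1 : ℕ) : ℝ)) ^ (n + 1)) := by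
    intro n
    induction n with
    | zero =>
      refine ⟨by simp, ?_⟩
      have := hrec 0
      simp only [norm_iteratedFDeriv_zero, CharP.cast_eq_zero, zero_mul, add_zero] at this
      refine this.trans ?_
      simp only [zero_add, pow_one, Nat.cast_one, Real.sqrt_one]
      have : 0 ≤ K * ‖f x‖ := by positivity
      nlinarith
    | succ n ih =>
      refine ⟨ih.2, ?_⟩
      have h1 := hrec (n + 1)
      rw [Nat.add_sub_cancel] at h1
      refine h1.trans ?_
      set s := √((n + 1 : ℕ) : ℝ) with hs
      have hs0 : 0 ≤ s := Real.sqrt_nonneg _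
      have hs2 : s * s = ((n + 1 : ℕ) : ℝ) := Real.mul_self_sqrt (by positivity)
      have hmono : √(n : ℝ) ≤ s := Real.sqrt_le_sqrt (by push_cast; linarith)
      have hmono2 : s ≤ √((n + 1 + 1 : ℕ) : ℝ) := Real.sqrt_le_sqrt (by push_cast; linarith)
      have a1 : K * ‖x‖ * ‖iteratedFDeriv ℝ (n + 1) f x‖ ≤
          ‖f x‖ * (K ^ (n + 1 + 1) * ((‖x‖ + s) ^ (n + 1) * ‖x‖)) := by
        calc _ ≤ K * ‖x‖ * (‖f x‖ * (K ^ (n + 1) * (‖x‖ + s) ^ (n + 1))) := by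
              gcongr
              exact ih.2
          _ = _ := by ring
      have a2 : ((n + 1 : ℕ) : ℝ) * K * ‖iteratedFDeriv ℝ n f x‖ ≤
          ‖f x‖ * (K ^ (n + 1 + 1) * ((‖x‖ + s) ^ (n + 1) * s)) := by
        calc _ ≤ ((n + 1 : ℕ) : ℝ) * K * (‖f x‖ * (K ^ n * (‖x‖ + √n) ^ n)) := by
              gcongr
              exact ih.1
          _ ≤ (s * s) * K * (‖f x‖ * (K ^ n * (‖x‖ + s) ^ n)) := by
              rw [hs2]
              gcongr
          _ = ‖f x‖ * (K ^ (n + 1) * ((‖x‖ + s) ^ n * s * s)) := by ring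
          _ ≤ ‖f x‖ * (K ^ (n + 1 + 1) * ((‖x‖ + s) ^ n * (‖x‖ + s) * s)) := by
              gcongr
              · omega
              · linarith [norm_nonneg x]
          _ = _ := by ring
      calc _ ≤ _ := add_le_add a1 a2
        _ = ‖f x‖ * (K ^ (n + 1 + 1) * (‖x‖ + s) ^ (n + 1 + 1)) := by ring
        _ ≤ _ := by gcongr
  exact (hstep n).1

/-- Half of the decay e^{-a‖x‖²} absorbs ‖x‖^n at the cost of √n!, while √n^n ≤ e^{n/2} √n! follows
from n^n/n! ≤ e^n. -/
theorem exp_quadratic_mem_gelfandShilov (B : V →L[ℝ] V →L[ℝ] ℂ) {a : ℝ} (ha : 0 < a)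
    (hB : ∀ x, a * ‖x‖ ^ 2 ≤ (B x x).re) : (fun x => Complex.exp (-(B x x))) ∈ GelfandShilov V := by
  obtain ⟨K, hK1, hK⟩ := norm_iteratedFDeriv_exp_quadratic_le B
  rw [mem_gelfandShilov_iff]
  set r := (√(2 * (a / 2)))⁻¹ + Real.exp (1 / 2) with hr
  refine ⟨Complex.contDiff_exp.comp (B.contDiff.clm_apply contDiff_id).neg, a / 2, by positivity, K * 2 * r,
    by positivity, 2, fun x n => (hK n x).trans ?_⟩
  have h1 : ‖Complex.exp (-(B x x))‖ ≤ Real.exp (-a * ‖x‖ ^ 2) := by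
    rw [Complex.norm_exp, Complex.neg_re]
    exact Real.exp_le_exp.2 (by linarith [hB x])
  have hn0 : (0 : ℝ) < n.factorial := by exact_mod_cast n.factorial_pos
  have h2 : ‖x‖ ^ n ≤ r ^ n * √(n.factorial : ℝ) * Real.exp (a / 2 * ‖x‖ ^ 2) := by
    refine (pow_le_sqrt_factorial_mul_exp (half_pos ha) ‖x‖ n).trans ?_
    gcongr
    rw [hr]
    linarith [Real.exp_pos (1 / 2)]
  have h3 : √(n : ℝ) ^ n ≤ r ^ n * √(n.factorial : ℝ) * Real.exp (a / 2 * ‖x‖ ^ 2) := by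
    have h4 : √(n : ℝ) ^ n ≤ Real.exp (1 / 2) ^ n * √(n.factorial : ℝ) := by
      apply le_of_sq_le_sq _ (by positivity)
      rw [mul_pow, Real.sq_sqrt hn0.le, ← pow_mul, mul_comm n 2, pow_mul, Real.sq_sqrt (by positivity),
        ← Real.exp_nat_mul, ← Real.exp_nat_mul]
      have := Real.pow_div_factorial_le_exp (n : ℝ) (by positivity) n
      rw [div_le_iff₀ hn0] at this
      refine this.trans (le_of_eq ?_)
      congr 2
      push_cast
      ring
    calc _ ≤ Real.exp (1 / 2) ^ n * √(n.factorial : ℝ) * 1 := by linarith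
      _ ≤ _ := by
        gcongr
        · rw [hr]
          have : 0 ≤ (√(2 * (a / 2)))⁻¹ := by positivity
          linarith
        · exact Real.one_le_exp (by positivity)
  have h5 : (‖x‖ + √n) ^ n ≤ 2 ^ n * (‖x‖ ^ n + √(n : ℝ) ^ n) := by
    have h6 : (‖x‖ + √n) ^ n ≤ (2 * max ‖x‖ √n) ^ n := by
      gcongr
      linarith [le_max_left ‖x‖ √n, le_max_right ‖x‖ √n]
    refine h6.trans ?_
    rw [mul_pow]
    gcongr
    rcases max_choice ‖x‖ √(n : ℝ) with h | h <;> rw [h]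
    · linarith [pow_nonneg (Real.sqrt_nonneg (n : ℝ)) n]
    · linarith [pow_nonneg (norm_nonneg x) n]
  calc _ ≤ Real.exp (-a * ‖x‖ ^ 2) * (K ^ n * (2 ^ n * (r ^ n * √(n.factorial : ℝ) * Real.exp (a / 2 * ‖x‖ ^ 2) +
        r ^ n * √(n.factorial : ℝ) * Real.exp (a / 2 * ‖x‖ ^ 2)))) := by
        gcongr
        exact h5.trans (by gcongr)
    _ = 2 * (Real.exp (-a * ‖x‖ ^ 2) * Real.exp (a / 2 * ‖x‖ ^ 2)) * ((K * 2 * r) ^ n * √(n.factorial : ℝ)) := by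
        rw [mul_pow, mul_pow]; ring
    _ = _ := by
        rw [← Real.exp_add]
        ring_nf

end ComplexGaussian

/-! ### The standard Gaussian window. -/

section Gaussian

variable {V : Type*} [NormedAddCommGroup V] [InnerProductSpace ℝ V]

theorem gaussWindow_mem : gaussWindow V ∈ GelfandShilov V := by
  have h := exp_quadratic_mem_gelfandShilov (V := V)
    ((ContinuousLinearMap.compL ℝ V ℝ ℂ ((1 / 2 : ℝ) • Complex.ofRealCLM)).comp (innerSL ℝ)) (a := 1 / 2) (by norm_num)
    (fun x => by simp [-Complex.ofReal_pow])
  have := (GelfandShilov V).smul_mem (((Real.pi ^ (-(Module.finrank ℝ V : ℝ) / 4) : ℝ)) : ℂ) h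
  convert this using 1
  ext x
  simp only [gaussWindow, Pi.smul_apply, smul_eq_mul, Complex.ofReal_mul, Complex.ofReal_exp]
  congr 2
  simp
  ring

theorem gaussWindow_ne_zero (x : V) : gaussWindow V x ≠ 0 := by
  have := Real.pi_pos
  rw [gaussWindow]
  exact_mod_cast (by positivity : Real.pi ^ (-(Module.finrank ℝ V : ℝ) / 4) * Real.exp (-‖x‖ ^ 2 / 2) ≠ 0)

end Gaussian

/-! ### A Peetre-type maximal inequality for exponents at most one. -/

section Peetre

variable {G : Type*} [AddCommGroup G] [MeasurableSpace G] {μ : Measure G}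

/-- The Gaussian `e^{-c q}` with values in `[0,∞]`. -/
noncomputable def eGauss {G : Type*} (q : G → ℝ) (c : ℝ) (X : G) : ℝ≥0∞ := ENNReal.ofReal (Real.exp (-c * q X))

/-- If `N'` and `N` are dominated by the convolution of `N` with a Gaussian, then `N'^p` is dominated by the
convolution of `N^p` with a Gaussian. -/
theorem rpow_le_convolution {q : G → ℝ} (hq0 : ∀ X, 0 ≤ q X) (hqz : q 0 = 0)
    (hq : ∀ τ > 0, ∀ X Y, q (X + Y) ≤ (1 + τ) * q X + (1 + τ⁻¹) * q Y) (hqn : ∀ X, q (-X) = q X)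
    {p c : ℝ} (hp : 0 < p) (hp1 : p ≤ 1) (hc : 0 < c) :
    ∃ δ > 0, ∀ (C : ℝ≥0) (N N' : G → ℝ≥0∞),
      (∀ X, N X ≤ C * ∫⁻ Z, N Z * eGauss q c (X - Z) ∂μ) →
      (∀ X, N' X ≤ C * ∫⁻ Z, N Z * eGauss q c (X - Z) ∂μ) →
      (∀ ε > 0, ∃ D : ℝ≥0, ∀ X, N X ≤ D * ENNReal.ofReal (Real.exp (ε * q X))) →
      ∀ X, N' X ^ p ≤ C * ∫⁻ Z, N Z ^ p * eGauss q (δ) (X - Z) ∂μ := by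
  -- With this ε the quasi-triangle inequality for q at τ = p/2 costs at most c in the variable Y -
  -- Z.
  set ε := c / (1 + (p / 2)⁻¹) with hε
  have hp2 : 0 < (p / 2)⁻¹ := by positivity
  have hε0 : 0 < ε := by positivity
  refine ⟨p * ε / 2, by positivity, fun C N N' hN hN' hgrow X => ?_⟩
  -- The maximal function of N at X. The growth condition makes it finite, so that a power of it can
  -- be cancelled below.
  set A : ℝ≥0∞ := ⨆ Y, N Y * eGauss q ε (X - Y) with hA
  set B : ℝ≥0∞ := ∫⁻ Z, N Z ^ p * eGauss q (p * ε / 2) (X - Z) ∂μ with hB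
  have hAtop : A ≠ ⊤ := by
    obtain ⟨D, hD⟩ := hgrow (ε / 2) (by positivity)
    have : A ≤ D * ENNReal.ofReal (Real.exp (ε * q X)) := by
      refine iSup_le fun Y => ?_
      calc _ ≤ D * ENNReal.ofReal (Real.exp (ε / 2 * q Y)) * eGauss q ε (X - Y) := by
            gcongr
            exact hD Y
        _ = D * ENNReal.ofReal (Real.exp (ε / 2 * q Y) * Real.exp (-ε * q (X - Y))) := by
            rw [eGauss, ENNReal.ofReal_mul (Real.exp_pos _).le, mul_assoc]
        _ ≤ _ := by
            gcongr
            rw [← Real.exp_add]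
            apply Real.exp_le_exp.2
            have h1 := hq 1 one_pos X (Y - X)
            rw [add_sub_cancel, ← neg_sub, hqn] at h1
            norm_num at h1
            nlinarith
    exact ne_top_of_le_ne_top (by finiteness) this
  -- Split N = N^p N^{1-p} and bound only the second factor by the maximal function.
  have hpt : ∀ Z, N Z ≤ N Z ^ p * (A ^ (1 - p) * ENNReal.ofReal (Real.exp ((1 - p) * ε * q (X - Z)))) := by
    intro Z
    have h1 : N Z ≤ A * ENNReal.ofReal (Real.exp (ε * q (X - Z))) := by
      have h2 : N Z * eGauss q ε (X - Z) ≤ A := le_iSup (fun Y => N Y * eGauss q ε (X - Y)) Z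
      calc N Z = N Z * eGauss q ε (X - Z) * ENNReal.ofReal (Real.exp (ε * q (X - Z))) := by
            rw [eGauss, mul_assoc, ← ENNReal.ofReal_mul (Real.exp_pos _).le, ← Real.exp_add]
            simp
        _ ≤ _ := by gcongr
    have hp1' : 0 ≤ 1 - p := by linarith
    calc N Z = N Z ^ p * N Z ^ (1 - p) := by
          rw [← ENNReal.rpow_add_of_nonneg _ _ hp.le hp1']; simp
      _ ≤ N Z ^ p * (A * ENNReal.ofReal (Real.exp (ε * q (X - Z)))) ^ (1 - p) := by
          gcongr
      _ = _ := by
          rw [ENNReal.mul_rpow_of_nonneg _ _ hp1', ENNReal.ofReal_rpow_of_pos (Real.exp_pos _), ← Real.exp_mul,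
            show (1 - p) * ε * q (X - Z) = ε * q (X - Z) * (1 - p) by ring]
  -- Since (1 - p/2)(1 + p/2) ≤ 1, the kernel and the weight e^{-ε q(X - Y)} together pay for the
  -- growth at rate (1 - p)ε in q(X - Z) and still leave decay at rate pε/2, uniformly in Y.
  have key : ∀ Y, (∫⁻ Z, N Z * eGauss q c (Y - Z) ∂μ) * eGauss q ε (X - Y) ≤ A ^ (1 - p) * B := by
    intro Y
    have hAp : A ^ (1 - p) ≠ ⊤ := ENNReal.rpow_ne_top_of_nonneg (by linarith) hAtop
    rw [← lintegral_mul_const' _ _ (by simp [eGauss]), hB, ← lintegral_const_mul' _ _ hAp]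
    refine lintegral_mono fun Z => ?_
    calc _ ≤ N Z ^ p * (A ^ (1 - p) * ENNReal.ofReal (Real.exp ((1 - p) * ε * q (X - Z)))) *
          eGauss q c (Y - Z) * eGauss q ε (X - Y) := by
          gcongr
          exact hpt Z
      _ = A ^ (1 - p) * (N Z ^ p * (ENNReal.ofReal (Real.exp ((1 - p) * ε * q (X - Z))) *
          eGauss q c (Y - Z) * eGauss q ε (X - Y))) := by ring
      _ ≤ _ := by
          gcongr
          rw [eGauss, eGauss, eGauss, ← ENNReal.ofReal_mul (Real.exp_pos _).le, ← Real.exp_add,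
            ← ENNReal.ofReal_mul (Real.exp_pos _).le, ← Real.exp_add]
          apply ENNReal.ofReal_le_ofReal
          apply Real.exp_le_exp.2
          have h1 := hq (p / 2) (by positivity) (X - Y) (Y - Z)
          rw [sub_add_sub_cancel] at h1
          have h2 : (1 - p / 2) * ε * q (X - Z) ≤
              (1 - p / 2) * ε * ((1 + p / 2) * q (X - Y) + (1 + (p / 2)⁻¹) * q (Y - Z)) := by
            have : 0 ≤ 1 - p / 2 := by linarith
            gcongr
          have h3 : ε * (1 + (p / 2)⁻¹) = c := by rw [hε]; field_simp
          have h4 : (1 - p / 2) * ε * ((1 + p / 2) * q (X - Y) + (1 + (p / 2)⁻¹) * q (Y - Z)) =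
              ε * q (X - Y) - ε * (p / 2) ^ 2 * q (X - Y) + (1 - p / 2) * (ε * (1 + (p / 2)⁻¹)) * q (Y - Z) := by ring
          rw [h3] at h4
          have h5 : 0 ≤ ε * (p / 2) ^ 2 * q (X - Y) := by have := hq0 (X - Y); positivity
          have h6 : 0 ≤ (p / 2) * c * q (Y - Z) := by have := hq0 (Y - Z); positivity
          nlinarith
  -- The supremum over Y gives A ≤ C A^{1-p} B, and cancelling yields A^p ≤ C B.
  have hABC : A ≤ C * (A ^ (1 - p) * B) := by
    refine iSup_le fun Y => ?_
    calc _ ≤ C * (∫⁻ Z, N Z * eGauss q c (Y - Z) ∂μ) * eGauss q ε (X - Y) := by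
          gcongr
          exact hN Y
      _ ≤ _ := by
          rw [mul_assoc]
          exact mul_le_mul_right (key Y) _
  have hAB : A ^ p ≤ C * B := by
    rcases eq_or_ne A 0 with h0 | h0
    · rw [h0, ENNReal.zero_rpow_of_pos hp]; exact zero_le
    · have hAp0 : A ^ (1 - p) ≠ 0 := by
        simp [h0, hAtop]
      have hAp : A ^ (1 - p) ≠ ⊤ := ENNReal.rpow_ne_top_of_nonneg (by linarith) hAtop
      have e : A ^ p * A ^ (1 - p) = A := by
        rw [← ENNReal.rpow_add_of_nonneg _ _ hp.le (by linarith)]; simp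
      rw [← ENNReal.mul_le_mul_iff_left hAp0 hAp, e]
      refine hABC.trans (le_of_eq (by ring))
  have hN'X : N' X ≤ C * (A ^ (1 - p) * B) := by
    refine (hN' X).trans ?_
    gcongr
    have h1 := key X
    simpa [eGauss, hqz] using h1
  calc N' X ^ p ≤ (C * (A ^ (1 - p) * B)) ^ p := by gcongr
    _ = C ^ p * ((A ^ p) ^ (1 - p) * B ^ p) := by
        rw [ENNReal.mul_rpow_of_nonneg _ _ hp.le, ENNReal.mul_rpow_of_nonneg _ _ hp.le, ← ENNReal.rpow_mul,
          ← ENNReal.rpow_mul, mul_comm p]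
    _ ≤ C ^ p * ((C * B) ^ (1 - p) * B ^ p) := by
        have : 0 ≤ 1 - p := by linarith
        gcongr
    _ = C * B := by
        have : 0 ≤ 1 - p := by linarith
        rw [ENNReal.mul_rpow_of_nonneg _ _ this, mul_assoc, ← ENNReal.rpow_add_of_nonneg _ _ this hp.le,
          ← mul_assoc, ← ENNReal.rpow_add_of_nonneg _ _ hp.le this]
        simp

end Peetre

/-! ### Change of windows. -/

section WindowChange

theorem eGauss_anti {G : Type*} {q : G → ℝ} (hq : ∀ X, 0 ≤ q X) {c c' : ℝ} (h : c ≤ c') (X : G) :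
    eGauss q c' X ≤ eGauss q c X := by
  refine ENNReal.ofReal_le_ofReal (Real.exp_le_exp.2 ?_)
  have := mul_le_mul_of_nonneg_right h (hq X)
  linarith

variable {V : Type*} [NormedAddCommGroup V] [InnerProductSpace ℝ V]

/-- The square of the Euclidean norm on `V × V`. -/
noncomputable def phaseSq {V : Type*} [NormedAddCommGroup V] (Z : V × V) : ℝ := ‖Z.1‖ ^ 2 + ‖Z.2‖ ^ 2

theorem norm_add_sq_le {V : Type*} [SeminormedAddCommGroup V] {τ : ℝ} (hτ : 0 < τ) (x y : V) :
    ‖x + y‖ ^ 2 ≤ (1 + τ) * ‖x‖ ^ 2 + (1 + τ⁻¹) * ‖y‖ ^ 2 := by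
  have h1 : ‖x + y‖ ^ 2 ≤ (‖x‖ + ‖y‖) ^ 2 := by gcongr; exact norm_add_le x y
  have h2 : 2 * (‖x‖ * ‖y‖) ≤ τ * ‖x‖ ^ 2 + τ⁻¹ * ‖y‖ ^ 2 := by
    have h3 : τ * ‖x‖ ^ 2 + τ⁻¹ * ‖y‖ ^ 2 - 2 * (‖x‖ * ‖y‖) = τ * (‖x‖ - τ⁻¹ * ‖y‖) ^ 2 := by
      field_simp; ring
    have := mul_nonneg hτ.le (sq_nonneg (‖x‖ - τ⁻¹ * ‖y‖))
    linarith
  nlinarith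

theorem phaseSq_add_le {V : Type*} [NormedAddCommGroup V] {τ : ℝ} (hτ : 0 < τ) (X Y : V × V) :
    phaseSq (X + Y) ≤ (1 + τ) * phaseSq X + (1 + τ⁻¹) * phaseSq Y := by
  have h1 := norm_add_sq_le hτ X.1 Y.1
  have h2 := norm_add_sq_le hτ X.2 Y.2
  simp only [phaseSq, Prod.fst_add, Prod.snd_add]
  linarith

theorem phaseSq_nonneg {V : Type*} [NormedAddCommGroup V] (X : V × V) : 0 ≤ phaseSq X := by
  unfold phaseSq; positivity

theorem phaseSq_neg {V : Type*} [NormedAddCommGroup V] (X : V × V) : phaseSq (-X) = phaseSq X := by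
  simp [phaseSq]

variable [FiniteDimensional ℝ V] [MeasurableSpace V] [BorelSpace V]

/-- Translating the integration variable by X.1 leaves only unimodular phases, so in modulus the
coefficients form a convolution kernel. -/
theorem norm_tfCoeff_tfShift (φ ψ : V → ℂ) (X Z : V × V) :
    ‖tfCoeff (tfShift ψ X.1 X.2) φ Z‖ = ‖tfCoeff (fun y => conj (ψ y)) φ (Z - X)‖ := by
  have e : tfCoeff (tfShift ψ X.1 X.2) φ Z =
      expNeg (X.2 - Z.2) X.1 * tfCoeff (fun y => conj (ψ y)) φ (Z - X) := by
    rw [tfCoeff, cFourier, tfCoeff, cFourier, ← integral_const_mul,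
      ← integral_add_right_eq_self _ X.1]
    congr 1
    ext t
    simp only [tfShift, add_sub_cancel_right, conj_expNeg, Prod.fst_sub, Prod.snd_sub, neg_sub]
    rw [show t + X.1 - Z.1 = t - (Z.1 - X.1) by abel, sub_eq_add_neg X.2, expNeg_add, expNeg_add,
      expNeg_add_right, expNeg_add_right]
    ring
  rw [e, norm_mul, norm_expNeg, one_mul]

/-- A shift of ψ is reconstructed from shifts of φ, with coefficients whose modulus depends only on
Z - X and has Gaussian decay. The constants do not depend on u. -/
theorem exists_enorm_gsPair_le_convolution {φ ψ : V → ℂ} (hφ : φ ∈ GelfandShilov V) (hψ : ψ ∈ GelfandShilov V)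
    {x₀ : V} (hx₀ : φ x₀ ≠ 0) : ∃ δ > 0, ∃ C : ℝ≥0, ∀ u : GelfandShilov V → ℂ, IsGSDistribution u → ∀ X : V × V,
      ‖gsPair u (tfShift ψ X.1 X.2)‖ₑ ≤
        C * ∫⁻ Z : V × V, ‖gsPair u (tfShift φ Z.1 Z.2)‖ₑ * eGauss phaseSq δ (X - Z) := by
  obtain ⟨δ, hδ, C, hC, hb⟩ := tfCoeff_decay (conj_mem_gelfandShilov hψ) hφ
  have hne := tfNorm_ne_zero hφ hx₀
  refine ⟨δ, hδ, (C / ‖tfNorm φ‖).toNNReal, fun u hu X => ?_⟩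
  have h1 := hu.tfNorm_mul_gsPair (tfShift_mem hψ X.1 X.2) hφ
  have h2 : gsPair u (tfShift ψ X.1 X.2) = ∫ Z : V × V, (tfNorm φ)⁻¹ *
      (tfCoeff (tfShift ψ X.1 X.2) φ Z * gsPair u (tfShift φ Z.1 Z.2)) := by
    rw [integral_const_mul, ← h1, inv_mul_cancel_left₀ hne]
  rw [h2, ← lintegral_const_mul' _ _ (by finiteness)]
  refine (enorm_integral_le_lintegral_enorm _).trans (lintegral_mono fun Z => ?_)
  rw [enorm_mul, enorm_mul, ← mul_assoc, mul_comm ‖gsPair u (tfShift φ Z.1 Z.2)‖ₑ, ← mul_assoc]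
  refine mul_le_mul_left ?_ _
  rw [eGauss, ← enorm_mul, ← ofReal_norm, ← ENNReal.ofReal, ← ENNReal.ofReal_mul (by positivity)]
  apply ENNReal.ofReal_le_ofReal
  rw [norm_mul, norm_inv, norm_tfCoeff_tfShift]
  have h3 := hb (Z - X)
  have h4 : phaseSq (X - Z) = ‖(Z - X).1‖ ^ 2 + ‖(Z - X).2‖ ^ 2 := by
    rw [← phaseSq_neg, neg_sub]; rfl
  rw [h4]
  exact (mul_le_mul_of_nonneg_left h3 (by positivity)).trans (le_of_eq (by ring))

/-- Change of windows for short-time Fourier transforms, in a form which is suited to quasi-norms. -/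
theorem exists_enorm_gsPair_rpow_le_convolution {φ ψ : V → ℂ} (hφ : φ ∈ GelfandShilov V)
    (hψ : ψ ∈ GelfandShilov V) {x₀ : V} (hx₀ : φ x₀ ≠ 0) {p : ℝ} (hp : 0 < p) (hp1 : p ≤ 1) :
    ∃ δ > 0, ∃ C : ℝ≥0, ∀ u : GelfandShilov V → ℂ, IsGSDistribution u → ∀ X : V × V,
      ‖gsPair u (tfShift ψ X.1 X.2)‖ₑ ^ p ≤
        C * ∫⁻ Z : V × V, ‖gsPair u (tfShift φ Z.1 Z.2)‖ₑ ^ p * eGauss phaseSq δ (X - Z) := by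
  obtain ⟨δ₁, hδ₁, C₁, h₁⟩ := exists_enorm_gsPair_le_convolution hφ hφ hx₀
  obtain ⟨δ₂, hδ₂, C₂, h₂⟩ := exists_enorm_gsPair_le_convolution hφ hψ hx₀
  -- The window φ reproduces itself (this bounds N) and reproduces ψ (this bounds N'); the smaller
  -- of the two decay rates serves both.
  obtain ⟨δ, hδ, H⟩ := rpow_le_convolution (μ := (volume : Measure (V × V))) (q := phaseSq) phaseSq_nonneg
    (by simp [phaseSq]) (fun τ hτ X Y => phaseSq_add_le hτ X Y) phaseSq_neg hp hp1 (lt_min hδ₁ hδ₂)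
  refine ⟨δ, hδ, max C₁ C₂, fun u hu X => ?_⟩
  refine H (max C₁ C₂) (fun Z => ‖gsPair u (tfShift φ Z.1 Z.2)‖ₑ) (fun Z => ‖gsPair u (tfShift ψ Z.1 Z.2)‖ₑ)
    (fun X => (h₁ u hu X).trans ?_) (fun X => (h₂ u hu X).trans ?_) (fun ε hε => ?_) X
  · gcongr
    · exact le_max_left _ _
    · exact eGauss_anti phaseSq_nonneg (min_le_left _ _) _
  · gcongr
    · exact le_max_right _ _
    · exact eGauss_anti phaseSq_nonneg (min_le_right _ _) _
  · obtain ⟨D, hD, hb⟩ := norm_gsPair_tfShift_le hφ hu hε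
    refine ⟨D.toNNReal, fun X => ?_⟩
    rw [← ofReal_norm, ← ENNReal.ofReal, ← ENNReal.ofReal_mul hD]
    exact ENNReal.ofReal_le_ofReal (hb X.1 X.2)

end WindowChange

/-! ### Quasi-Young functions and Jensen's inequality. -/

section Star

/-- Functions with the properties of quasi-Young functions of order `p` which matter for
the Luxemburg quasi-norm. -/
structure IsStarYoung (p : ℝ) (Φ : ℝ≥0∞ → ℝ≥0∞) : Prop where
  zero : Φ 0 = 0
  top : Φ ⊤ = ⊤
  star : ∀ c t : ℝ≥0∞, c ≤ 1 → Φ (c * t) ≤ c ^ p * Φ t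
  unbounded : ∀ K : ℝ≥0, ∃ s : ℝ≥0, 0 < s ∧ K < Φ s

/-- Convexity between 0 and t gives the scaling inequality of order 1, and the limit at infinity
gives unboundedness. -/
theorem IsYoung.isStarYoung {Φ : ℝ≥0∞ → ℝ≥0∞} (h : IsYoung Φ) : IsStarYoung 1 Φ where
  zero := h.zero
  top := h.top
  star c t hc := by
    rw [ENNReal.rpow_one]
    rcases eq_or_ne c 0 with rfl | hc0
    · simp [h.zero]
    rcases eq_or_ne t ⊤ with rfl | ht
    · rw [h.top, ENNReal.mul_top hc0]; exact le_top
    lift t to ℝ≥0 using ht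
    lift c to ℝ≥0 using ne_top_of_le_ne_top ENNReal.one_ne_top hc
    have hc' : c ≤ 1 := by exact_mod_cast hc
    have := h.convex c (1 - c) t 0 (add_tsub_cancel_of_le hc')
    simpa [h.zero] using this
  unbounded K := by
    have h1 := (h.tendsto.eventually (lt_mem_nhds (ENNReal.coe_lt_top (r := K)))).and (eventually_gt_atTop 0)
    obtain ⟨s, hs, hs0⟩ := h1.exists
    exact ⟨s, hs0, hs⟩

theorem IsQuasiYoung.isStarYoung {Φ : ℝ≥0∞ → ℝ≥0∞} (h : IsQuasiYoung Φ) :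
    ∃ p : ℝ, 0 < p ∧ p ≤ 1 ∧ IsStarYoung p Φ := by
  obtain ⟨p, hp, hp1, Φ₀, h₀, hΦ⟩ := h
  have h₁ := h₀.isStarYoung
  refine ⟨p, hp, hp1, ⟨?_, ?_, fun c t hc => ?_, fun K => ?_⟩⟩
  · rw [hΦ, ENNReal.zero_rpow_of_pos hp, h₁.zero]
  · rw [hΦ, ENNReal.top_rpow_of_pos hp, h₁.top]
  · rw [hΦ, hΦ, ENNReal.mul_rpow_of_nonneg _ _ hp.le]
    have := h₁.star (c ^ p) (t ^ p) (ENNReal.rpow_le_one hc hp.le)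
    rwa [ENNReal.rpow_one] at this
  · obtain ⟨s, hs0, hs⟩ := h₁.unbounded K
    refine ⟨s ^ p⁻¹, by positivity, ?_⟩
    rw [hΦ, ← ENNReal.coe_rpow_of_nonneg _ hp.le, ← NNReal.rpow_mul, inv_mul_cancel₀ hp.ne', NNReal.rpow_one]
    exact hs

theorem IsStarYoung.anti {p p' : ℝ} {Φ : ℝ≥0∞ → ℝ≥0∞} (h : IsStarYoung p Φ) (hp : p' ≤ p) :
    IsStarYoung p' Φ where
  zero := h.zero
  top := h.top
  star c t hc := (h.star c t hc).trans
    (mul_le_mul_left (ENNReal.rpow_le_rpow_of_exponent_ge hc hp) _)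
  unbounded := h.unbounded

/-- Passing to s ↦ Φ(s^{1/p}) turns order p into order 1. Together with `orliczNorm_rpow` this
reduces quasi-norms to the case where a Minkowski inequality is available. -/
theorem IsStarYoung.comp_rpow {p : ℝ} {Φ : ℝ≥0∞ → ℝ≥0∞} (hp : 0 < p) (h : IsStarYoung p Φ) :
    IsStarYoung 1 (fun s => Φ (s ^ p⁻¹)) where
  zero := by rw [ENNReal.zero_rpow_of_pos (by positivity), h.zero]
  top := by rw [ENNReal.top_rpow_of_pos (by positivity), h.top]
  star c t hc := by
    rw [ENNReal.mul_rpow_of_nonneg _ _ (by positivity)]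
    refine (h.star _ _ (ENNReal.rpow_le_one hc (by positivity))).trans ?_
    rw [← ENNReal.rpow_mul, inv_mul_cancel₀ hp.ne']
  unbounded K := by
    obtain ⟨s, hs0, hs⟩ := h.unbounded K
    refine ⟨s ^ p, by positivity, ?_⟩
    rw [← ENNReal.coe_rpow_of_nonneg _ (by positivity), ← NNReal.rpow_mul, mul_inv_cancel₀ hp.ne', NNReal.rpow_one]
    exact hs

theorem IsStarYoung.monotone {p : ℝ} {Φ : ℝ≥0∞ → ℝ≥0∞} (hp : 0 ≤ p) (h : IsStarYoung p Φ) : Monotone Φ := by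
  intro s t hst
  rcases eq_or_ne t ⊤ with rfl | ht
  · rw [h.top]; exact le_top
  rcases eq_or_ne t 0 with rfl | ht0
  · rw [nonpos_iff_eq_zero.1 hst]
  have h1 := h.star (s / t) t (ENNReal.div_le_of_le_mul (by simpa using hst))
  rw [ENNReal.div_mul_cancel ht0 ht] at h1
  exact h1.trans (mul_le_of_le_one_left' (ENNReal.rpow_le_one (ENNReal.div_le_of_le_mul (by simpa using hst)) hp))

/-- Jensen's inequality up to a factor. -/
theorem IsStarYoung.jensen {Φ : ℝ≥0∞ → ℝ≥0∞} (h : IsStarYoung 1 Φ) {T : Type*} [MeasurableSpace T] {ν : Measure T}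
    [IsProbabilityMeasure ν] {F : T → ℝ≥0∞} (hF : Measurable F) :
    Φ ((∫⁻ t, F t ∂ν) / 2) ≤ ∫⁻ t, Φ (F t) ∂ν := by
  have hmono := h.monotone zero_le_one
  have hΦm : Measurable Φ := hmono.measurable
  have hΦF : Measurable fun t => Φ (F t) := hΦm.comp hF
  set m := ∫⁻ t, F t ∂ν with hm
  -- For F > s this is the monotonicity of Φ(s)/s, which replaces a supporting line; for F ≤ s the
  -- second term suffices.
  have key : ∀ s : ℝ≥0, ∀ t, (F t) * Φ s ≤ s * Φ (F t) + s * Φ s := by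
    intro s t
    rcases le_or_gt (F t) s with hst | hst
    · exact (by gcongr : F t * Φ s ≤ s * Φ s).trans le_add_self
    · refine le_trans ?_ le_self_add
      rcases eq_or_ne (F t) ⊤ with ht | ht
      · rw [ht, h.top]
        rcases eq_or_ne s 0 with rfl | hs
        · simp [h.zero]
        · rw [ENNReal.mul_top (by simpa using hs)]; exact le_top
      have h0 : F t ≠ 0 := (bot_le.trans_lt hst).ne'
      have h1 := h.star (s / F t) (F t) (ENNReal.div_le_of_le_mul (by simpa using hst.le))
      rw [ENNReal.div_mul_cancel h0 ht, ENNReal.rpow_one] at h1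
      calc F t * Φ s ≤ F t * (s / F t * Φ (F t)) := by gcongr
        _ = F t * (s / F t) * Φ (F t) := by ring
        _ = _ := by rw [ENNReal.mul_div_cancel h0 ht]
  have hint : ∀ s : ℝ≥0, m * Φ s ≤ s * ∫⁻ t, Φ (F t) ∂ν + s * Φ s := by
    intro s
    rw [hm, ← lintegral_mul_const _ hF]
    refine (lintegral_mono (key s)).trans ?_
    rw [lintegral_add_right _ measurable_const, lintegral_const_mul _ hΦF]
    simp
  have hpos : ∀ s : ℝ≥0, (s : ℝ≥0∞) < m → ∃ A : Set T, 0 < ν A ∧ ∀ t ∈ A, (s : ℝ≥0∞) ≤ F t := by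
    intro s hs
    refine ⟨{t | s ≤ F t}, ?_, fun t ht => ht⟩
    rw [pos_iff_ne_zero]
    intro h0
    have h1 : ∀ᵐ t ∂ν, F t ≤ s := by
      rw [ae_iff]
      refine measure_mono_null (fun t ht => ?_) h0
      exact (not_le.1 ht).le
    have : m ≤ s := by
      calc m ≤ ∫⁻ _, (s : ℝ≥0∞) ∂ν := lintegral_mono_ae h1
        _ = s := by simp
    exact absurd hs (not_lt.2 this)
  -- As 2s ≤ m, the integrated inequality gives 2sΦ(s) ≤ s∫Φ(F) + sΦ(s), and sΦ(s) cancels when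
  -- finite. If Φ(s) = ∞, then F ≥ s on a set of positive measure and the right side is infinite.
  have hfin : ∀ s : ℝ≥0, 2 * (s : ℝ≥0∞) ≤ m → 0 < s → Φ s ≤ ∫⁻ t, Φ (F t) ∂ν := by
    intro s hs hs0
    rcases eq_or_ne (Φ s) ⊤ with ht | ht
    · have hsm : (s : ℝ≥0∞) < m := by
        refine lt_of_lt_of_le ?_ hs
        rw [two_mul]
        exact_mod_cast lt_add_of_pos_left s hs0
      obtain ⟨A, hA, hAs⟩ := hpos s hsm
      have h2 : ⊤ * ν {t | ⊤ ≤ Φ (F t)} ≤ ∫⁻ t, Φ (F t) ∂ν := mul_meas_ge_le_lintegral (hΦm.comp hF) ⊤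
      have h3 : 0 < ν {t | ⊤ ≤ Φ (F t)} := hA.trans_le (measure_mono fun t hmem => by
        have := hmono (hAs t hmem)
        rwa [ht] at this)
      rw [ENNReal.top_mul h3.ne'] at h2
      exact le_top.trans h2
    · have h1 : 2 * (s * Φ s) ≤ s * ∫⁻ t, Φ (F t) ∂ν + s * Φ s := by
        calc 2 * (s * Φ s) = 2 * s * Φ s := by ring
          _ ≤ m * Φ s := by gcongr
          _ ≤ _ := hint s
      rw [two_mul] at h1
      have h2 := (ENNReal.add_le_add_iff_right (ENNReal.mul_ne_top ENNReal.coe_ne_top ht)).1 h1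
      exact (ENNReal.mul_le_mul_iff_right (by simpa using hs0.ne') ENNReal.coe_ne_top).1 h2
  -- For an infinite mean the bound holds with every s > 0, and unboundedness of Φ makes the right
  -- side infinite; for a finite mean s = m/2.
  rcases eq_or_ne m ⊤ with hmt | hmt
  · rw [hmt, ENNReal.top_div_of_ne_top (by simp), h.top]
    refine top_le_iff.2 (ENNReal.eq_top_of_forall_nnreal_le fun K => ?_)
    obtain ⟨s, hs0, hs⟩ := h.unbounded K
    exact hs.le.trans (hfin s (by rw [hmt]; exact le_top) hs0)
  · have h2 : m / 2 ≠ ⊤ := ENNReal.div_ne_top hmt (by simp)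
    obtain ⟨s, hs⟩ : ∃ s : ℝ≥0, (s : ℝ≥0∞) = m / 2 := ⟨_, ENNReal.coe_toNNReal h2⟩
    rcases eq_or_ne s 0 with rfl | hs0
    · rw [← hs]; simp [h.zero]
    rw [← hs]
    refine hfin s ?_ (pos_iff_ne_zero.2 hs0)
    rw [hs, ENNReal.mul_div_cancel (by simp) (by simp)]

end Star

/-! ### Luxemburg quasi-norms and Minkowski's inequality. -/

section Luxemburg

variable {α : Type*} [MeasureSpace α] {Φ : ℝ≥0∞ → ℝ≥0∞}

theorem orliczNorm_le {F : α → ℝ≥0∞} {l : ℝ≥0} (hl : 0 < l) (h : ∫⁻ x, Φ (F x / l) ≤ 1) : orliczNorm Φ F ≤ l :=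
  iInf_le_of_le l (iInf_le_of_le hl (iInf_le _ h))

/-- The strict inequality supplies an admissible value below l, so the infimum need not be attained.
-/
theorem lintegral_le_one_of_orliczNorm_lt {p : ℝ} (hp : 0 ≤ p) (hΦ : IsStarYoung p Φ) {F : α → ℝ≥0∞} {l : ℝ≥0∞}
    (h : orliczNorm Φ F < l) : ∫⁻ x, Φ (F x / l) ≤ 1 := by
  simp only [orliczNorm, iInf_lt_iff] at h
  obtain ⟨k, hk, hk1, hkl⟩ := h
  refine le_trans (lintegral_mono fun x => hΦ.monotone hp ?_) hk1
  gcongr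

theorem le_orliczNorm {F : α → ℝ≥0∞} {m : ℝ≥0∞} (h : ∀ l : ℝ≥0, 0 < l → ∫⁻ x, Φ (F x / l) ≤ 1 → m ≤ l) :
    m ≤ orliczNorm Φ F :=
  le_iInf fun l => le_iInf fun hl => le_iInf fun h1 => h l hl h1

theorem orliczNorm_mono {p : ℝ} (hp : 0 ≤ p) (hΦ : IsStarYoung p Φ) {F G : α → ℝ≥0∞} (h : ∀ x, F x ≤ G x) :
    orliczNorm Φ F ≤ orliczNorm Φ G :=
  le_orliczNorm fun l hl h1 => orliczNorm_le hl ((lintegral_mono fun x => hΦ.monotone hp (by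
    have := h x
    gcongr)).trans h1)

theorem orliczNorm_zero (h0 : Φ 0 = 0) : orliczNorm Φ (fun _ : α => 0) = 0 := by
  refine le_antisymm (ENNReal.le_of_forall_pos_le_add fun ε hε _ => ?_) bot_le
  rw [zero_add]
  exact orliczNorm_le hε (by simp [h0])

theorem orliczNorm_const_mul_le {c : ℝ≥0} (hc : 0 < c) (F : α → ℝ≥0∞) :
    orliczNorm Φ (fun x => c * F x) ≤ c * orliczNorm Φ F := by
  have hc0 : (c : ℝ≥0∞) ≠ 0 := by simpa using hc.ne'
  rw [mul_comm, ← ENNReal.div_le_iff hc0 ENNReal.coe_ne_top]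
  refine le_orliczNorm fun l hl h1 => ?_
  rw [ENNReal.div_le_iff hc0 ENNReal.coe_ne_top, ← ENNReal.coe_mul]
  refine orliczNorm_le (by positivity) (le_of_eq_of_le (lintegral_congr fun x => ?_) h1)
  rw [mul_comm l c, ENNReal.coe_mul, ENNReal.mul_div_mul_left _ _ hc0 ENNReal.coe_ne_top]

theorem orliczNorm_const_mul {c : ℝ≥0} (hc : 0 < c) (F : α → ℝ≥0∞) :
    orliczNorm Φ (fun x => c * F x) = c * orliczNorm Φ F := by
  have hc0 : (c : ℝ≥0∞) ≠ 0 := by simpa using hc.ne'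
  refine le_antisymm (orliczNorm_const_mul_le hc F) ?_
  have h := orliczNorm_const_mul_le (Φ := Φ) (inv_pos.2 hc) (fun x => c * F x)
  simp_rw [← mul_assoc, ENNReal.coe_inv hc.ne', ENNReal.inv_mul_cancel hc0 ENNReal.coe_ne_top, one_mul] at h
  calc _ ≤ (c : ℝ≥0∞) * ((c : ℝ≥0∞)⁻¹ * orliczNorm Φ fun x => c * F x) := by gcongr
    _ = _ := by rw [← mul_assoc, ENNReal.mul_inv_cancel hc0 ENNReal.coe_ne_top, one_mul]

theorem orliczNorm_comp {e : α ≃ᵐ α} (he : MeasurePreserving e) (F : α → ℝ≥0∞) :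
    orliczNorm Φ (fun x => F (e x)) = orliczNorm Φ F := by
  have : ∀ l : ℝ≥0, ∫⁻ x, Φ (F (e x) / l) = ∫⁻ x, Φ (F x / l) := fun l =>
    he.lintegral_comp_emb e.measurableEmbedding (fun x => Φ (F x / l))
  simp only [orliczNorm, this]

/-- The substitution l ↦ l^p in the defining infimum. -/
theorem orliczNorm_rpow {p : ℝ} (hp : 0 < p) (F : α → ℝ≥0∞) :
    orliczNorm Φ F ^ p = orliczNorm (fun s => Φ (s ^ p⁻¹)) fun x => F x ^ p := by
  have hpi : p⁻¹ * p = 1 := inv_mul_cancel₀ hp.ne'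
  have hpi' : p * p⁻¹ = 1 := mul_inv_cancel₀ hp.ne'
  apply le_antisymm
  · refine le_orliczNorm fun l hl h1 => ?_
    have : orliczNorm Φ F ≤ ((l ^ p⁻¹ : ℝ≥0) : ℝ≥0∞) := by
      refine orliczNorm_le (by positivity) (le_of_eq_of_le (lintegral_congr fun x => ?_) h1)
      rw [ENNReal.div_rpow_of_nonneg _ _ (by positivity), ← ENNReal.rpow_mul, hpi', ENNReal.rpow_one,
        ENNReal.coe_rpow_of_nonneg _ (by positivity)]
    calc _ ≤ ((l ^ p⁻¹ : ℝ≥0) : ℝ≥0∞) ^ p := by gcongr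
      _ = l := by
        rw [← ENNReal.coe_rpow_of_nonneg _ hp.le, ← NNReal.rpow_mul, hpi, NNReal.rpow_one]
  · rw [← ENNReal.rpow_inv_le_iff hp]
    refine le_orliczNorm fun l hl h1 => ?_
    rw [ENNReal.rpow_inv_le_iff hp, ← ENNReal.coe_rpow_of_nonneg _ hp.le]
    refine orliczNorm_le (by positivity) (le_of_eq_of_le (lintegral_congr fun x => ?_) h1)
    rw [ENNReal.div_rpow_of_nonneg _ _ (by positivity), ← ENNReal.rpow_mul, hpi', ENNReal.rpow_one,
      ← ENNReal.coe_rpow_of_nonneg _ (by positivity), ← NNReal.rpow_mul, hpi', NNReal.rpow_one]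

/-- A function which is bounded below on a set of positive measure has a nonzero norm. -/
theorem exists_pos_le_orliczNorm {p : ℝ} (hp : 0 ≤ p) (hΦ : IsStarYoung p Φ) {U : Set α} (hU : MeasurableSet U)
    (hU0 : volume U ≠ 0) {δ : ℝ≥0∞} (hδ : 0 < δ) :
    ∃ m : ℝ≥0∞, 0 < m ∧ ∀ F : α → ℝ≥0∞, (∀ x ∈ U, δ ≤ F x) → m ≤ orliczNorm Φ F := by
  obtain ⟨δ', hδ'0, hδ'⟩ := ENNReal.lt_iff_exists_nnreal_btwn.1 hδ
  have hδ'' : 0 < δ' := by simpa using hδ'0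
  obtain ⟨K, hK⟩ : ∃ K : ℝ≥0, (K : ℝ≥0∞) = (volume U)⁻¹ := ⟨_, ENNReal.coe_toNNReal (ENNReal.inv_ne_top.2 hU0)⟩
  -- Here Φ(s)|U| > 1, so F/l ≥ s on U is impossible for an admissible l; this bounds l below by
  -- δ'/s.
  obtain ⟨s, hs0, hs⟩ := hΦ.unbounded K
  refine ⟨(δ' / s : ℝ≥0), by exact_mod_cast div_pos hδ'' hs0, fun F hF => le_orliczNorm fun l hl h1 => ?_⟩
  by_contra hlt
  rw [not_le] at hlt
  have hlt' : l < δ' / s := by exact_mod_cast hlt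
  have hsl : s ≤ δ' / l := by
    rw [le_div_iff₀ hl, mul_comm]
    exact ((lt_div_iff₀ hs0).1 hlt').le
  have h2 : ∀ x ∈ U, Φ s ≤ Φ (F x / l) := fun x hx => hΦ.monotone hp (by
    calc (s : ℝ≥0∞) ≤ ((δ' / l : ℝ≥0) : ℝ≥0∞) := by exact_mod_cast hsl
      _ = δ' / l := ENNReal.coe_div hl.ne'
      _ ≤ _ := by
        have := hδ'.le.trans (hF x hx)
        gcongr)
  have h3 : Φ s * volume U ≤ 1 := by
    calc Φ s * volume U = ∫⁻ _ in U, Φ s := by rw [setLIntegral_const]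
      _ ≤ ∫⁻ x in U, Φ (F x / l) := setLIntegral_mono' hU h2
      _ ≤ ∫⁻ x, Φ (F x / l) := setLIntegral_le_lintegral _ _
      _ ≤ 1 := h1
  rw [hK] at hs
  rcases eq_or_ne (volume U) ⊤ with ht | ht
  · rw [ht, ENNReal.mul_top (bot_le.trans_lt hs).ne'] at h3
    exact absurd h3 (by simp)
  · have h4 := ENNReal.mul_lt_mul_left hU0 ht hs
    rw [ENNReal.inv_mul_cancel hU0 ht] at h4
    exact absurd h3 (not_le.2 h4)

/-- For every l the quotient is ∞ on U, and Φ(∞) = ∞ on a set of positive measure leaves no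
admissible l. -/
theorem orliczNorm_top_mul {p : ℝ} (hΦ : IsStarYoung p Φ) {U : Set α} (hU : MeasurableSet U)
    (hU0 : volume U ≠ 0) {F : α → ℝ≥0∞} (hF : ∀ x ∈ U, F x ≠ 0) : orliczNorm Φ (fun x => ⊤ * F x) = ⊤ := by
  refine top_le_iff.1 (le_orliczNorm fun l hl h1 => ?_)
  exfalso
  have h2 : ∫⁻ x in U, Φ (⊤ * F x / l) = ∫⁻ _ in U, ⊤ := setLIntegral_congr_fun hU fun x hx => by
    simp only [ENNReal.top_mul (hF x hx), ENNReal.top_div_of_ne_top (ENNReal.coe_ne_top (r := l)), hΦ.top]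
  rw [setLIntegral_const, ENNReal.top_mul hU0] at h2
  have h3 := (setLIntegral_le_lintegral U (fun x => Φ (⊤ * F x / l))).trans h1
  rw [h2] at h3
  exact absurd h3 (by simp)

/-- The norm lies below m exactly when some positive rational below m is admissible, so sublevel
sets are countable unions of measurable sets. -/
theorem measurable_orliczNorm {β : Type*} [MeasurableSpace β] [SFinite (volume : Measure α)] {p : ℝ} (hp : 0 ≤ p)
    (hΦ : IsStarYoung p Φ) {F : α × β → ℝ≥0∞} (hF : Measurable F) :
    Measurable fun y => orliczNorm Φ fun x => F (x, y) := by
  refine measurable_of_Iio fun m => ?_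
  have e : (fun y => orliczNorm Φ fun x => F (x, y)) ⁻¹' Set.Iio m =
      ⋃ (q : ℚ) (_ : 0 < q ∧ ENNReal.ofReal q < m), {y | ∫⁻ x, Φ (F (x, y) / ENNReal.ofReal q) ≤ 1} := by
    ext y
    simp only [Set.mem_preimage, Set.mem_Iio, Set.mem_iUnion, Set.mem_ofPred_eq, exists_prop]
    constructor
    · intro h
      obtain ⟨q, hq0, hq1, hq2⟩ := ENNReal.lt_iff_exists_rat_btwn.1 h
      have hq3 : (0 : ℝ) < q := by
        by_contra hneg
        have : Real.toNNReal q = 0 := Real.toNNReal_of_nonpos (not_lt.1 hneg)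
        rw [this] at hq1
        exact absurd hq1 (by simp)
      exact ⟨q, ⟨by exact_mod_cast hq3, hq2⟩, lintegral_le_one_of_orliczNorm_lt hp hΦ hq1⟩
    · rintro ⟨q, ⟨hq0, hqm⟩, h1⟩
      exact (orliczNorm_le (l := Real.toNNReal q) (by simpa using hq0) h1).trans_lt hqm
  rw [e]
  refine MeasurableSet.iUnion fun q => MeasurableSet.iUnion fun _ => ?_
  refine measurableSet_le ?_ measurable_const
  have hm : Measurable fun z : α × β => Φ (F z / ENNReal.ofReal q) :=
    (hΦ.monotone hp).measurable.comp (hF.div_const _)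
  exact hm.lintegral_prod_left'

/-- Minkowski's integral inequality up to a factor. -/
theorem orliczNorm_lintegral_le [SFinite (volume : Measure α)] (hΦ : IsStarYoung 1 Φ) {T : Type*}
    [MeasurableSpace T] {γ : Measure T} [IsFiniteMeasure γ] {H : α × T → ℝ≥0∞} (hH : Measurable H) :
    orliczNorm Φ (fun x => ∫⁻ t, H (x, t) ∂γ) ≤ 2 * ∫⁻ t, orliczNorm Φ (fun x => H (x, t)) ∂γ := by
  set n : T → ℝ≥0∞ := fun t => orliczNorm Φ fun x => H (x, t) with hn
  have hnm : Measurable n := measurable_orliczNorm zero_le_one hΦ hH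
  have hΦm : Measurable Φ := (hΦ.monotone zero_le_one).measurable
  rcases eq_or_ne γ 0 with rfl | hγ
  · simp [orliczNorm_zero hΦ.zero]
  have hγ0 : γ Set.univ ≠ 0 := by simpa using hγ
  have hγt : γ Set.univ ≠ ⊤ := measure_ne_top γ _
  rcases eq_or_ne (∫⁻ t, n t ∂γ) ⊤ with htop | htop
  · rw [htop]; simp
  have key : ∀ ε : ℝ≥0, 0 < ε → orliczNorm Φ (fun x => ∫⁻ t, H (x, t) ∂γ) ≤
      2 * (∫⁻ t, n t ∂γ + ε * γ Set.univ) := by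
    intro ε hε
    have hε0 : (ε : ℝ≥0∞) ≠ 0 := by simpa using hε.ne'
    -- The added ε keeps the density nonzero where n vanishes, and makes n' strictly larger than n
    -- wherever n is finite.
    set n' : T → ℝ≥0∞ := fun t => n t + ε with hn'
    have hn'm : Measurable n' := hnm.add_const _
    set m : ℝ≥0∞ := ∫⁻ t, n' t ∂γ with hm
    have hmeq : m = ∫⁻ t, n t ∂γ + ε * γ Set.univ := by
      rw [hm, hn', lintegral_add_right _ measurable_const, lintegral_const]
    have hmt : m ≠ ⊤ := by rw [hmeq]; finiteness
    have hm0 : m ≠ 0 := by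
      rw [hmeq]
      simp [hε.ne', hγ]
    have hn'0 : ∀ t, n' t ≠ 0 := fun t => by simp [hn', hε.ne']
    have hn't : ∀ᵐ t ∂γ, n' t ≠ ⊤ := by
      filter_upwards [ae_lt_top hnm htop] with t ht
      exact ENNReal.add_ne_top.2 ⟨ht.ne, ENNReal.coe_ne_top⟩
    -- Jensen's inequality is applied to H/n' under this probability measure. Each slice H(·,t) has
    -- norm below n'(t), so its modular is at most 1 for almost every t; Tonelli then averages these
    -- bounds.
    set ν : Measure T := γ.withDensity fun t => n' t / m with hν
    have hdm : Measurable fun t => n' t / m := hn'm.div_const _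
    have hνp : IsProbabilityMeasure ν := ⟨by
      rw [hν, withDensity_apply _ MeasurableSet.univ, Measure.restrict_univ]
      simp_rw [div_eq_mul_inv]
      rw [lintegral_mul_const _ hn'm, ← hm, ENNReal.mul_inv_cancel hm0 hmt]⟩
    have hHx : ∀ x, Measurable fun t => H (x, t) := fun x => hH.comp measurable_prodMk_left
    have hpt : ∀ x, Φ ((∫⁻ t, H (x, t) ∂γ) / (2 * m)) ≤ ∫⁻ t, n' t / m * Φ (H (x, t) / n' t) ∂γ := by
      intro x
      have hj := hΦ.jensen (ν := ν) ((hHx x).div hn'm)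
      have hΦH : Measurable fun t => Φ (((fun t => H (x, t)) / n') t) := hΦm.comp ((hHx x).div hn'm)
      rw [hν, lintegral_withDensity_eq_lintegral_mul _ hdm ((hHx x).div hn'm),
        lintegral_withDensity_eq_lintegral_mul _ hdm hΦH] at hj
      refine le_of_eq_of_le ?_ hj
      congr 1
      have : ∫⁻ t, ((fun t => n' t / m) * ((fun t => H (x, t)) / n')) t ∂γ = (∫⁻ t, H (x, t) ∂γ) / m := by
        rw [ENNReal.div_eq_inv_mul, ← lintegral_const_mul _ (hHx x)]
        refine lintegral_congr_ae ?_
        filter_upwards [hn't] with t ht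
        simp only [Pi.mul_apply, div_eq_mul_inv]
        calc n' t * m⁻¹ * (H (x, t) * (n' t)⁻¹) = n' t * (n' t)⁻¹ * (m⁻¹ * H (x, t)) := by ring
          _ = _ := by rw [ENNReal.mul_inv_cancel (hn'0 t) ht, one_mul]
      erw [this]
      rw [div_eq_mul_inv, div_eq_mul_inv, div_eq_mul_inv, mul_assoc,
        ENNReal.mul_inv (Or.inr hmt) (Or.inr hm0), mul_comm m⁻¹]
    rw [← hmeq]
    obtain ⟨l, hl⟩ : ∃ l : ℝ≥0, (l : ℝ≥0∞) = 2 * m :=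
      ⟨_, ENNReal.coe_toNNReal (ENNReal.mul_ne_top (by simp : (2 : ℝ≥0∞) ≠ ⊤) hmt)⟩
    rw [← hl]
    have hl0 : 0 < l := by
      rw [pos_iff_ne_zero]
      rintro rfl
      simp [hm0] at hl
    refine orliczNorm_le hl0 ?_
    rw [hl]
    refine (lintegral_mono hpt).trans ?_
    have hmeas : Measurable fun z : α × T => n' z.2 / m * Φ (H z / n' z.2) :=
      (hdm.comp measurable_snd).mul (hΦm.comp (hH.div (hn'm.comp measurable_snd)))
    rw [lintegral_lintegral_swap hmeas.aemeasurable]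
    calc _ ≤ ∫⁻ t, n' t / m ∂γ := by
          refine lintegral_mono_ae ?_
          filter_upwards [hn't] with t ht
          have hm1 : Measurable fun x => Φ (H (x, t) / n' t) :=
            hΦm.comp ((hH.comp measurable_prodMk_right).div_const _)
          rw [lintegral_const_mul _ hm1]
          refine mul_le_of_le_one_right' (lintegral_le_one_of_orliczNorm_lt zero_le_one hΦ ?_)
          refine ENNReal.lt_add_right (fun h => ht ?_) hε0
          simp only [hn', hn] at h ⊢
          rw [h]; simp
      _ = 1 := by
          simp_rw [div_eq_mul_inv]
          rw [lintegral_mul_const _ hn'm, ← hm, ENNReal.mul_inv_cancel hm0 hmt]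
  have hlim : Tendsto (fun ε : ℝ≥0 => 2 * (∫⁻ t, n t ∂γ + (ε : ℝ≥0∞) * γ Set.univ)) (𝓝[>] 0)
      (𝓝 (2 * (∫⁻ t, n t ∂γ + ((0 : ℝ≥0) : ℝ≥0∞) * γ Set.univ))) := by
    refine tendsto_nhdsWithin_of_tendsto_nhds ?_
    refine ENNReal.Tendsto.const_mul (Tendsto.add tendsto_const_nhds ?_) (Or.inr (by simp))
    exact ENNReal.Tendsto.mul_const (ENNReal.tendsto_coe.2 tendsto_id) (Or.inr hγt)
  rw [ENNReal.coe_zero, zero_mul, add_zero] at hlim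
  exact ge_of_tendsto hlim (by
    filter_upwards [self_mem_nhdsWithin] with ε hε
    exact key ε hε)

end Luxemburg

/-! ### Haar measures on products. -/

section Instances

variable {α β : Type*} [NormedAddCommGroup α] [MeasureSpace α] [SecondCountableTopology α] [BorelSpace α]
  [LocallyCompactSpace α] [NormedAddCommGroup β] [MeasureSpace β] [SecondCountableTopology β] [BorelSpace β]
  [LocallyCompactSpace β]

instance isAddHaarMeasure_volume_prod [h : (volume : Measure α).IsAddHaarMeasure]
    [h' : (volume : Measure β).IsAddHaarMeasure] : (volume : Measure (α × β)).IsAddHaarMeasure :=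
  Measure.prod.instIsAddHaarMeasure _ _

instance isAddHaarMeasure_volume_triple (d : ℕ) : (volume : Measure (Rd d × Rd d × Rd d)).IsAddHaarMeasure :=
  isAddHaarMeasure_volume_prod

instance isAddHaarMeasure_volume_quadruple (d : ℕ) :
    (volume : Measure (Rd d × Rd d × Rd d × Rd d)).IsAddHaarMeasure :=
  isAddHaarMeasure_volume_prod

end Instances

/-! ### Moderate weights: growth, measurability and lower bounds. -/

section ModerateWeights

variable {G : Type*} [NormedAddCommGroup G] [NormedSpace ℝ G] [FiniteDimensional ℝ G] [MeasureSpace G]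
  [BorelSpace G] [(volume : Measure G).IsAddHaarMeasure] {ω : G → ℝ}

/-- The moderating v is bounded on compact sets only almost everywhere. Writing y = z + (y - z),
almost every z in the unit ball makes both v(z) and v(y - z) at most M, and moderateness is applied
twice. -/
theorem IsModerateWeight.exists_local_bound (h : IsModerateWeight ω) :
    ∃ L : ℝ, 1 ≤ L ∧ ∀ x y, ‖y‖ ≤ 1 → ω (x + y) ≤ L * ω x := by
  obtain ⟨v, hv, C, hC⟩ := h.moderate
  have hω := h.weight.pos
  have hC0 : 0 < C := by
    have h1 := hC 0 0
    rw [add_zero] at h1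
    by_contra hneg
    have h2 : C * (ω 0 * v 0) ≤ 0 := mul_nonpos_of_nonpos_of_nonneg (not_lt.1 hneg) (mul_pos (hω 0) (hv.pos 0)).le
    linarith [hω 0]
  have := FiniteDimensional.proper ℝ G
  obtain ⟨M, hM⟩ := hv.bounded (Metric.closedBall 0 2) (isCompact_closedBall _ _)
  rw [ae_restrict_iff' measurableSet_closedBall] at hM
  refine ⟨max 1 (C ^ 2 * M ^ 2), le_max_left _ _, fun x y hy => ?_⟩
  have hM' : ∀ᵐ z, y - z ∈ Metric.closedBall (0 : G) 2 → v (y - z) ≤ M :=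
    (Measure.measurePreserving_sub_left volume y).quasiMeasurePreserving.ae hM
  have hne : NeBot (ae (volume.restrict (Metric.ball (0 : G) 1))) := by
    rw [ae_neBot, Ne, Measure.restrict_eq_zero]
    exact (Metric.measure_ball_pos volume 0 one_pos).ne'
  obtain ⟨z, hz1, hz2, hz3⟩ := ((ae_restrict_mem measurableSet_ball).and
    ((ae_restrict_of_ae hM).and (ae_restrict_of_ae hM'))).exists (f := ae (volume.restrict (Metric.ball (0 : G) 1)))
  rw [mem_ball_zero_iff] at hz1
  have b1 : v z ≤ M := hz2 (by rw [mem_closedBall_zero_iff]; linarith)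
  have b2 : v (y - z) ≤ M := hz3 (by
    rw [mem_closedBall_zero_iff]
    linarith [norm_sub_le y z])
  have hvz := hv.pos z
  have hvy := hv.pos (y - z)
  have hx := hω x
  have s1 := hC (x + z) (y - z)
  rw [add_add_sub_cancel] at s1
  have s2 := hC x z
  calc ω (x + y) ≤ C * (ω (x + z) * v (y - z)) := s1
    _ ≤ C * (C * (ω x * v z) * v (y - z)) := by gcongr
    _ ≤ C * (C * (ω x * M) * M) := by
        have : 0 ≤ M := hvz.le.trans b1
        gcongr
    _ = C ^ 2 * M ^ 2 * ω x := by ring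
    _ ≤ _ := by
        gcongr
        exact le_max_right _ _

/-- Walk from x to x + y in ⌈‖y‖⌉ steps of length at most one, each costing a factor L. -/
theorem IsModerateWeight.exists_exp_bound (h : IsModerateWeight ω) :
    ∃ L r : ℝ, 1 ≤ L ∧ 0 ≤ r ∧ ∀ x y, ω (x + y) ≤ L * Real.exp (r * ‖y‖) * ω x := by
  obtain ⟨L, hL, hloc⟩ := h.exists_local_bound
  have hω := h.weight.pos
  refine ⟨L, Real.log L, hL, Real.log_nonneg hL, fun x y => ?_⟩
  have hstep : ∀ (n : ℕ) (x y : G), ‖y‖ ≤ n → ω (x + y) ≤ L ^ n * ω x := by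
    intro n
    induction n with
    | zero =>
      intro x y hy
      have : y = 0 := by simpa using hy
      simp [this]
    | succ n ih =>
      intro x y hy
      set t : ℝ := (n : ℝ) / (n + 1) with ht
      have h1 : ‖t • y‖ ≤ n := by
        rw [norm_smul, Real.norm_of_nonneg (by positivity), ht, div_mul_eq_mul_div, div_le_iff₀ (by positivity)]
        push_cast at hy
        gcongr
      have h2 : ‖(1 - t) • y‖ ≤ 1 := by
        have e : 1 - t = 1 / (n + 1) := by rw [ht]; field_simp; ring
        rw [norm_smul, e, Real.norm_of_nonneg (by positivity), div_mul_eq_mul_div, div_le_iff₀ (by positivity)]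
        push_cast at hy
        linarith
      have e : x + y = (x + t • y) + (1 - t) • y := by rw [sub_smul, one_smul]; abel
      rw [e, pow_succ']
      calc _ ≤ L * ω (x + t • y) := hloc _ _ h2
        _ ≤ L * (L ^ n * ω x) := by
          gcongr
          exact ih x _ h1
        _ = _ := by ring
  refine (hstep ⌈‖y‖⌉₊ x y (Nat.le_ceil _)).trans ?_
  have hx := (hω x).le
  gcongr
  have hL0 : 0 < L := by linarith
  calc L ^ ⌈‖y‖⌉₊ = Real.exp (Real.log L * ⌈‖y‖⌉₊) := by
        rw [mul_comm, Real.exp_nat_mul, Real.exp_log hL0]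
    _ ≤ Real.exp (Real.log L * (‖y‖ + 1)) := by
        gcongr
        · exact Real.log_nonneg hL
        · exact (Nat.ceil_lt_add_one (norm_nonneg y)).le
    _ = L * Real.exp (Real.log L * ‖y‖) := by
        rw [mul_add, mul_one, Real.exp_add, Real.exp_log hL0, mul_comm]

/-- The local supremum of a weight, a measurable weight equivalent to it. -/
noncomputable def localSup {G : Type*} [PseudoMetricSpace G] (ω : G → ℝ) (x : G) : ℝ≥0∞ :=
  ⨆ y ∈ Metric.ball x 1, ENNReal.ofReal (ω y)

/-- Superlevel sets are unions of open balls, so no measurability of ω itself is used. -/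
theorem measurable_localSup {G : Type*} [PseudoMetricSpace G] [MeasurableSpace G] [OpensMeasurableSpace G]
    (ω : G → ℝ) : Measurable (localSup ω) := by
  refine measurable_of_Ioi fun m => ?_
  have : localSup ω ⁻¹' Set.Ioi m = ⋃ (y : G) (_ : m < ENNReal.ofReal (ω y)), Metric.ball y 1 := by
    ext x
    simp only [localSup, Set.mem_preimage, Set.mem_Ioi, lt_iSup_iff, Set.mem_iUnion, exists_prop, Metric.mem_ball]
    refine exists_congr fun y => ?_
    rw [dist_comm, and_comm]
  rw [this]
  exact (isOpen_iUnion fun y => isOpen_iUnion fun _ => Metric.isOpen_ball).measurableSet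

theorem le_localSup {G : Type*} [PseudoMetricSpace G] (ω : G → ℝ) (x : G) : ENNReal.ofReal (ω x) ≤ localSup ω x :=
  le_iSup₂_of_le x (Metric.mem_ball_self one_pos) le_rfl

theorem IsModerateWeight.localSup_le (h : IsModerateWeight ω) :
    ∃ L : ℝ≥0, 0 < L ∧ ∀ x, localSup ω x ≤ L * ENNReal.ofReal (ω x) := by
  obtain ⟨L, hL, hloc⟩ := h.exists_local_bound
  have hL0 : 0 < L := by linarith
  refine ⟨L.toNNReal, by simpa using hL0, fun x => iSup₂_le fun y hy => ?_⟩
  rw [← ENNReal.ofReal, ← ENNReal.ofReal_mul hL0.le]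
  refine ENNReal.ofReal_le_ofReal ?_
  have := hloc x (y - x) (by rw [← dist_eq_norm]; exact (Metric.mem_ball.1 hy).le)
  rwa [add_sub_cancel] at this

theorem IsModerateWeight.exists_pos_le_near (h : IsModerateWeight ω) (x₀ : G) :
    ∃ c > 0, ∀ x ∈ Metric.ball x₀ 1, c ≤ ω x := by
  obtain ⟨L, hL, hloc⟩ := h.exists_local_bound
  have hL0 : 0 < L := by linarith
  refine ⟨ω x₀ / L, div_pos (h.weight.pos x₀) hL0, fun x hx => ?_⟩
  rw [div_le_iff₀ hL0, mul_comm]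
  have := hloc x (x₀ - x) (by rw [← dist_eq_norm, dist_comm]; exact (Metric.mem_ball.1 hx).le)
  rwa [add_sub_cancel] at this

end ModerateWeights

/-! ### Functions bounded below on open sets, and infinite factors. -/

section Products

/-- A `[0,∞]`-valued function which vanishes or is bounded below on some nonempty open set. -/
def ZeroOrOpenBelow {α : Type*} [TopologicalSpace α] (F : α → ℝ≥0∞) : Prop :=
  (∀ x, F x = 0) ∨ ∃ U : Set α, IsOpen U ∧ U.Nonempty ∧ ∃ δ : ℝ≥0∞, 0 < δ ∧ ∀ x ∈ U, δ ≤ F x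

/-- Only c = ∞ needs the dichotomy: for F = 0 both sides vanish, and otherwise F is bounded below on
a nonempty open set, which makes both sides infinite. -/
theorem orliczNorm_mul {α : Type*} [TopologicalSpace α] [MeasureSpace α] [OpensMeasurableSpace α]
    [(volume : Measure α).IsOpenPosMeasure] {p : ℝ} (hp : 0 ≤ p) {Φ : ℝ≥0∞ → ℝ≥0∞} (hΦ : IsStarYoung p Φ)
    {F : α → ℝ≥0∞} (hF : ZeroOrOpenBelow F) (c : ℝ≥0∞) : orliczNorm Φ (fun x => c * F x) = c * orliczNorm Φ F := by
  rcases eq_or_ne c 0 with rfl | hc0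
  · simp [orliczNorm_zero hΦ.zero]
  rcases eq_or_ne c ⊤ with rfl | hct
  · rcases hF with hF | ⟨U, hU, hUn, δ, hδ, hUδ⟩
    · obtain rfl : F = fun _ => 0 := funext hF
      simp [orliczNorm_zero hΦ.zero]
    · have hU0 := (hU.measure_pos volume hUn).ne'
      rw [orliczNorm_top_mul hΦ hU.measurableSet hU0 fun x hx => (hδ.trans_le (hUδ x hx)).ne']
      obtain ⟨m, hm, hmF⟩ := exists_pos_le_orliczNorm hp hΦ hU.measurableSet hU0 hδ
      rw [ENNReal.top_mul (hm.trans_le (hmF F hUδ)).ne']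
  · lift c to ℝ≥0 using hct
    exact orliczNorm_const_mul (pos_iff_ne_zero.2 (by simpa using hc0)) F

/-- A `[0,∞]`-valued function of two variables which is bounded below near each point where it does not vanish. -/
def LocallyBelow {α β : Type*} [TopologicalSpace α] [TopologicalSpace β] (P : α → β → ℝ≥0∞) : Prop :=
  ∀ x₀ y₀, P x₀ y₀ ≠ 0 → ∃ U : Set α, ∃ W : Set β, IsOpen U ∧ IsOpen W ∧ x₀ ∈ U ∧ y₀ ∈ W ∧
    ∃ δ : ℝ≥0∞, 0 < δ ∧ ∀ x ∈ U, ∀ y ∈ W, δ ≤ P x y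

theorem LocallyBelow.swap {α β : Type*} [TopologicalSpace α] [TopologicalSpace β] {P : α → β → ℝ≥0∞}
    (h : LocallyBelow P) : LocallyBelow fun y x => P x y := by
  intro y₀ x₀ h0
  obtain ⟨U, W, hU, hW, hx, hy, δ, hδ, hb⟩ := h x₀ y₀ h0
  exact ⟨W, U, hW, hU, hy, hx, δ, hδ, fun y hy x hx => hb x hx y hy⟩

theorem LocallyBelow.section {α β : Type*} [TopologicalSpace α] [TopologicalSpace β] {P : α → β → ℝ≥0∞}
    (h : LocallyBelow P) (y : β) : ZeroOrOpenBelow fun x => P x y := by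
  by_cases h0 : ∀ x, P x y = 0
  · exact Or.inl h0
  · push Not at h0
    obtain ⟨x, hx⟩ := h0
    obtain ⟨U, W, hU, -, hxU, hyW, δ, hδ, hb⟩ := h x y hx
    exact Or.inr ⟨U, hU, ⟨x, hxU⟩, δ, hδ, fun z hz => hb z hz y hyW⟩

variable {α : Type*} [TopologicalSpace α] [MeasureSpace α] [OpensMeasurableSpace α]
    [(volume : Measure α).IsOpenPosMeasure] {β : Type*} [TopologicalSpace β]

theorem LocallyBelow.exists_pos_le_norm {p : ℝ} (hp : 0 ≤ p) {Φ : ℝ≥0∞ → ℝ≥0∞}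
    (hΦ : IsStarYoung p Φ) {P : α → β → ℝ≥0∞} (h : LocallyBelow P) {x₀ : α} {y₀ : β} (h0 : P x₀ y₀ ≠ 0) :
    ∃ W : Set β, IsOpen W ∧ W.Nonempty ∧ ∃ δ : ℝ≥0∞, 0 < δ ∧ ∀ y ∈ W, δ ≤ orliczNorm Φ fun x => P x y := by
  obtain ⟨U, W, hU, hW, hxU, hyW, δ, hδ, hb⟩ := h x₀ y₀ h0
  obtain ⟨m, hm, hmF⟩ := exists_pos_le_orliczNorm hp hΦ hU.measurableSet (hU.measure_pos volume ⟨x₀, hxU⟩).ne' hδ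
  exact ⟨W, hW, ⟨y₀, hyW⟩, m, hm, fun y hy => hmF _ fun x hx => hb x hx y hy⟩

theorem LocallyBelow.zeroOrOpenBelow_norm {p : ℝ} (hp : 0 ≤ p) {Φ : ℝ≥0∞ → ℝ≥0∞}
    (hΦ : IsStarYoung p Φ) {P : α → β → ℝ≥0∞} (h : LocallyBelow P) :
    ZeroOrOpenBelow fun y => orliczNorm Φ fun x => P x y := by
  by_cases h0 : ∀ x y, P x y = 0
  · left
    intro y
    simp only [h0, orliczNorm_zero hΦ.zero]
  · push Not at h0
    obtain ⟨x, y, hxy⟩ := h0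
    exact Or.inr (h.exists_pos_le_norm hp hΦ hxy)

theorem LocallyBelow.norm_norm_ne_zero [MeasureSpace β] [OpensMeasurableSpace β]
    [(volume : Measure β).IsOpenPosMeasure] {p : ℝ} (hp : 0 ≤ p) {Φ Ψ : ℝ≥0∞ → ℝ≥0∞}
    (hΦ : IsStarYoung p Φ) (hΨ : IsStarYoung p Ψ) {P : α → β → ℝ≥0∞} (h : LocallyBelow P) {x₀ : α} {y₀ : β}
    (h0 : P x₀ y₀ ≠ 0) : orliczNorm Ψ (fun y => orliczNorm Φ fun x => P x y) ≠ 0 := by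
  obtain ⟨W, hW, hWn, δ, hδ, hb⟩ := h.exists_pos_le_norm hp hΦ h0
  obtain ⟨m, hm, hmF⟩ := exists_pos_le_orliczNorm hp hΨ hW.measurableSet (hW.measure_pos volume hWn).ne' hδ
  exact (hm.trans_le (hmF _ hb)).ne'

/-- Continuity bounds |A| from below near a point where it is nonzero, and a moderate weight, though
possibly discontinuous, is bounded below on unit balls. -/
theorem locallyBelow_of_continuous {d : ℕ} {A : Rd d × Rd d → ℂ} (hA : Continuous A) {ω : Rd d × Rd d → ℝ}
    (hω : IsModerateWeight ω) : LocallyBelow fun x ξ => ‖A (x, ξ)‖ₑ * ENNReal.ofReal (ω (x, ξ)) := by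
  intro x₀ ξ₀ h0
  have hA0 : ‖A (x₀, ξ₀)‖ₑ ≠ 0 := left_ne_zero_of_mul h0
  obtain ⟨δ, hδ0, hδ⟩ := ENNReal.lt_iff_exists_nnreal_btwn.1 (pos_iff_ne_zero.2 hA0)
  obtain ⟨c, hc, hcω⟩ := hω.exists_pos_le_near (x₀, ξ₀)
  have h1 : ∀ᶠ X in 𝓝 (x₀, ξ₀), (δ : ℝ≥0∞) < ‖A X‖ₑ := (hA.enorm.tendsto (x₀, ξ₀)).eventually (lt_mem_nhds hδ)
  have h2 := h1.and (Metric.ball_mem_nhds (x₀, ξ₀) one_pos)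
  rw [nhds_prod_eq] at h2
  obtain ⟨S, hS, S', hS', hSS⟩ := Filter.mem_prod_iff.1 h2
  obtain ⟨U, hUS, hU, hxU⟩ := mem_nhds_iff.1 hS
  obtain ⟨W, hWS, hW, hξW⟩ := mem_nhds_iff.1 hS'
  refine ⟨U, W, hU, hW, hxU, hξW, δ * ENNReal.ofReal c, ENNReal.mul_pos hδ0.ne' (by simpa using hc),
    fun x hx ξ hξ => ?_⟩
  obtain ⟨g1, g2⟩ := hSS (Set.mk_mem_prod (hUS hx) (hWS hξ))
  exact mul_le_mul' g1.le (ENNReal.ofReal_le_ofReal (hcω _ g2))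

end Products

/-! ### Mixed norms in four variables: products and convolutions. -/

section Mixed

variable {d : ℕ} {Φ₁ Φ₂ Ψ₁ Ψ₂ : ℝ≥0∞ → ℝ≥0∞}

/-- The mixed norm of a `[0,∞]`-valued function of four variables. -/
noncomputable def orlicz4 (Φ₁ Φ₂ Ψ₁ Ψ₂ : ℝ≥0∞ → ℝ≥0∞) (F : Rd d × Rd d × Rd d × Rd d → ℝ≥0∞) : ℝ≥0∞ :=
  orliczNorm Ψ₂ fun y => orliczNorm Ψ₁ fun η => orliczNorm Φ₂ fun ξ => orliczNorm Φ₁ fun x => F (x, ξ, η, y)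

theorem orlicz4_mono {p : ℝ} (hp : 0 ≤ p) (h₁ : IsStarYoung p Φ₁) (h₂ : IsStarYoung p Φ₂) (h₃ : IsStarYoung p Ψ₁)
    (h₄ : IsStarYoung p Ψ₂) {F G : Rd d × Rd d × Rd d × Rd d → ℝ≥0∞} (h : ∀ X, F X ≤ G X) :
    orlicz4 Φ₁ Φ₂ Ψ₁ Ψ₂ F ≤ orlicz4 Φ₁ Φ₂ Ψ₁ Ψ₂ G :=
  orliczNorm_mono hp h₄ fun _ => orliczNorm_mono hp h₃ fun _ => orliczNorm_mono hp h₂ fun _ =>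
    orliczNorm_mono hp h₁ fun _ => h _

theorem orlicz4_const_mul {c : ℝ≥0} (hc : 0 < c) (F : Rd d × Rd d × Rd d × Rd d → ℝ≥0∞) :
    orlicz4 Φ₁ Φ₂ Ψ₁ Ψ₂ (fun X => c * F X) = c * orlicz4 Φ₁ Φ₂ Ψ₁ Ψ₂ F := by
  simp only [orlicz4, orliczNorm_const_mul hc]

theorem orlicz4_rpow {p : ℝ} (hp : 0 < p) (F : Rd d × Rd d × Rd d × Rd d → ℝ≥0∞) :
    orlicz4 Φ₁ Φ₂ Ψ₁ Ψ₂ F ^ p = orlicz4 (fun s => Φ₁ (s ^ p⁻¹)) (fun s => Φ₂ (s ^ p⁻¹)) (fun s => Ψ₁ (s ^ p⁻¹))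
      (fun s => Ψ₂ (s ^ p⁻¹)) fun X => F X ^ p := by
  simp only [orlicz4, orliczNorm_rpow hp]

/-- In the order x, ξ, η, y each variable, at its turn, occurs in one factor only, after a
reflection or a translation. The other factor is a constant, possibly ∞, which `orliczNorm_mul`
takes out. -/
theorem orlicz4_mul {p : ℝ} (hp : 0 ≤ p) (h₁ : IsStarYoung p Φ₁) (h₂ : IsStarYoung p Φ₂) (h₃ : IsStarYoung p Ψ₁)
    (h₄ : IsStarYoung p Ψ₂) {P Q : Rd d → Rd d → ℝ≥0∞} (hP : LocallyBelow P) (hQ : LocallyBelow Q) :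
    orlicz4 Φ₁ Φ₂ Ψ₁ Ψ₂ (fun X => P (-X.2.2.2 - X.1) X.2.2.1 * Q (-X.2.2.2) (X.2.1 + X.2.2.1)) =
      orliczNorm Ψ₁ (fun η => orliczNorm Φ₁ fun x => P x η) * orliczNorm Ψ₂ (fun y => orliczNorm Φ₂ fun ξ => Q y ξ) := by
  have e1 : ∀ y ξ η : Rd d, orliczNorm Φ₁ (fun x => P (-y - x) η * Q (-y) (ξ + η)) =
      (orliczNorm Φ₁ fun x => P x η) * Q (-y) (ξ + η) := by
    intro y ξ η
    have := orliczNorm_comp (Φ := Φ₁) (e := MeasurableEquiv.subLeft (-y)) (Measure.measurePreserving_sub_left volume (-y))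
      (fun x => P x η * Q (-y) (ξ + η))
    refine this.trans ?_
    simp_rw [mul_comm _ (Q (-y) (ξ + η))]
    rw [orliczNorm_mul hp h₁ (hP.section η)]
  have e2 : ∀ y η : Rd d, (orliczNorm Φ₂ fun ξ => (orliczNorm Φ₁ fun x => P x η) * Q (-y) (ξ + η)) =
      (orliczNorm Φ₂ fun ξ => Q (-y) ξ) * orliczNorm Φ₁ fun x => P x η := by
    intro y η
    have := orliczNorm_comp (Φ := Φ₂) (e := MeasurableEquiv.addRight η) (measurePreserving_add_right volume η)
      (fun ξ => (orliczNorm Φ₁ fun x => P x η) * Q (-y) ξ)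
    refine this.trans ?_
    rw [orliczNorm_mul hp h₂ (hQ.swap.section (-y)), mul_comm]
  have e3 : ∀ y : Rd d, (orliczNorm Ψ₁ fun η => (orliczNorm Φ₂ fun ξ => Q (-y) ξ) * orliczNorm Φ₁ fun x => P x η) =
      (orliczNorm Ψ₁ fun η => orliczNorm Φ₁ fun x => P x η) * orliczNorm Φ₂ fun ξ => Q (-y) ξ := by
    intro y
    rw [orliczNorm_mul hp h₃ (hP.zeroOrOpenBelow_norm hp h₁), mul_comm]
  simp only [orlicz4, e1, e2, e3]
  have := orliczNorm_comp (Φ := Ψ₂) (e := MeasurableEquiv.neg (Rd d)) (Measure.measurePreserving_neg volume)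
    (fun y => (orliczNorm Ψ₁ fun η => orliczNorm Φ₁ fun x => P x η) * orliczNorm Φ₂ fun ξ => Q y ξ)
  refine this.trans ?_
  rw [orliczNorm_mul hp h₄ (hQ.swap.zeroOrOpenBelow_norm hp h₂)]

/-- Minkowski's inequality, after which translation invariance removes a(t). -/
theorem orliczNorm_convolution_le {α W : Type*} [AddCommGroup α] [MeasureSpace α] [MeasurableAdd₂ α] [MeasurableNeg α]
    [SFinite (volume : Measure α)] [(volume : Measure α).IsAddLeftInvariant]
    [AddCommGroup W] [MeasurableSpace W] [MeasurableAdd₂ W] [MeasurableNeg W]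
    {Φ : ℝ≥0∞ → ℝ≥0∞} (hΦ : IsStarYoung 1 Φ) {T : Type*} [MeasurableSpace T] {γ : Measure T} [IsFiniteMeasure γ]
    {F : α × W → ℝ≥0∞} (hF : Measurable F) {a : T → α} {b : T → W} (ha : Measurable a) (hb : Measurable b) (w : W) :
    orliczNorm Φ (fun x => ∫⁻ t, F (x - a t, w - b t) ∂γ) ≤
      2 * ∫⁻ t, orliczNorm Φ (fun x => F (x, w - b t)) ∂γ := by
  refine (orliczNorm_lintegral_le hΦ (H := fun z : α × T => F (z.1 - a z.2, w - b z.2)) ?_).trans (le_of_eq ?_)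
  · simp only [sub_eq_add_neg]
    exact hF.comp ((measurable_fst.add (ha.comp measurable_snd).neg).prodMk
      (measurable_const.add (hb.comp measurable_snd).neg))
  · congr 1
    refine lintegral_congr fun t => ?_
    exact orliczNorm_comp (e := MeasurableEquiv.subRight (a t)) (measurePreserving_sub_right volume (a t))
      (fun x => F (x, w - b t))

/-- One Minkowski estimate per variable, from the innermost outwards, so 16 = 2⁴. The shifts in the
variables not yet treated stay under the integral over T. -/
theorem orlicz4_convolution_le (h₁ : IsStarYoung 1 Φ₁) (h₂ : IsStarYoung 1 Φ₂) (h₃ : IsStarYoung 1 Ψ₁)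
    (h₄ : IsStarYoung 1 Ψ₂) {γ : Measure (Rd d × Rd d × Rd d × Rd d)} [IsFiniteMeasure γ]
    {F : Rd d × Rd d × Rd d × Rd d → ℝ≥0∞} (hF : Measurable F) :
    orlicz4 Φ₁ Φ₂ Ψ₁ Ψ₂ (fun X => ∫⁻ T, F (X.1 - T.1, X.2 - T.2) ∂γ) ≤
      16 * γ Set.univ * orlicz4 Φ₁ Φ₂ Ψ₁ Ψ₂ F := by
  have h2 : (0 : ℝ≥0) < 2 := by norm_num
  -- Each partial norm is named as a measurable function of the remaining variables, so that the
  -- next estimate applies to it.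
  obtain ⟨f₁, hf₁⟩ : ∃ f₁ : Rd d × Rd d × Rd d → ℝ≥0∞, ∀ w, orliczNorm Φ₁ (fun x => F (x, w)) = f₁ w :=
    ⟨_, fun _ => rfl⟩
  have m₁ : Measurable f₁ := by
    rw [← funext hf₁]
    exact measurable_orliczNorm zero_le_one h₁ hF
  obtain ⟨f₂, hf₂⟩ : ∃ f₂ : Rd d × Rd d → ℝ≥0∞, ∀ w, orliczNorm Φ₂ (fun x => f₁ (x, w)) = f₂ w := ⟨_, fun _ => rfl⟩
  have m₂ : Measurable f₂ := by
    rw [← funext hf₂]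
    exact measurable_orliczNorm zero_le_one h₂ m₁
  obtain ⟨f₃, hf₃⟩ : ∃ f₃ : Rd d → ℝ≥0∞, ∀ w, orliczNorm Ψ₁ (fun x => f₂ (x, w)) = f₃ w := ⟨_, fun _ => rfl⟩
  have m₃ : Measurable f₃ := by
    rw [← funext hf₃]
    exact measurable_orliczNorm zero_le_one h₃ m₂
  have s₁ : ∀ w : Rd d × Rd d × Rd d, orliczNorm Φ₁ (fun x => ∫⁻ T, F (x - T.1, w - T.2) ∂γ) ≤
      2 * ∫⁻ T, f₁ (w - T.2) ∂γ := fun w => by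
    simp_rw [← hf₁]
    exact orliczNorm_convolution_le h₁ hF measurable_fst measurable_snd w
  have s₂ : ∀ w : Rd d × Rd d, orliczNorm Φ₂ (fun x => ∫⁻ T, f₁ (x - T.2.1, w - T.2.2) ∂γ) ≤
      2 * ∫⁻ T, f₂ (w - T.2.2) ∂γ := fun w => by
    simp_rw [← hf₂]
    exact orliczNorm_convolution_le h₂ m₁ (measurable_fst.comp measurable_snd) (measurable_snd.comp measurable_snd) w
  have s₃ : ∀ w : Rd d, orliczNorm Ψ₁ (fun x => ∫⁻ T, f₂ (x - T.2.2.1, w - T.2.2.2) ∂γ) ≤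
      2 * ∫⁻ T, f₃ (w - T.2.2.2) ∂γ := fun w => by
    simp_rw [← hf₃]
    exact orliczNorm_convolution_le h₃ m₂ (measurable_fst.comp (measurable_snd.comp measurable_snd))
      (measurable_snd.comp (measurable_snd.comp measurable_snd)) w
  have s₄ : orliczNorm Ψ₂ (fun y => ∫⁻ T, f₃ (y - T.2.2.2) ∂γ) ≤ 2 * (orliczNorm Ψ₂ f₃ * γ Set.univ) := by
    have := orliczNorm_convolution_le h₄ (W := Rd d) (γ := γ) (m₃.comp measurable_fst)
      (measurable_snd.comp (measurable_snd.comp measurable_snd)) (measurable_const (a := (0 : Rd d))) 0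
    rwa [lintegral_const] at this
  have e : orlicz4 Φ₁ Φ₂ Ψ₁ Ψ₂ F = orliczNorm Ψ₂ f₃ := by
    simp only [orlicz4, hf₁, hf₂, hf₃]
  calc orlicz4 Φ₁ Φ₂ Ψ₁ Ψ₂ (fun X => ∫⁻ T, F (X.1 - T.1, X.2 - T.2) ∂γ)
      ≤ orliczNorm Ψ₂ fun y => orliczNorm Ψ₁ fun η => orliczNorm Φ₂ fun ξ =>
          ((2 : ℝ≥0) : ℝ≥0∞) * ∫⁻ T, f₁ (ξ - T.2.1, (η, y) - T.2.2) ∂γ :=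
        orliczNorm_mono zero_le_one h₄ fun y => orliczNorm_mono zero_le_one h₃ fun η =>
          orliczNorm_mono zero_le_one h₂ fun ξ => s₁ (ξ, η, y)
    _ ≤ orliczNorm Ψ₂ fun y => orliczNorm Ψ₁ fun η => ((2 : ℝ≥0) : ℝ≥0∞) *
          (((2 : ℝ≥0) : ℝ≥0∞) * ∫⁻ T, f₂ (η - T.2.2.1, y - T.2.2.2) ∂γ) :=
        orliczNorm_mono zero_le_one h₄ fun y => orliczNorm_mono zero_le_one h₃ fun η => by
          rw [orliczNorm_const_mul h2]
          exact mul_le_mul_right (s₂ (η, y)) _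
    _ ≤ orliczNorm Ψ₂ fun y => ((2 : ℝ≥0) : ℝ≥0∞) * (((2 : ℝ≥0) : ℝ≥0∞) *
          (((2 : ℝ≥0) : ℝ≥0∞) * ∫⁻ T, f₃ (y - T.2.2.2) ∂γ)) :=
        orliczNorm_mono zero_le_one h₄ fun y => by
          rw [orliczNorm_const_mul h2, orliczNorm_const_mul h2]
          exact mul_le_mul_right (mul_le_mul_right (s₃ y) _) _
    _ ≤ ((2 : ℝ≥0) : ℝ≥0∞) * (((2 : ℝ≥0) : ℝ≥0∞) * (((2 : ℝ≥0) : ℝ≥0∞) * (2 * (orliczNorm Ψ₂ f₃ * γ Set.univ)))) := by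
        rw [orliczNorm_const_mul h2, orliczNorm_const_mul h2, orliczNorm_const_mul h2]
        exact mul_le_mul_right (mul_le_mul_right (mul_le_mul_right s₄ _) _) _
    _ = 16 * γ Set.univ * orlicz4 Φ₁ Φ₂ Ψ₁ Ψ₂ F := by rw [e]; push_cast; ring

end Mixed

/-! ### Gaussian convolutions in weighted mixed quasi-norms. -/

section WeightedConvolution

variable {d : ℕ} {Φ₁ Φ₂ Ψ₁ Ψ₂ : ℝ≥0∞ → ℝ≥0∞}

/-- The square of the Euclidean norm on `ℝ^{4d}`. -/
noncomputable def sq4 (X : Rd d × Rd d × Rd d × Rd d) : ℝ :=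
  ‖X.1‖ ^ 2 + ‖X.2.1‖ ^ 2 + ‖X.2.2.1‖ ^ 2 + ‖X.2.2.2‖ ^ 2

theorem sq_norm_le_sq4 (X : Rd d × Rd d × Rd d × Rd d) : ‖X‖ ^ 2 ≤ sq4 X := by
  have h : ‖X‖ = max ‖X.1‖ (max ‖X.2.1‖ (max ‖X.2.2.1‖ ‖X.2.2.2‖)) := rfl
  have h1 := sq_nonneg ‖X.1‖
  have h2 := sq_nonneg ‖X.2.1‖
  have h3 := sq_nonneg ‖X.2.2.1‖
  have h4 := sq_nonneg ‖X.2.2.2‖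
  rw [h, sq4]
  rcases max_choice ‖X.2.2.1‖ ‖X.2.2.2‖ with e | e <;> rw [e] <;>
  rcases max_choice ‖X.2.1‖ _ with e | e <;> rw [e] <;>
  rcases max_choice ‖X.1‖ _ with e | e <;> rw [e] <;> linarith

theorem continuous_sq4 : Continuous (sq4 (d := d)) := by
  unfold sq4
  fun_prop

theorem integrable_exp_neg_sq4 {c : ℝ} (hc : 0 < c) :
    Integrable fun X : Rd d × Rd d × Rd d × Rd d => Real.exp (-c * sq4 X) := by
  have h : Integrable fun x : Rd d => Real.exp (-c * ‖x‖ ^ 2) := integrable_gauss hc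
  refine (h.mul_prod (h.mul_prod (h.mul_prod h))).congr (Eventually.of_forall fun X => ?_)
  simp only [sq4, ← Real.exp_add]
  congr 1
  ring

/-- A moderate weight moves inside the convolution at the price L e^{r‖X - Z‖}, which the Gaussian
kernel absorbs, leaving a finite measure γ. Raising to the power p reduces to order 1, where
`orlicz4_convolution_le` holds. -/
theorem orlicz4_moderate_convolution_le {p : ℝ} (hp : 0 < p) (h₁ : IsStarYoung p Φ₁) (h₂ : IsStarYoung p Φ₂)
    (h₃ : IsStarYoung p Ψ₁) (h₄ : IsStarYoung p Ψ₂) {ω : Rd d × Rd d × Rd d × Rd d → ℝ} (hω : IsModerateWeight ω)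
    {δ : ℝ} (hδ : 0 < δ) (C : ℝ≥0) : ∃ c : ℝ≥0, ∀ N N' : Rd d × Rd d × Rd d × Rd d → ℝ≥0∞, Measurable N →
      (∀ X, N' X ^ p ≤ C * ∫⁻ Z, N Z ^ p * eGauss sq4 δ (X - Z)) →
      orlicz4 Φ₁ Φ₂ Ψ₁ Ψ₂ (fun X => N' X * ENNReal.ofReal (ω X)) ≤
        c * orlicz4 Φ₁ Φ₂ Ψ₁ Ψ₂ fun X => N X * ENNReal.ofReal (ω X) := by
  obtain ⟨L, r, hL, hr, hωe⟩ := hω.exists_exp_bound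
  obtain ⟨L', hL', hloc⟩ := hω.localSup_le
  have hL0 : 0 < L := by linarith
  obtain ⟨k, hk⟩ : ∃ k : Rd d × Rd d × Rd d × Rd d → ℝ≥0∞,
      ∀ T, k T = eGauss sq4 δ T * ENNReal.ofReal (L * Real.exp (r * ‖T‖)) ^ p := ⟨_, fun _ => rfl⟩
  have hkm : Measurable k := by
    rw [funext hk]
    have : Continuous fun T : Rd d × Rd d × Rd d × Rd d => Real.exp (-δ * sq4 T) := by
      have := continuous_sq4 (d := d)
      fun_prop
    refine this.measurable.ennreal_ofReal.mul (Measurable.pow_const (Measurable.ennreal_ofReal ?_) _)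
    fun_prop
  have hkle : ∀ T, k T ≤ ENNReal.ofReal (L ^ p * Real.exp ((p * r) ^ 2 / (2 * δ)) * Real.exp (-(δ / 2) * sq4 T)) := by
    intro T
    rw [hk, eGauss, ENNReal.ofReal_rpow_of_pos (by positivity), ← ENNReal.ofReal_mul (Real.exp_pos _).le]
    refine ENNReal.ofReal_le_ofReal ?_
    rw [Real.mul_rpow hL0.le (Real.exp_pos _).le, ← Real.exp_mul, mul_left_comm, mul_assoc, ← Real.exp_add,
      mul_assoc, ← Real.exp_add]
    refine mul_le_mul_of_nonneg_left (Real.exp_le_exp.2 ?_) (by positivity)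
    -- Completing the square pays for the linear exponent with half of the Gaussian.
    have e1 : p * r * ‖T‖ ≤ δ / 2 * ‖T‖ ^ 2 + (p * r) ^ 2 / (2 * δ) := by
      have : δ / 2 * ‖T‖ ^ 2 + (p * r) ^ 2 / (2 * δ) - p * r * ‖T‖ = (δ * ‖T‖ - p * r) ^ 2 / (2 * δ) := by
        field_simp
        ring
      have h0 : 0 ≤ (δ * ‖T‖ - p * r) ^ 2 / (2 * δ) := by positivity
      linarith
    have e2 := mul_le_mul_of_nonneg_left (sq_norm_le_sq4 T) (half_pos hδ).le
    linarith
  have hkfin : ∫⁻ T, k T ≠ ⊤ := by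
    refine ne_top_of_le_ne_top ?_ (lintegral_mono hkle)
    exact ((integrable_exp_neg_sq4 (half_pos hδ)).const_mul _).lintegral_lt_top.ne
  obtain ⟨γ, hγ⟩ : ∃ γ : Measure (Rd d × Rd d × Rd d × Rd d), γ = volume.withDensity k := ⟨_, rfl⟩
  have hγf : IsFiniteMeasure γ := hγ ▸ isFiniteMeasure_withDensity hkfin
  -- The constant is made positive, as `orlicz4_const_mul` requires.
  obtain ⟨C', hC', hCC'⟩ : ∃ C' : ℝ≥0, 0 < C' ∧ C ≤ C' := ⟨max C 1, by positivity, le_max_left _ _⟩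
  have hK : (C' * (16 * γ Set.univ)) ^ p⁻¹ * L' ≠ ⊤ :=
    ENNReal.mul_ne_top (ENNReal.rpow_ne_top_of_nonneg (by positivity) (ENNReal.mul_ne_top ENNReal.coe_ne_top
      (ENNReal.mul_ne_top (by norm_num) (measure_ne_top _ _)))) ENNReal.coe_ne_top
  refine ⟨((C' * (16 * γ Set.univ)) ^ p⁻¹ * L').toNNReal, fun N N' hN hNN => ?_⟩
  rw [ENNReal.coe_toNNReal hK]
  have hinv : ∀ u : ℝ≥0∞, (u ^ p) ^ p⁻¹ = u := fun u => ENNReal.rpow_rpow_inv hp.ne' u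
  -- The measurable `localSup ω` stands in for ω here, since Minkowski's inequality is stated for
  -- measurable integrands; `hloc` returns to ω at the end.
  set G : Rd d × Rd d × Rd d × Rd d → ℝ≥0∞ := fun Z => (N Z * localSup ω Z) ^ p with hG
  have hGm : Measurable G := (hN.mul (measurable_localSup ω)).pow_const _
  have hconv : ∀ X, (N' X * ENNReal.ofReal (ω X)) ^ p ≤ C' * ∫⁻ T, G (X.1 - T.1, X.2 - T.2) ∂γ := by
    intro X
    have h1 : ∫⁻ T, G (X.1 - T.1, X.2 - T.2) ∂γ = ∫⁻ Z, G Z * k (X - Z) := by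
      have hm : Measurable fun T => G (X - T) := hGm.comp (measurable_const.sub measurable_id)
      calc _ = ∫⁻ T, G (X - T) ∂γ := rfl
        _ = ∫⁻ T, k T * G (X - T) := by
          rw [hγ, lintegral_withDensity_eq_lintegral_mul _ hkm hm]
          rfl
        _ = ∫⁻ T, k (X - T) * G (X - (X - T)) :=
          have : (volume : Measure (Rd d × Rd d × Rd d × Rd d)).Regular :=
            Measure.Regular.of_sigmaCompactSpace_of_isLocallyFiniteMeasure _
          have : (volume : Measure (Rd d × Rd d × Rd d × Rd d)).IsNegInvariant :=
            Measure.IsAddHaarMeasure.isNegInvariant_of_regular _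
          (lintegral_sub_left_eq_self (fun T => k T * G (X - T)) X).symm
        _ = _ := by
          refine lintegral_congr fun T => ?_
          rw [sub_sub_cancel, mul_comm]
    rw [h1, ENNReal.mul_rpow_of_nonneg _ _ hp.le]
    calc N' X ^ p * ENNReal.ofReal (ω X) ^ p
        ≤ (C * ∫⁻ Z, N Z ^ p * eGauss sq4 δ (X - Z)) * ENNReal.ofReal (ω X) ^ p := mul_le_mul_left (hNN X) _
      _ = C * ∫⁻ Z, N Z ^ p * eGauss sq4 δ (X - Z) * ENNReal.ofReal (ω X) ^ p := by
        rw [mul_assoc, lintegral_mul_const' _ _ (ENNReal.rpow_ne_top_of_nonneg hp.le ENNReal.ofReal_ne_top)]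
      _ ≤ C' * ∫⁻ Z, G Z * k (X - Z) := by
        refine mul_le_mul' (by exact_mod_cast hCC') (lintegral_mono fun Z => ?_)
        have b : ENNReal.ofReal (ω X) ≤ ENNReal.ofReal (L * Real.exp (r * ‖X - Z‖)) * localSup ω Z := by
          refine le_trans ?_ (mul_le_mul_right (le_localSup ω Z) _)
          rw [← ENNReal.ofReal_mul (by positivity)]
          refine ENNReal.ofReal_le_ofReal ?_
          have := hωe Z (X - Z)
          rwa [add_sub_cancel] at this
        calc _ ≤ N Z ^ p * eGauss sq4 δ (X - Z) *
              (ENNReal.ofReal (L * Real.exp (r * ‖X - Z‖)) * localSup ω Z) ^ p :=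
            mul_le_mul_right (ENNReal.rpow_le_rpow b hp.le) _
          _ = _ := by
            rw [hG, hk]
            simp only [ENNReal.mul_rpow_of_nonneg _ _ hp.le]
            ring
  have g₁ := h₁.comp_rpow hp
  have g₂ := h₂.comp_rpow hp
  have g₃ := h₃.comp_rpow hp
  have g₄ := h₄.comp_rpow hp
  have main : orlicz4 Φ₁ Φ₂ Ψ₁ Ψ₂ (fun X => N' X * ENNReal.ofReal (ω X)) ^ p ≤
      C' * (16 * γ Set.univ) * (L' * orlicz4 Φ₁ Φ₂ Ψ₁ Ψ₂ fun X => N X * ENNReal.ofReal (ω X)) ^ p := by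
    rw [orlicz4_rpow hp, ← orlicz4_const_mul hL', orlicz4_rpow hp]
    refine (orlicz4_mono zero_le_one g₁ g₂ g₃ g₄ hconv).trans ?_
    rw [orlicz4_const_mul hC', mul_assoc]
    refine mul_le_mul_right ((orlicz4_convolution_le g₁ g₂ g₃ g₄ hGm).trans (mul_le_mul_right ?_ _)) _
    refine orlicz4_mono zero_le_one g₁ g₂ g₃ g₄ fun X => ENNReal.rpow_le_rpow ?_ hp.le
    rw [mul_left_comm]
    exact mul_le_mul_right (hloc X) _
  have := ENNReal.rpow_le_rpow main (inv_nonneg.2 hp.le)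
  rwa [hinv, ENNReal.mul_rpow_of_nonneg _ _ (inv_nonneg.2 hp.le), hinv, ← mul_assoc] at this

end WeightedConvolution

/-! ### The kernel of a shifted window and the factorization identity. -/

section Kernel

variable {d : ℕ}

theorem fourierConst_sq_mul (V : Type*) [NormedAddCommGroup V] [InnerProductSpace ℝ V] :
    fourierConst V * fourierConst V * (((2 * Real.pi) ^ Module.finrank ℝ V : ℝ) : ℂ) = 1 := by
  have hpi : 0 < 2 * Real.pi := by positivity
  rw [fourierConst, ← Complex.ofReal_mul, ← Complex.ofReal_mul, ← Real.rpow_add hpi, ← Real.rpow_natCast,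
    ← Real.rpow_add hpi]
  ring_nf
  simp

theorem conj_fourierConst (V : Type*) [NormedAddCommGroup V] [InnerProductSpace ℝ V] :
    conj (fourierConst V) = fourierConst V := Complex.conj_ofReal _

theorem fourierConst_ne_zero (V : Type*) [NormedAddCommGroup V] [InnerProductSpace ℝ V] : fourierConst V ≠ 0 :=
  fun h => by simpa [h] using fourierConst_sq_mul V

theorem stft_eq {V : Type*} [NormedAddCommGroup V] [InnerProductSpace ℝ V] (φ : V → ℂ) (u : GelfandShilov V → ℂ)
    (x ξ : V) : stft φ u x ξ = fourierConst V * gsPair u (tfShift φ x ξ) := rfl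

theorem expNeg_neg_right {V : Type*} [NormedAddCommGroup V] [InnerProductSpace ℝ V] (ξ y : V) :
    expNeg ξ (-y) = conj (expNeg ξ y) := by
  rw [conj_expNeg, expNeg_swap, ← conj_expNeg, expNeg_swap, conj_expNeg]

theorem expNeg_toLp (η y a b : Rd d) :
    expNeg (WithLp.toLp 2 (η, y) : R2d d) (WithLp.toLp 2 (a, b)) = expNeg η a * expNeg y b := by
  rw [expNeg, expNeg, expNeg, ← Complex.exp_add, WithLp.prod_inner_apply]
  congr 1
  push_cast
  ring

theorem conj_stftFun2 (φ₁ φ₂ : Rd d → ℂ) (a b : Rd d) :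
    conj (stftFun2 φ₁ φ₂ (WithLp.toLp 2 (a, b))) = fourierConst (Rd d) * tfCoeff (fun t => conj (φ₂ t)) φ₁ (a, b) := by
  rw [stftFun2, stftFun, map_mul, conj_fourierConst, tfCoeff, cFourier, ← integral_conj]
  simp

theorem integral_tfCoeff_mul_expNeg {V : Type*} [NormedAddCommGroup V] [InnerProductSpace ℝ V]
    [FiniteDimensional ℝ V] [MeasurableSpace V] [BorelSpace V] {θ φ : V → ℂ} (hθ : θ ∈ GelfandShilov V)
    (hφ : φ ∈ GelfandShilov V) (u y : V) :
    ∫ ζ, tfCoeff θ φ (u, ζ) * expNeg ζ y = ((2 * Real.pi) ^ Module.finrank ℝ V : ℝ) * (θ y * φ (y - u)) := by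
  have hcθ := hθ.1.continuous
  have hcφ := hφ.1.continuous
  obtain ⟨B, hB, hb⟩ := GelfandShilov.bounded hφ
  refine fourier_inversion (f := fun t => θ t * φ (t - u)) (by fun_prop) ?_ ?_ y
  · refine Integrable.mono' ((GelfandShilov.integrable hθ).norm.const_mul B)
      (by fun_prop : Continuous fun t => θ t * φ (t - u)).aestronglyMeasurable (Eventually.of_forall fun t => ?_)
    rw [norm_mul, mul_comm]
    exact mul_le_mul_of_nonneg_right (hb _) (norm_nonneg _)
  · obtain ⟨δ, hδ, C, hC, hd⟩ := tfCoeff_decay hθ hφ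
    refine Integrable.mono' ((integrable_gauss hδ).const_mul C) ?_ (Eventually.of_forall fun ζ => (hd (u, ζ)).trans ?_)
    · have hc : Continuous fun p : V × V => θ p.2 * φ (p.2 - u) * conj (expNeg p.1 p.2) := by
        have := continuous_expNeg_uncurry (V := V)
        exact (by fun_prop : Continuous fun p : V × V => θ p.2 * φ (p.2 - u)).mul (Complex.continuous_conj.comp this)
      exact (hc.stronglyMeasurable.integral_prod_right (ν := volume)).aestronglyMeasurable
    · refine mul_le_mul_of_nonneg_left (Real.exp_le_exp.2 ?_) hC
      have := mul_nonneg hδ.le (sq_nonneg ‖u‖)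
      simp only
      linarith

/-- V_{φ₁}φ₂ is a Fourier integral in its second variable, so the partial Fourier transform is
undone by inversion, and the result separates the variables v and z. The two constants
`fourierConst` cancel (2π)^d. -/
theorem stftKernel_tfShift {φ₁ φ₂ : Rd d → ℂ} (hφ₁ : φ₁ ∈ GelfandShilov (Rd d)) (hφ₂ : φ₂ ∈ GelfandShilov (Rd d))
    (x ξ η y v z : Rd d) :
    stftKernel (tfShift (stftFun2 φ₁ φ₂) (WithLp.toLp 2 (x, ξ)) (WithLp.toLp 2 (η, y))) v z =
      expNeg η (v - z) * expNeg ξ (v + y) * (conj (φ₂ (v + y)) * φ₁ (z + y + x)) := by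
  have h : ∀ ζ : Rd d, tfShift (stftFun2 φ₁ φ₂) (WithLp.toLp 2 (x, ξ)) (WithLp.toLp 2 (η, y))
      (WithLp.toLp 2 (v - z, ζ)) * expNeg ζ v = fourierConst (Rd d) * (expNeg η (v - z) * expNeg ξ (v + y)) *
        (tfCoeff (fun t => conj (φ₂ t)) φ₁ (v - z - x, ζ - ξ) * expNeg (ζ - ξ) (v + y)) := by
    intro ζ
    rw [tfShift, expNeg_toLp, ← WithLp.toLp_sub, Prod.mk_sub_mk, conj_stftFun2]
    have e : expNeg y ζ * expNeg ζ v = expNeg ξ (v + y) * expNeg (ζ - ξ) (v + y) := by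
      rw [← expNeg_add, add_sub_cancel, expNeg_swap y, add_comm v, expNeg_add_right]
    linear_combination (fourierConst (Rd d) * tfCoeff (fun t => conj (φ₂ t)) φ₁ (v - z - x, ζ - ξ) *
      expNeg η (v - z)) * e
  rw [stftKernel]
  simp_rw [h]
  rw [integral_const_mul, integral_sub_right_eq_self
    (fun ζ => tfCoeff (fun t => conj (φ₂ t)) φ₁ (v - z - x, ζ) * expNeg ζ (v + y)) ξ,
    integral_tfCoeff_mul_expNeg (conj_mem_gelfandShilov hφ₂) hφ₁]
  have e : v + y - (v - z - x) = z + y + x := by abel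
  rw [e]
  linear_combination (expNeg η (v - z) * expNeg ξ (v + y) * (conj (φ₂ (v + y)) * φ₁ (z + y + x))) *
    fourierConst_sq_mul (Rd d)

/-- The functional `V_{f₁} f₂`, evaluated at an arbitrary function. -/
noncomputable def stftPair (f₁ f₂ : GelfandShilov (Rd d) → ℂ) (Θ : R2d d → ℂ) : ℂ :=
  gsPair f₂ fun y => conj (gsPair f₁ fun z => conj (stftKernel Θ y z))

/-- Because the kernel separates, f₁ and f₂ act one after the other, each on a shift of its own
window, by `gsPair_const_mul`. This is the identity behind the whole theorem. -/
theorem stftPair_tfShift {f₁ f₂ : GelfandShilov (Rd d) → ℂ} (hf₁ : IsGSDistribution f₁) (hf₂ : IsGSDistribution f₂)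
    {φ₁ φ₂ : Rd d → ℂ} (hφ₁ : φ₁ ∈ GelfandShilov (Rd d)) (hφ₂ : φ₂ ∈ GelfandShilov (Rd d)) (x ξ η y : Rd d) :
    stftPair f₁ f₂ (tfShift (stftFun2 φ₁ φ₂) (WithLp.toLp 2 (x, ξ)) (WithLp.toLp 2 (η, y))) =
      expNeg ξ y * (conj (gsPair f₁ (tfShift φ₁ (-y - x) η)) * gsPair f₂ (tfShift φ₂ (-y) (ξ + η))) := by
  have h1 : ∀ v : Rd d, (fun z => conj (stftKernel (tfShift (stftFun2 φ₁ φ₂) (WithLp.toLp 2 (x, ξ))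
      (WithLp.toLp 2 (η, y))) v z)) = fun z => conj (expNeg η v * expNeg ξ (v + y) * conj (φ₂ (v + y))) *
        tfShift φ₁ (-y - x) η z := by
    intro v
    ext z
    rw [stftKernel_tfShift hφ₁ hφ₂, tfShift, sub_eq_add_neg v z, expNeg_add_right, expNeg_neg_right]
    have e : z - (-y - x) = z + y + x := by abel
    rw [e]
    simp only [map_mul, Complex.conj_conj]
    ring
  have h2 : (fun v => conj (gsPair f₁ fun z => conj (stftKernel (tfShift (stftFun2 φ₁ φ₂) (WithLp.toLp 2 (x, ξ))
      (WithLp.toLp 2 (η, y))) v z))) = fun v => (expNeg ξ y * conj (gsPair f₁ (tfShift φ₁ (-y - x) η))) *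
        tfShift φ₂ (-y) (ξ + η) v := by
    ext v
    rw [h1, gsPair_const_mul hf₁, map_mul, Complex.conj_conj, tfShift, sub_neg_eq_add, expNeg_add, expNeg_add_right]
    ring
  rw [stftPair, h2, gsPair_const_mul hf₂]
  ring

theorem gsPair_stftDist {f₁ f₂ : GelfandShilov (Rd d) → ℂ} {Θ : R2d d → ℂ} (hΘ : Θ ∈ GelfandShilov (R2d d)) :
    gsPair (stftDist f₁ f₂) Θ = stftPair f₁ f₂ Θ := gsPair_of_mem hΘ

end Kernel

/-! ### The ambiguity function of the Gaussian. -/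

section GaussianAmbiguity

variable {V : Type*} [NormedAddCommGroup V] [InnerProductSpace ℝ V]

theorem conj_gaussWindow (x : V) : conj (gaussWindow V x) = gaussWindow V x := Complex.conj_ofReal _

variable [FiniteDimensional ℝ V] [MeasurableSpace V] [BorelSpace V]

variable (V) in
-- After recentring at a/2 the parallelogram law merges the two Gaussians into a single one in t,
-- whose Fourier transform is explicit.
theorem exists_integral_gaussWindow_mul : ∃ K : ℂ, K ≠ 0 ∧ ∀ a b : V,
    ∫ t, gaussWindow V t * gaussWindow V (t - a) * expNeg b t =
      K * Complex.exp (-(((‖a‖ ^ 2 + ‖b‖ ^ 2 : ℝ) : ℂ) / 4 + Complex.I / 2 * ((⟪a, b⟫_ℝ : ℝ) : ℂ))) := by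
  obtain ⟨k, hk⟩ : ∃ k : ℝ, k = Real.pi ^ (-(Module.finrank ℝ V : ℝ) / 4) := ⟨_, rfl⟩
  have hpi := Real.pi_pos
  have hk0 : (k : ℂ) ≠ 0 := by
    rw [hk]
    exact_mod_cast (Real.rpow_pos_of_pos hpi _).ne'
  have hg : ∀ t : V, gaussWindow V t = k * Complex.exp (((-‖t‖ ^ 2 / 2 : ℝ) : ℂ)) := by
    intro t
    rw [gaussWindow, hk]
    push_cast
    rfl
  refine ⟨k ^ 2 * ((Real.pi : ℂ) / 1) ^ (Module.finrank ℝ V / 2 : ℂ), mul_ne_zero (pow_ne_zero 2 hk0) ?_, fun a b => ?_⟩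
  · rw [div_one, Ne, Complex.cpow_eq_zero_iff]
    exact fun h => hpi.ne' (by exact_mod_cast h.1)
  have h1 : ∀ t : V, gaussWindow V (t + (1 / 2 : ℝ) • a) * gaussWindow V (t + (1 / 2 : ℝ) • a - a) *
      expNeg b (t + (1 / 2 : ℝ) • a) = k ^ 2 * Complex.exp (-(((‖a‖ ^ 2 : ℝ) : ℂ) / 4 +
        Complex.I / 2 * ((⟪a, b⟫_ℝ : ℝ) : ℂ))) *
        Complex.exp (-1 * (‖t‖ : ℂ) ^ 2 + (-Complex.I) * ((⟪b, t⟫_ℝ : ℝ) : ℂ)) := by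
    intro t
    have e : t + (1 / 2 : ℝ) • a - a = t - (1 / 2 : ℝ) • a := by
      have : a = (1 / 2 : ℝ) • a + (1 / 2 : ℝ) • a := by rw [← add_smul]; norm_num
      nth_rewrite 2 [this]
      abel
    rw [e, hg, hg, expNeg]
    have n1 : ‖t + (1 / 2 : ℝ) • a‖ ^ 2 + ‖t - (1 / 2 : ℝ) • a‖ ^ 2 = 2 * ‖t‖ ^ 2 + ‖a‖ ^ 2 / 2 := by
      rw [norm_add_sq_real, norm_sub_sq_real, norm_smul]
      norm_num
      ring
    have n2 : ⟪t + (1 / 2 : ℝ) • a, b⟫_ℝ = ⟪b, t⟫_ℝ + ⟪a, b⟫_ℝ / 2 := by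
      rw [inner_add_left, real_inner_smul_left, real_inner_comm]
      ring
    rw [n2]
    have n3 : ((‖t + (1 / 2 : ℝ) • a‖ ^ 2 + ‖t - (1 / 2 : ℝ) • a‖ ^ 2 : ℝ) : ℂ) =
        ((2 * ‖t‖ ^ 2 + ‖a‖ ^ 2 / 2 : ℝ) : ℂ) := by rw [n1]
    have n4 : ∀ x y z : ℂ, k * Complex.exp x * (k * Complex.exp y) * Complex.exp z =
        k ^ 2 * Complex.exp (x + y + z) := fun x y z => by
      rw [Complex.exp_add, Complex.exp_add]
      ring
    rw [n4, mul_assoc, ← Complex.exp_add]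
    congr 2
    push_cast at n3 ⊢
    linear_combination (-1 / 2) * n3
  rw [← integral_add_right_eq_self (fun t : V => gaussWindow V t * gaussWindow V (t - a) * expNeg b t)
    ((1 / 2 : ℝ) • a)]
  simp_rw [h1]
  rw [integral_const_mul, GaussianFourier.integral_cexp_neg_mul_sq_norm_add (by simp)]
  have e2 : ∀ P A B : ℂ, (k : ℂ) ^ 2 * Complex.exp A * (P * Complex.exp B) = k ^ 2 * P * Complex.exp (A + B) :=
    fun P A B => by rw [Complex.exp_add]; ring
  rw [e2]
  congr 2
  push_cast
  linear_combination ((‖b‖ : ℂ) ^ 2 / 4) * Complex.I_sq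

end GaussianAmbiguity

/-! ### The transform of the Gaussian with Gaussian window. -/

section WindowRegularity

variable {d : ℕ}

theorem exists_stftFun2_gaussWindow (d : ℕ) : ∃ K : ℂ, K ≠ 0 ∧ ∀ X : R2d d,
    stftFun2 (gaussWindow (Rd d)) (gaussWindow (Rd d)) X =
      K * Complex.exp (-(((‖X‖ ^ 2 : ℝ) : ℂ) / 4 + Complex.I / 2 * ((⟪X.fst, X.snd⟫_ℝ : ℝ) : ℂ))) := by
  obtain ⟨K, hK, h⟩ := exists_integral_gaussWindow_mul (Rd d)
  refine ⟨fourierConst (Rd d) * K, mul_ne_zero (fourierConst_ne_zero _) hK, fun X => ?_⟩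
  rw [stftFun2, stftFun]
  simp_rw [conj_gaussWindow]
  rw [h, WithLp.prod_norm_sq_eq_of_L2, mul_assoc]

theorem stftFun2_gaussWindow_ne_zero (X : R2d d) :
    stftFun2 (gaussWindow (Rd d)) (gaussWindow (Rd d)) X ≠ 0 := by
  obtain ⟨K, hK, h⟩ := exists_stftFun2_gaussWindow d
  rw [h]
  exact mul_ne_zero hK (Complex.exp_ne_zero _)

/-- The exponent is a complex quadratic form: the phase ⟨x, ξ⟩/2 is imaginary, and the real part
‖X‖²/4 is coercive. -/
theorem stftFun2_gaussWindow_mem :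
    stftFun2 (gaussWindow (Rd d)) (gaussWindow (Rd d)) ∈ GelfandShilov (R2d d) := by
  obtain ⟨K, hK, h⟩ := exists_stftFun2_gaussWindow d
  set B₁ : R2d d →L[ℝ] R2d d →L[ℝ] ℂ :=
    (ContinuousLinearMap.compL ℝ (R2d d) ℝ ℂ ((1 / 4 : ℝ) • Complex.ofRealCLM)).comp (innerSL ℝ) with hB₁
  set B₂ : R2d d →L[ℝ] R2d d →L[ℝ] ℂ :=
    ((ContinuousLinearMap.compL ℝ (Rd d) ℝ ℂ ((Complex.I / 2) • Complex.ofRealCLM)).comp (innerSL ℝ)).bilinearComp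
      (WithLp.fstL 2 ℝ (Rd d) (Rd d)) (WithLp.sndL 2 ℝ (Rd d) (Rd d)) with hB₂
  have e₁ : ∀ X : R2d d, B₁ X X = (((‖X‖ ^ 2 : ℝ) : ℂ) / 4) := by
    intro X
    simp [hB₁]
    ring
  have e₂ : ∀ X : R2d d, B₂ X X = Complex.I / 2 * ((⟪X.fst, X.snd⟫_ℝ : ℝ) : ℂ) := by
    intro X
    simp [hB₂]
  have hm := exp_quadratic_mem_gelfandShilov (B₁ + B₂) (a := 1 / 4) (by norm_num) (fun X => by
    rw [add_apply, add_apply, e₁, e₂]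
    simp [-Complex.ofReal_pow]
    linarith)
  have := (GelfandShilov (R2d d)).smul_mem K hm
  convert this using 1
  ext X
  rw [h]
  simp only [add_apply, e₁, e₂, Pi.smul_apply, smul_eq_mul]

end WindowRegularity

/-! ### Membership of V_{φ₁}φ₂ in the Gelfand–Shilov space. -/

section WindowMembership

theorem exists_norm_comp_sub_le {V : Type*} [NormedAddCommGroup V] [NormedSpace ℝ V] {φ : V → ℂ}
    (hφ : φ ∈ GelfandShilov V) {b : ℝ} (hb : 0 < b) : ∃ ε > 0, ∃ C : ℝ, 0 ≤ C ∧
      ∀ x y, ‖φ (y - x)‖ ≤ C * Real.exp (-ε * ‖y‖ ^ 2) * Real.exp (b * ‖x‖ ^ 2) := by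
  rw [mem_gelfandShilov_iff] at hφ
  obtain ⟨-, a, ha, h, hh, M, H⟩ := hφ
  have hm : 0 < min a b := lt_min ha hb
  refine ⟨min a b / 2, by positivity, M, H.nonneg, fun x y => (H.norm_le _).trans ?_⟩
  rw [mul_assoc, ← Real.exp_add]
  refine mul_le_mul_of_nonneg_left (Real.exp_le_exp.2 ?_) H.nonneg
  have h1 := neg_mul_norm_sub_sq_le hm.le x y
  have h2 := mul_le_mul_of_nonneg_right (min_le_left a b) (sq_nonneg ‖y - x‖)
  have h3 := mul_le_mul_of_nonneg_right (min_le_right a b) (sq_nonneg ‖x‖)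
  linarith

theorem continuous_tfShift_comp {V : Type*} [NormedAddCommGroup V] [InnerProductSpace ℝ V] {φ : V → ℂ}
    (hφ : Continuous φ) {S : Type*} [TopologicalSpace S] {x ξ y : S → V} (hx : Continuous x) (hξ : Continuous ξ)
    (hy : Continuous y) : Continuous fun s => tfShift φ (x s) (ξ s) (y s) :=
  (Complex.continuous_conj.comp (hφ.comp (hy.sub hx))).mul (continuous_expNeg_uncurry.comp (hξ.prodMk hy))

/-- Joint integrability for Fubini: one shifted window supplies decay in p.1, the other is merely
bounded, and the coefficients beat the Gaussian growth in the shift parameters. -/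
theorem integrable_tfCoeff_mul_tfCoeff {V : Type*} [NormedAddCommGroup V] [InnerProductSpace ℝ V]
    [FiniteDimensional ℝ V] [MeasurableSpace V] [BorelSpace V] {θ₁ θ₂ g : V → ℂ} (h₁ : θ₁ ∈ GelfandShilov V)
    (h₂ : θ₂ ∈ GelfandShilov V) (hg : g ∈ GelfandShilov V) (x ξ : V) :
    Integrable fun p : V × ((V × V) × (V × V)) => (tfCoeff θ₁ g p.2.1 * tfShift g p.2.1.1 p.2.1.2 (p.1 - x)) *
      (tfCoeff θ₂ g p.2.2 * tfShift g p.2.2.1 p.2.2.2 p.1) * expNeg ξ p.1 := by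
  have hgc := hg.1.continuous
  have a₁ := aestronglyMeasurable_tfCoeff h₁.1.continuous hgc
  have a₂ := aestronglyMeasurable_tfCoeff h₂.1.continuous hgc
  obtain ⟨b₁, hb₁, n₁⟩ := integrable_tfCoeff_exp h₁ hg
  obtain ⟨b₂, hb₂, n₂⟩ := integrable_tfCoeff_exp h₂ hg
  obtain ⟨B, hB, hgB⟩ := GelfandShilov.bounded hg
  obtain ⟨ε, hε, C, hC, hgε⟩ := exists_norm_comp_sub_le hg hb₂
  have hdom := ((integrable_gauss (V := V) hε).const_mul (C * B)).mul_prod (n₁.mul_prod n₂)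
  refine hdom.mono' ?_ (Eventually.of_forall fun p => ?_)
  · have m1 : AEStronglyMeasurable (fun p : V × ((V × V) × (V × V)) => tfCoeff θ₁ g p.2.1) := a₁.comp_fst.comp_snd
    have m2 : AEStronglyMeasurable (fun p : V × ((V × V) × (V × V)) => tfCoeff θ₂ g p.2.2) := a₂.comp_snd.comp_snd
    have k1 : Continuous fun p : V × ((V × V) × (V × V)) => tfShift g p.2.1.1 p.2.1.2 (p.1 - x) :=
      continuous_tfShift_comp hgc (by fun_prop) (by fun_prop) (by fun_prop)
    have k2 : Continuous fun p : V × ((V × V) × (V × V)) => tfShift g p.2.2.1 p.2.2.2 p.1 :=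
      continuous_tfShift_comp hgc (by fun_prop) (by fun_prop) (by fun_prop)
    have k3 : Continuous fun p : V × ((V × V) × (V × V)) => expNeg ξ p.1 :=
      (contDiff_expNeg ξ).continuous.comp continuous_fst
    exact ((m1.mul k1.aestronglyMeasurable).mul (m2.mul k2.aestronglyMeasurable)).mul k3.aestronglyMeasurable
  · simp only [norm_mul, norm_tfShift, norm_expNeg, mul_one]
    have q1 := hgB (p.1 - x - p.2.1.1)
    have q2 := hgε p.2.2.1 p.1
    have q3 : 1 ≤ Real.exp (b₁ * (‖p.2.1.1‖ ^ 2 + ‖p.2.1.2‖ ^ 2)) := Real.one_le_exp (by positivity)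
    have q4 : Real.exp (b₂ * ‖p.2.2.1‖ ^ 2) ≤ Real.exp (b₂ * (‖p.2.2.1‖ ^ 2 + ‖p.2.2.2‖ ^ 2)) := by
      refine Real.exp_le_exp.2 (mul_le_mul_of_nonneg_left ?_ hb₂.le)
      linarith [sq_nonneg ‖p.2.2.2‖]
    calc ‖tfCoeff θ₁ g p.2.1‖ * ‖g (p.1 - x - p.2.1.1)‖ * (‖tfCoeff θ₂ g p.2.2‖ * ‖g (p.1 - p.2.2.1)‖)
        ≤ ‖tfCoeff θ₁ g p.2.1‖ * (B * Real.exp (b₁ * (‖p.2.1.1‖ ^ 2 + ‖p.2.1.2‖ ^ 2))) * (‖tfCoeff θ₂ g p.2.2‖ *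
          (C * Real.exp (-ε * ‖p.1‖ ^ 2) * Real.exp (b₂ * (‖p.2.2.1‖ ^ 2 + ‖p.2.2.2‖ ^ 2)))) := by
          refine mul_le_mul (mul_le_mul_of_nonneg_left (q1.trans (le_mul_of_one_le_right hB q3)) (norm_nonneg _))
            (mul_le_mul_of_nonneg_left (q2.trans (mul_le_mul_of_nonneg_left q4 (by positivity))) (norm_nonneg _))
            (by positivity) (by positivity)
      _ = _ := by ring

variable {d : ℕ}

theorem stftFun2_toLp (φ₁ φ₂ : Rd d → ℂ) (a b : Rd d) : stftFun2 φ₁ φ₂ (WithLp.toLp 2 (a, b)) =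
    fourierConst (Rd d) * ∫ y, φ₂ y * conj (φ₁ (y - a)) * expNeg b y := rfl

theorem norm_sq_toLp (a b : Rd d) : ‖(WithLp.toLp 2 (a, b) : R2d d)‖ ^ 2 = ‖a‖ ^ 2 + ‖b‖ ^ 2 :=
  WithLp.prod_norm_sq_eq_of_L2 _

/-- The superposition of products of Gaussian windows underlying `V_{φ₁} φ₂`. -/
theorem stftFun2_eq_integral {φ₁ φ₂ : Rd d → ℂ} (hφ₁ : φ₁ ∈ GelfandShilov (Rd d)) (hφ₂ : φ₂ ∈ GelfandShilov (Rd d))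
    (X : R2d d) :
    tfNorm (gaussWindow (Rd d)) ^ 2 * stftFun2 φ₁ φ₂ X =
      ∫ t : (Rd d × Rd d) × (Rd d × Rd d), (tfCoeff (fun s => conj (φ₁ s)) (gaussWindow (Rd d)) t.1 *
        tfCoeff φ₂ (gaussWindow (Rd d)) t.2 * expNeg (t.1.2 + t.2.2) t.2.1) *
        tfShift (fun W => conj (stftFun2 (gaussWindow (Rd d)) (gaussWindow (Rd d)) W))
          (WithLp.toLp 2 (t.2.1 - t.1.1, -(t.1.2 + t.2.2))) (WithLp.toLp 2 (-t.1.2, t.2.1)) X := by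
  obtain ⟨x, ξ, rfl⟩ : ∃ x ξ, X = WithLp.toLp 2 (x, ξ) := ⟨X.fst, X.snd, rfl⟩
  obtain ⟨g, hg⟩ : ∃ g, g = gaussWindow (Rd d) := ⟨_, rfl⟩
  have hgm : g ∈ GelfandShilov (Rd d) := hg ▸ gaussWindow_mem
  have hgc := hgm.1.continuous
  have hgr : ∀ t, conj (g t) = g t := fun t => hg ▸ conj_gaussWindow t
  rw [← hg]
  obtain ⟨c₁, hc₁⟩ : ∃ c, c = tfCoeff (fun s => conj (φ₁ s)) g := ⟨_, rfl⟩
  obtain ⟨c₂, hc₂⟩ : ∃ c, c = tfCoeff φ₂ g := ⟨_, rfl⟩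
  have hm₁ := conj_mem_gelfandShilov hφ₁
  -- Both conj φ₁ and φ₂ are expanded in shifts of the Gaussian g.
  have i₁ : ∀ s, ∫ Z, c₁ Z * tfShift g Z.1 Z.2 s = tfNorm g * conj (φ₁ s) := fun s => by
    rw [hc₁, integral_tfCoeff_mul_tfShift hm₁ hgm]
  have i₂ : ∀ s, ∫ Z, c₂ Z * tfShift g Z.1 Z.2 s = tfNorm g * φ₂ s := fun s => by
    rw [hc₂, integral_tfCoeff_mul_tfShift hφ₂ hgm]
  obtain ⟨F, hF⟩ : ∃ F : Rd d → (Rd d × Rd d) × (Rd d × Rd d) → ℂ, ∀ s t, F s t =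
      (c₁ t.1 * tfShift g t.1.1 t.1.2 (s - x)) * (c₂ t.2 * tfShift g t.2.1 t.2.2 s) * expNeg ξ s := ⟨_, fun _ _ => rfl⟩
  have hFint : Integrable (Function.uncurry F) := by
    have := integrable_tfCoeff_mul_tfCoeff hm₁ hφ₂ hgm x ξ
    rw [← hc₁, ← hc₂] at this
    refine this.congr (Eventually.of_forall fun p => ?_)
    rw [Function.uncurry, hF]
  have s1 : tfNorm g ^ 2 * stftFun2 φ₁ φ₂ (WithLp.toLp 2 (x, ξ)) = fourierConst (Rd d) * ∫ s, ∫ t, F s t := by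
    have : ∀ s, ∫ t, F s t = tfNorm g ^ 2 * (φ₂ s * conj (φ₁ (s - x)) * expNeg ξ s) := by
      intro s
      simp_rw [hF]
      rw [integral_mul_const]
      have := integral_prod_mul (μ := (volume : Measure (Rd d × Rd d))) (ν := (volume : Measure (Rd d × Rd d)))
        (fun Z => c₁ Z * tfShift g Z.1 Z.2 (s - x)) (fun Z => c₂ Z * tfShift g Z.1 Z.2 s)
      rw [Measure.volume_eq_prod, this, i₁, i₂]
      ring
    simp_rw [this]
    rw [integral_const_mul, stftFun2_toLp]
    ring
  -- After translating s by x₂ the inner integral is V_g g at a shifted point, times phases. The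
  -- window is conjugated because `tfShift` conjugates once more.
  have s2 : ∀ t : (Rd d × Rd d) × (Rd d × Rd d), fourierConst (Rd d) * ∫ s, F s t =
      (c₁ t.1 * c₂ t.2 * expNeg (t.1.2 + t.2.2) t.2.1) * tfShift (fun W => conj (stftFun2 g g W))
          (WithLp.toLp 2 (t.2.1 - t.1.1, -(t.1.2 + t.2.2))) (WithLp.toLp 2 (-t.1.2, t.2.1)) (WithLp.toLp 2 (x, ξ)) := by
    rintro ⟨⟨x₁, ξ₁⟩, ⟨x₂, ξ₂⟩⟩
    have e1 : ∀ s, F (s + x₂) ((x₁, ξ₁), (x₂, ξ₂)) = (c₁ (x₁, ξ₁) * c₂ (x₂, ξ₂) * expNeg (ξ₁ + ξ₂) x₂ *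
        (expNeg (-ξ₁) x * expNeg x₂ ξ)) * (g s * conj (g (s - (x - (x₂ - x₁)))) * expNeg (ξ + (ξ₁ + ξ₂)) s) := by
      intro s
      have r1 : s + x₂ + -x - x₁ = s - (x - (x₂ - x₁)) := by abel
      rw [hF, sub_eq_add_neg (s + x₂) x]
      simp only [tfShift, hgr, r1, add_sub_cancel_right, expNeg_add, expNeg_add_right,
        expNeg_neg_right, conj_expNeg, expNeg_swap x₂ ξ]
      ring
    rw [← integral_add_right_eq_self (fun s => F s ((x₁, ξ₁), (x₂, ξ₂))) x₂]
    simp_rw [e1]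
    have r2 : (WithLp.toLp 2 (x, ξ) : R2d d) - WithLp.toLp 2 (x₂ - x₁, -(ξ₁ + ξ₂)) =
        WithLp.toLp 2 (x - (x₂ - x₁), ξ + (ξ₁ + ξ₂)) := by
      rw [← WithLp.toLp_sub, Prod.mk_sub_mk, sub_neg_eq_add]
    rw [integral_const_mul, tfShift, expNeg_toLp, r2, Complex.conj_conj, stftFun2_toLp]
    ring
  rw [s1, integral_integral_swap hFint, ← integral_const_mul]
  simp_rw [s2]
  rw [hc₁, hc₂]

/-- By `stftFun2_eq_integral` this is a superposition of shifts of conj V_g g for the Gaussian g,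
with coefficients that `synthesis` accepts. -/
theorem stftFun2_mem {φ₁ φ₂ : Rd d → ℂ} (hφ₁ : φ₁ ∈ GelfandShilov (Rd d)) (hφ₂ : φ₂ ∈ GelfandShilov (Rd d)) :
    stftFun2 φ₁ φ₂ ∈ GelfandShilov (R2d d) := by
  have hg := gaussWindow_mem (V := Rd d)
  have hne := tfNorm_ne_zero hg (gaussWindow_ne_zero (0 : Rd d))
  have hm₁ := conj_mem_gelfandShilov hφ₁
  have a₁ := aestronglyMeasurable_tfCoeff hm₁.1.continuous hg.1.continuous
  have a₂ := aestronglyMeasurable_tfCoeff hφ₂.1.continuous hg.1.continuous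
  obtain ⟨b₁, hb₁, n₁⟩ := integrable_tfCoeff_exp hm₁ hg
  obtain ⟨b₂, hb₂, n₂⟩ := integrable_tfCoeff_exp hφ₂ hg
  -- The squared length of the shift parameters is at most 3 times that of the coefficient
  -- variables.
  have hb : 0 < min b₁ b₂ / 3 := by positivity
  have hph : Continuous fun t : (Rd d × Rd d) × (Rd d × Rd d) => expNeg (t.1.2 + t.2.2) t.2.1 :=
    continuous_expNeg_uncurry.comp (by fun_prop : Continuous fun t : (Rd d × Rd d) × (Rd d × Rd d) =>
      (t.1.2 + t.2.2, t.2.1))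
  have hcm : AEStronglyMeasurable fun t : (Rd d × Rd d) × (Rd d × Rd d) =>
      tfCoeff (fun s => conj (φ₁ s)) (gaussWindow (Rd d)) t.1 *
        tfCoeff φ₂ (gaussWindow (Rd d)) t.2 * expNeg (t.1.2 + t.2.2) t.2.1 :=
    (a₁.comp_fst.mul a₂.comp_snd).mul hph.aestronglyMeasurable
  have hZ : Continuous fun t : (Rd d × Rd d) × (Rd d × Rd d) =>
      ((WithLp.toLp 2 (t.2.1 - t.1.1, -(t.1.2 + t.2.2)) : R2d d), (WithLp.toLp 2 (-t.1.2, t.2.1) : R2d d)) := by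
    fun_prop
  have := (synthesis (conj_mem_gelfandShilov (stftFun2_gaussWindow_mem (d := d))) hb hZ.measurable hcm ?_).1
  · simp only [← stftFun2_eq_integral hφ₁ hφ₂] at this
    have := (GelfandShilov (R2d d)).smul_mem (tfNorm (gaussWindow (Rd d)) ^ 2)⁻¹ this
    convert this using 1
    ext X
    simp only [Pi.smul_apply, smul_eq_mul]
    rw [inv_mul_cancel_left₀ (pow_ne_zero 2 hne)]
  · refine (n₁.mul_prod n₂).mono' (hcm.norm.mul (Continuous.aestronglyMeasurable ?_))
      (Eventually.of_forall fun t => ?_)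
    · fun_prop
    · rw [Real.norm_of_nonneg (by positivity), norm_mul, norm_mul, norm_expNeg, mul_one]
      rw [mul_mul_mul_comm, ← Real.exp_add]
      refine mul_le_mul_of_nonneg_left (Real.exp_le_exp.2 ?_) (by positivity)
      rw [norm_sq_toLp, norm_sq_toLp, norm_neg, norm_neg]
      have hsq : ∀ u v : Rd d, ‖u + v‖ ^ 2 ≤ 2 * ‖u‖ ^ 2 + 2 * ‖v‖ ^ 2 := fun u v => by
        have := norm_add_le u v
        nlinarith [sq_nonneg (‖u‖ - ‖v‖), norm_nonneg (u + v), norm_nonneg u, norm_nonneg v]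
      have q1 := hsq t.2.1 (-t.1.1)
      rw [← sub_eq_add_neg, norm_neg] at q1
      have q2 := hsq t.1.2 t.2.2
      have m1 := mul_le_mul_of_nonneg_right (min_le_left b₁ b₂) (by positivity : 0 ≤ ‖t.1.1‖ ^ 2 + ‖t.1.2‖ ^ 2)
      have m2 := mul_le_mul_of_nonneg_right (min_le_right b₁ b₂) (by positivity : 0 ≤ ‖t.2.1‖ ^ 2 + ‖t.2.2‖ ^ 2)
      have hb0 : 0 ≤ min b₁ b₂ := (lt_min hb₁ hb₂).le
      have q : ‖t.2.1 - t.1.1‖ ^ 2 + ‖t.1.2 + t.2.2‖ ^ 2 + (‖t.1.2‖ ^ 2 + ‖t.2.1‖ ^ 2) ≤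
          3 * ((‖t.1.1‖ ^ 2 + ‖t.1.2‖ ^ 2) + (‖t.2.1‖ ^ 2 + ‖t.2.2‖ ^ 2)) := by
        linarith [sq_nonneg ‖t.1.1‖, sq_nonneg ‖t.2.2‖]
      have := mul_le_mul_of_nonneg_left q hb.le
      linarith

end WindowMembership

/-! ### Fubini for the inversion formula. -/

section Comp

variable {V : Type*} [NormedAddCommGroup V] [InnerProductSpace ℝ V]

theorem continuous_expNeg_comp {S : Type*} [TopologicalSpace S] {ξ y : S → V} (hξ : Continuous ξ)
    (hy : Continuous y) : Continuous fun s => expNeg (ξ s) (y s) :=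
  continuous_expNeg_uncurry.comp (hξ.prodMk hy)

theorem continuous_gsPair_tfShift_comp {u : GelfandShilov V → ℂ} (hu : IsGSDistribution u) {φ : V → ℂ}
    (hφ : φ ∈ GelfandShilov V) {S : Type*} [TopologicalSpace S] {x ξ : S → V} (hx : Continuous x)
    (hξ : Continuous ξ) : Continuous fun s => gsPair u (tfShift φ (x s) (ξ s)) :=
  (continuous_gsPair_tfShift hφ hu).comp (hx.prodMk hξ)

variable [FiniteDimensional ℝ V] [MeasurableSpace V] [BorelSpace V]

/-- The inversion formula is inserted under a Fourier integral; ‖ζ‖ ≤ ‖w ζ‖ turns the decay of G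
into decay in ζ, which justifies Fubini. -/
theorem tfNorm_mul_integral_mul_expNeg {U : Type*} [NormedAddCommGroup U] [InnerProductSpace ℝ U]
    [FiniteDimensional ℝ U] [MeasurableSpace U] [BorelSpace U] {G Θ : V → ℂ} (hG : G ∈ GelfandShilov V)
    (hΘ : Θ ∈ GelfandShilov V) {w : U → V} (hw : Continuous w) (hle : ∀ ζ, ‖ζ‖ ^ 2 ≤ ‖w ζ‖ ^ 2) (v : U) :
    tfNorm G * ∫ ζ, Θ (w ζ) * expNeg ζ v =
      ∫ Z : V × V, tfCoeff Θ G Z * ∫ ζ, tfShift G Z.1 Z.2 (w ζ) * expNeg ζ v := by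
  obtain ⟨F, hF⟩ : ∃ F : U → V × V → ℂ, ∀ ζ Z, F ζ Z =
      tfCoeff Θ G Z * tfShift G Z.1 Z.2 (w ζ) * expNeg ζ v := ⟨_, fun _ _ => rfl⟩
  have hGc := hG.1.continuous
  have hint : Integrable (Function.uncurry F) := by
    obtain ⟨b, hb, n⟩ := integrable_tfCoeff_exp hΘ hG
    obtain ⟨ε, hε, C, hC, hGε⟩ := exists_norm_comp_sub_le hG hb
    refine (((integrable_gauss (V := U) hε).const_mul C).mul_prod n).mono' ?_ (Eventually.of_forall fun p => ?_)
    · have m1 : AEStronglyMeasurable (fun p : U × (V × V) => tfCoeff Θ G p.2) :=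
        (aestronglyMeasurable_tfCoeff hΘ.1.continuous hGc).comp_snd
      have k1 : Continuous fun p : U × (V × V) => tfShift G p.2.1 p.2.2 (w p.1) :=
        continuous_tfShift_comp hGc (by fun_prop) (by fun_prop) (by fun_prop)
      have k2 : Continuous fun p : U × (V × V) => expNeg p.1 v :=
        continuous_expNeg_comp continuous_fst continuous_const
      refine ((m1.mul k1.aestronglyMeasurable).mul k2.aestronglyMeasurable).congr (Eventually.of_forall fun p => ?_)
      simp only [Function.uncurry, hF, Pi.mul_apply]
    · simp only [Function.uncurry, hF, norm_mul, norm_tfShift, norm_expNeg, mul_one]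
      have q1 := hGε p.2.1 (w p.1)
      have q2 : Real.exp (-ε * ‖w p.1‖ ^ 2) ≤ Real.exp (-ε * ‖p.1‖ ^ 2) := by
        refine Real.exp_le_exp.2 ?_
        have := mul_le_mul_of_nonneg_left (hle p.1) hε.le
        linarith
      have q3 : Real.exp (b * ‖p.2.1‖ ^ 2) ≤ Real.exp (b * (‖p.2.1‖ ^ 2 + ‖p.2.2‖ ^ 2)) := by
        refine Real.exp_le_exp.2 (mul_le_mul_of_nonneg_left ?_ hb.le)
        linarith [sq_nonneg ‖p.2.2‖]
      calc _ ≤ ‖tfCoeff Θ G p.2‖ * (C * Real.exp (-ε * ‖p.1‖ ^ 2) *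
            Real.exp (b * (‖p.2.1‖ ^ 2 + ‖p.2.2‖ ^ 2))) := by
            refine mul_le_mul_of_nonneg_left (q1.trans ?_) (norm_nonneg _)
            exact mul_le_mul (mul_le_mul_of_nonneg_left q2 hC) q3 (Real.exp_pos _).le (by positivity)
        _ = _ := by ring
  have h1 : ∀ ζ, ∫ Z, F ζ Z = tfNorm G * (Θ (w ζ) * expNeg ζ v) := by
    intro ζ
    simp_rw [hF]
    rw [integral_mul_const, integral_tfCoeff_mul_tfShift hΘ hG]
    ring
  have h2 : ∀ Z, ∫ ζ, F ζ Z = tfCoeff Θ G Z * ∫ ζ, tfShift G Z.1 Z.2 (w ζ) * expNeg ζ v := by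
    intro Z
    simp_rw [hF, mul_assoc]
    rw [integral_const_mul]
  simp_rw [← h2]
  rw [← integral_integral_swap hint]
  simp_rw [h1]
  rw [integral_const_mul]

end Comp

/-! ### V_{f₁}f₂ as a distribution. -/

section STFTDistribution

variable {d : ℕ}

theorem continuous_fst_R2d : Continuous fun X : R2d d => X.fst := (WithLp.fstL 2 ℝ (Rd d) (Rd d)).continuous

theorem continuous_snd_R2d : Continuous fun X : R2d d => X.snd := (WithLp.sndL 2 ℝ (Rd d) (Rd d)).continuous

theorem norm_sq_add_le (u v : Rd d) : ‖u + v‖ ^ 2 ≤ 2 * ‖u‖ ^ 2 + 2 * ‖v‖ ^ 2 := by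
  have := norm_add_le u v
  nlinarith [sq_nonneg (‖u‖ - ‖v‖), norm_nonneg (u + v), norm_nonneg u, norm_nonneg v]

theorem tfNorm_mul_stftKernel {G Θ : R2d d → ℂ} (hG : G ∈ GelfandShilov (R2d d)) (hΘ : Θ ∈ GelfandShilov (R2d d))
    (v z : Rd d) :
    tfNorm G * stftKernel Θ v z = ∫ Z : R2d d × R2d d, tfCoeff Θ G Z * stftKernel (tfShift G Z.1 Z.2) v z := by
  have h := tfNorm_mul_integral_mul_expNeg hG hΘ (w := fun ζ : Rd d => (WithLp.toLp 2 (v - z, ζ) : R2d d))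
    (by fun_prop) (fun ζ => by rw [norm_sq_toLp]; linarith [sq_nonneg ‖v - z‖]) v
  simp only [stftKernel]
  rw [mul_left_comm, h, ← integral_const_mul]
  refine integral_congr_ae (Eventually.of_forall fun Z => ?_)
  simp only
  ring

theorem norm_sq_phase_le (Z : R2d d × R2d d) :
    ‖-Z.2.snd - Z.1.fst‖ ^ 2 + ‖Z.2.fst‖ ^ 2 ≤ 2 * (‖Z.1‖ ^ 2 + ‖Z.2‖ ^ 2) ∧
      ‖-Z.2.snd‖ ^ 2 + ‖Z.1.snd + Z.2.fst‖ ^ 2 ≤ 2 * (‖Z.1‖ ^ 2 + ‖Z.2‖ ^ 2) := by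
  have h1 := norm_sq_add_le (-Z.2.snd) (-Z.1.fst)
  have h2 := norm_sq_add_le Z.1.snd Z.2.fst
  rw [← sub_eq_add_neg, norm_neg, norm_neg] at h1
  rw [norm_neg, WithLp.prod_norm_sq_eq_of_L2, WithLp.prod_norm_sq_eq_of_L2]
  have := sq_nonneg ‖Z.1.fst‖
  have := sq_nonneg ‖Z.1.snd‖
  have := sq_nonneg ‖Z.2.fst‖
  have := sq_nonneg ‖Z.2.snd‖
  constructor <;> linarith

theorem continuous_stftPair_tfShift {f₁ f₂ : GelfandShilov (Rd d) → ℂ} (hf₁ : IsGSDistribution f₁)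
    (hf₂ : IsGSDistribution f₂) {φ₁ φ₂ : Rd d → ℂ} (hφ₁ : φ₁ ∈ GelfandShilov (Rd d))
    (hφ₂ : φ₂ ∈ GelfandShilov (Rd d)) :
    Continuous fun Z : R2d d × R2d d => stftPair f₁ f₂ (tfShift (stftFun2 φ₁ φ₂) Z.1 Z.2) := by
  have e : ∀ Z : R2d d × R2d d, stftPair f₁ f₂ (tfShift (stftFun2 φ₁ φ₂) Z.1 Z.2) = expNeg Z.1.snd Z.2.snd *
      (conj (gsPair f₁ (tfShift φ₁ (-Z.2.snd - Z.1.fst) Z.2.fst)) *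
        gsPair f₂ (tfShift φ₂ (-Z.2.snd) (Z.1.snd + Z.2.fst))) := fun Z =>
    stftPair_tfShift hf₁ hf₂ hφ₁ hφ₂ Z.1.fst Z.1.snd Z.2.fst Z.2.snd
  simp_rw [e]
  have c1 := continuous_fst_R2d (d := d)
  have c2 := continuous_snd_R2d (d := d)
  have k1 : Continuous fun Z : R2d d × R2d d => gsPair f₁ (tfShift φ₁ (-Z.2.snd - Z.1.fst) Z.2.fst) :=
    continuous_gsPair_tfShift_comp hf₁ hφ₁ (by fun_prop) (by fun_prop)
  have k2 : Continuous fun Z : R2d d × R2d d => gsPair f₂ (tfShift φ₂ (-Z.2.snd) (Z.1.snd + Z.2.fst)) :=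
    continuous_gsPair_tfShift_comp hf₂ hφ₂ (by fun_prop) (by fun_prop)
  have k3 : Continuous fun Z : R2d d × R2d d => expNeg Z.1.snd Z.2.snd :=
    continuous_expNeg_comp (by fun_prop) (by fun_prop)
  exact k3.mul ((Complex.continuous_conj.comp k1).mul k2)

theorem norm_stftPair_tfShift_le {f₁ f₂ : GelfandShilov (Rd d) → ℂ} (hf₁ : IsGSDistribution f₁)
    (hf₂ : IsGSDistribution f₂) {φ₁ φ₂ : Rd d → ℂ} (hφ₁ : φ₁ ∈ GelfandShilov (Rd d))
    (hφ₂ : φ₂ ∈ GelfandShilov (Rd d)) {b : ℝ} (hb : 0 < b) : ∃ C : ℝ, 0 ≤ C ∧ ∀ Z : R2d d × R2d d,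
      ‖stftPair f₁ f₂ (tfShift (stftFun2 φ₁ φ₂) Z.1 Z.2)‖ ≤ C * Real.exp (b * (‖Z.1‖ ^ 2 + ‖Z.2‖ ^ 2)) := by
  -- Each of the two factors sits at a point of squared length at most 2(‖Z.1‖² + ‖Z.2‖²), and 2 · 2
  -- · b/4 = b.
  have hb4 : 0 < b / 4 := by positivity
  obtain ⟨C₁, hC₁, h₁⟩ := norm_gsPair_tfShift_le hφ₁ hf₁ hb4
  obtain ⟨C₂, hC₂, h₂⟩ := norm_gsPair_tfShift_le hφ₂ hf₂ hb4
  refine ⟨C₁ * C₂, mul_nonneg hC₁ hC₂, fun Z => ?_⟩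
  have e : stftPair f₁ f₂ (tfShift (stftFun2 φ₁ φ₂) Z.1 Z.2) = expNeg Z.1.snd Z.2.snd *
      (conj (gsPair f₁ (tfShift φ₁ (-Z.2.snd - Z.1.fst) Z.2.fst)) *
        gsPair f₂ (tfShift φ₂ (-Z.2.snd) (Z.1.snd + Z.2.fst))) :=
    stftPair_tfShift hf₁ hf₂ hφ₁ hφ₂ Z.1.fst Z.1.snd Z.2.fst Z.2.snd
  rw [e, norm_mul, norm_mul, norm_expNeg, one_mul, RCLike.norm_conj]
  refine (mul_le_mul (h₁ _ _) (h₂ _ _) (norm_nonneg _) (by positivity)).trans ?_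
  rw [mul_mul_mul_comm, ← Real.exp_add]
  refine mul_le_mul_of_nonneg_left (Real.exp_le_exp.2 ?_) (by positivity)
  obtain ⟨q1, q2⟩ := norm_sq_phase_le Z
  have r1 := mul_le_mul_of_nonneg_left q1 hb4.le
  have r2 := mul_le_mul_of_nonneg_left q2 hb4.le
  linarith

/-- Continuity of this functional is not yet known, so the reconstruction formula cannot be applied
to it. Instead the kernel is expanded in kernels of shifts, and `synthesis` brings first f₁ and then
f₂ under the integral. -/
theorem tfNorm_mul_stftPair {f₁ f₂ : GelfandShilov (Rd d) → ℂ} (hf₁ : IsGSDistribution f₁)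
    (hf₂ : IsGSDistribution f₂) {φ₁ φ₂ : Rd d → ℂ} (hφ₁ : φ₁ ∈ GelfandShilov (Rd d))
    (hφ₂ : φ₂ ∈ GelfandShilov (Rd d)) {Θ : R2d d → ℂ} (hΘ : Θ ∈ GelfandShilov (R2d d))
    (hne : tfNorm (stftFun2 φ₁ φ₂) ≠ 0) :
    tfNorm (stftFun2 φ₁ φ₂) * stftPair f₁ f₂ Θ = ∫ Z : R2d d × R2d d,
      tfCoeff Θ (stftFun2 φ₁ φ₂) Z * stftPair f₁ f₂ (tfShift (stftFun2 φ₁ φ₂) Z.1 Z.2) := by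
  have hG := stftFun2_mem hφ₁ hφ₂
  obtain ⟨G, hGd⟩ : ∃ G, G = stftFun2 φ₁ φ₂ := ⟨_, rfl⟩
  have hker : ∀ (Z : R2d d × R2d d) (v z : Rd d), stftKernel (tfShift G Z.1 Z.2) v z =
      expNeg Z.2.fst (v - z) * expNeg Z.1.snd (v + Z.2.snd) *
        (conj (φ₂ (v + Z.2.snd)) * φ₁ (z + Z.2.snd + Z.1.fst)) := fun Z v z => by
    rw [hGd]
    exact stftKernel_tfShift hφ₁ hφ₂ Z.1.fst Z.1.snd Z.2.fst Z.2.snd v z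
  have hpair : ∀ Z : R2d d × R2d d, stftPair f₁ f₂ (tfShift G Z.1 Z.2) = expNeg Z.1.snd Z.2.snd *
      (conj (gsPair f₁ (tfShift φ₁ (-Z.2.snd - Z.1.fst) Z.2.fst)) *
        gsPair f₂ (tfShift φ₂ (-Z.2.snd) (Z.1.snd + Z.2.fst))) := fun Z => by
    rw [hGd]
    exact stftPair_tfShift hf₁ hf₂ hφ₁ hφ₂ Z.1.fst Z.1.snd Z.2.fst Z.2.snd
  rw [← hGd] at hG hne ⊢
  have c1 := continuous_fst_R2d (d := d)
  have c2 := continuous_snd_R2d (d := d)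
  have hφ₂c := hφ₂.1.continuous
  obtain ⟨b, hb, n⟩ := integrable_tfCoeff_exp hΘ hG
  have hb4 : 0 < b / 4 := by positivity
  have hcm := aestronglyMeasurable_tfCoeff hΘ.1.continuous hG.1.continuous
  have hZ₁ : Continuous fun Z : R2d d × R2d d => (-Z.2.snd - Z.1.fst, Z.2.fst) := by fun_prop
  have hZ₂ : Continuous fun Z : R2d d × R2d d => (-Z.2.snd, Z.1.snd + Z.2.fst) := by fun_prop
  obtain ⟨B, hB, hφB⟩ := GelfandShilov.bounded hφ₂
  obtain ⟨C₁, hC₁, h₁⟩ := norm_gsPair_tfShift_le hφ₁ hf₁ hb4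
  -- For fixed v, the function paired with f₁ is a superposition of shifts of φ₁; the outcome, as a
  -- function of v, is a superposition of shifts of φ₂.
  have hk : ∀ v : Rd d, conj (gsPair f₁ fun z => conj (stftKernel Θ v z)) = ∫ Z : R2d d × R2d d,
      ((tfNorm G)⁻¹ * tfCoeff Θ G Z * (expNeg Z.1.snd Z.2.snd *
        conj (gsPair f₁ (tfShift φ₁ (-Z.2.snd - Z.1.fst) Z.2.fst)))) *
          tfShift φ₂ (-Z.2.snd) (Z.1.snd + Z.2.fst) v := by
    intro v
    obtain ⟨c, hc⟩ : ∃ c : R2d d × R2d d → ℂ, ∀ Z, c Z = conj ((tfNorm G)⁻¹ * tfCoeff Θ G Z *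
      (expNeg Z.2.fst v * expNeg Z.1.snd (v + Z.2.snd) * conj (φ₂ (v + Z.2.snd)))) := ⟨_, fun _ => rfl⟩
    have hcmeas : AEStronglyMeasurable c := by
      have k1 : Continuous fun Z : R2d d × R2d d => expNeg Z.2.fst v :=
        continuous_expNeg_comp (by fun_prop) (by fun_prop)
      have k2 : Continuous fun Z : R2d d × R2d d => expNeg Z.1.snd (v + Z.2.snd) :=
        continuous_expNeg_comp (by fun_prop) (by fun_prop)
      have k3 : Continuous fun Z : R2d d × R2d d => conj (φ₂ (v + Z.2.snd)) :=
        Complex.continuous_conj.comp (hφ₂c.comp (by fun_prop))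
      rw [funext hc]
      exact Complex.continuous_conj.comp_aestronglyMeasurable
        ((hcm.const_mul _).mul ((k1.mul k2).mul k3).aestronglyMeasurable)
    have hcint : Integrable fun Z : R2d d × R2d d =>
        ‖c Z‖ * Real.exp (b / 4 * (‖-Z.2.snd - Z.1.fst‖ ^ 2 + ‖Z.2.fst‖ ^ 2)) := by
      refine (n.const_mul (‖(tfNorm G)⁻¹‖ * B)).mono' (hcmeas.norm.mul (Continuous.aestronglyMeasurable (by fun_prop)))
        (Eventually.of_forall fun Z => ?_)
      rw [Real.norm_of_nonneg (by positivity), hc, RCLike.norm_conj, norm_mul, norm_mul, norm_mul, norm_mul,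
        norm_expNeg, norm_expNeg, RCLike.norm_conj, one_mul, one_mul]
      have q : Real.exp (b / 4 * (‖-Z.2.snd - Z.1.fst‖ ^ 2 + ‖Z.2.fst‖ ^ 2)) ≤
          Real.exp (b * (‖Z.1‖ ^ 2 + ‖Z.2‖ ^ 2)) := by
        refine Real.exp_le_exp.2 ?_
        have := mul_le_mul_of_nonneg_left (norm_sq_phase_le Z).1 hb4.le
        have : 0 ≤ b * (‖Z.1‖ ^ 2 + ‖Z.2‖ ^ 2) := by positivity
        linarith
      calc _ ≤ ‖(tfNorm G)⁻¹‖ * ‖tfCoeff Θ G Z‖ * B * Real.exp (b * (‖Z.1‖ ^ 2 + ‖Z.2‖ ^ 2)) :=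
            mul_le_mul (mul_le_mul_of_nonneg_left (hφB _) (by positivity)) q (Real.exp_pos _).le (by positivity)
        _ = _ := by ring
    have e1 : (fun z => conj (stftKernel Θ v z)) = fun z => ∫ Z : R2d d × R2d d, c Z *
        tfShift φ₁ (-Z.2.snd - Z.1.fst) Z.2.fst z := by
      ext z
      have e2 : stftKernel Θ v z = ∫ Z : R2d d × R2d d, (tfNorm G)⁻¹ *
          (tfCoeff Θ G Z * stftKernel (tfShift G Z.1 Z.2) v z) := by
        rw [integral_const_mul, ← tfNorm_mul_stftKernel hG hΘ, inv_mul_cancel_left₀ hne]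
      rw [e2, ← integral_conj]
      refine integral_congr_ae (Eventually.of_forall fun Z => ?_)
      have e3 : z - (-Z.2.snd - Z.1.fst) = z + Z.2.snd + Z.1.fst := by abel
      simp only
      rw [hc, hker, tfShift, e3, sub_eq_add_neg v z, expNeg_add_right, expNeg_neg_right]
      simp only [map_mul, Complex.conj_conj]
      ring
    rw [e1, (synthesis hφ₁ hb4 hZ₁.measurable hcmeas hcint).2 f₁ hf₁, ← integral_conj]
    refine integral_congr_ae (Eventually.of_forall fun Z => ?_)
    simp only [hc, map_mul, Complex.conj_conj, tfShift, sub_neg_eq_add, expNeg_add, expNeg_add_right]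
    ring
  -- The new coefficients contain the pairings with f₁, whose growth at rate b/4 fits into the
  -- margin b.
  obtain ⟨c, hc⟩ : ∃ c : R2d d × R2d d → ℂ, ∀ Z, c Z = (tfNorm G)⁻¹ * tfCoeff Θ G Z * (expNeg Z.1.snd Z.2.snd *
      conj (gsPair f₁ (tfShift φ₁ (-Z.2.snd - Z.1.fst) Z.2.fst))) := ⟨_, fun _ => rfl⟩
  have hcmeas : AEStronglyMeasurable c := by
    have k1 : Continuous fun Z : R2d d × R2d d => expNeg Z.1.snd Z.2.snd :=
      continuous_expNeg_comp (by fun_prop) (by fun_prop)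
    have k2 : Continuous fun Z : R2d d × R2d d => gsPair f₁ (tfShift φ₁ (-Z.2.snd - Z.1.fst) Z.2.fst) :=
      continuous_gsPair_tfShift_comp hf₁ hφ₁ (by fun_prop) (by fun_prop)
    rw [funext hc]
    exact (hcm.const_mul _).mul (k1.mul (Complex.continuous_conj.comp k2)).aestronglyMeasurable
  have hcint : Integrable fun Z : R2d d × R2d d =>
      ‖c Z‖ * Real.exp (b / 4 * (‖-Z.2.snd‖ ^ 2 + ‖Z.1.snd + Z.2.fst‖ ^ 2)) := by
    refine (n.const_mul (‖(tfNorm G)⁻¹‖ * C₁)).mono' (hcmeas.norm.mul (Continuous.aestronglyMeasurable (by fun_prop)))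
      (Eventually.of_forall fun Z => ?_)
    rw [Real.norm_of_nonneg (by positivity), hc, norm_mul, norm_mul, norm_mul, norm_expNeg, RCLike.norm_conj, one_mul]
    have q : Real.exp (b / 4 * (‖-Z.2.snd - Z.1.fst‖ ^ 2 + ‖Z.2.fst‖ ^ 2)) *
        Real.exp (b / 4 * (‖-Z.2.snd‖ ^ 2 + ‖Z.1.snd + Z.2.fst‖ ^ 2)) ≤ Real.exp (b * (‖Z.1‖ ^ 2 + ‖Z.2‖ ^ 2)) := by
      rw [← Real.exp_add]
      refine Real.exp_le_exp.2 ?_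
      have r1 := mul_le_mul_of_nonneg_left (norm_sq_phase_le Z).1 hb4.le
      have r2 := mul_le_mul_of_nonneg_left (norm_sq_phase_le Z).2 hb4.le
      linarith
    calc _ ≤ ‖(tfNorm G)⁻¹‖ * ‖tfCoeff Θ G Z‖ *
          (C₁ * Real.exp (b / 4 * (‖-Z.2.snd - Z.1.fst‖ ^ 2 + ‖Z.2.fst‖ ^ 2))) *
          Real.exp (b / 4 * (‖-Z.2.snd‖ ^ 2 + ‖Z.1.snd + Z.2.fst‖ ^ 2)) :=
          mul_le_mul_of_nonneg_right (mul_le_mul_of_nonneg_left (h₁ _ _) (by positivity)) (Real.exp_pos _).le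
      _ = ‖(tfNorm G)⁻¹‖ * ‖tfCoeff Θ G Z‖ * C₁ *
          (Real.exp (b / 4 * (‖-Z.2.snd - Z.1.fst‖ ^ 2 + ‖Z.2.fst‖ ^ 2)) *
          Real.exp (b / 4 * (‖-Z.2.snd‖ ^ 2 + ‖Z.1.snd + Z.2.fst‖ ^ 2))) := by ring
      _ ≤ ‖(tfNorm G)⁻¹‖ * ‖tfCoeff Θ G Z‖ * C₁ * Real.exp (b * (‖Z.1‖ ^ 2 + ‖Z.2‖ ^ 2)) :=
          mul_le_mul_of_nonneg_left q (by positivity)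
      _ = _ := by ring
  simp_rw [← hc] at hk
  rw [stftPair, funext hk, (synthesis hφ₂ hb4 hZ₂.measurable hcmeas hcint).2 f₂ hf₂, ← integral_const_mul]
  refine integral_congr_ae (Eventually.of_forall fun Z => ?_)
  simp only [hc, hpair]
  rw [← mul_assoc, ← mul_assoc, ← mul_assoc, mul_inv_cancel_left₀ hne]
  ring

theorem tfCoeff_add {V : Type*} [NormedAddCommGroup V] [InnerProductSpace ℝ V]
    [FiniteDimensional ℝ V] [MeasurableSpace V] [BorelSpace V] {θ θ' φ : V → ℂ} (hθ : θ ∈ GelfandShilov V)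
    (hθ' : θ' ∈ GelfandShilov V) (hφ : φ ∈ GelfandShilov V) (Z : V × V) :
    tfCoeff (θ + θ') φ Z = tfCoeff θ φ Z + tfCoeff θ' φ Z := by
  obtain ⟨B, hB, hb⟩ := GelfandShilov.bounded hφ
  have hφc := hφ.1.continuous
  have hi : ∀ θ : V → ℂ, θ ∈ GelfandShilov V →
      Integrable fun t => θ t * φ (t - Z.1) * conj (expNeg Z.2 t) := by
    intro θ hθ
    refine (GelfandShilov.integrable hθ).mul_bdd (c := B) ?_ ?_ |>.mul_bdd (c := 1) ?_ ?_
    · exact (hφc.comp (by fun_prop)).aestronglyMeasurable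
    · exact Eventually.of_forall fun t => hb _
    · exact (Complex.continuous_conj.comp (contDiff_expNeg Z.2).continuous).aestronglyMeasurable
    · exact Eventually.of_forall fun t => by rw [RCLike.norm_conj, norm_expNeg]
  simp only [tfCoeff, cFourier]
  rw [← integral_add (hi θ hθ) (hi θ' hθ')]
  refine integral_congr_ae (Eventually.of_forall fun t => ?_)
  simp only [Pi.add_apply]
  ring

/-- The functional is an integral of `tfCoeff Θ G` against a fixed continuous function that grows
slower than every Gaussian. Linearity is inherited from the coefficients, and boundedness holds
because their Gaussian decay is uniform over each S_{1/2,h}. -/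
theorem isGSDistribution_stftDist {f₁ f₂ : GelfandShilov (Rd d) → ℂ} (hf₁ : IsGSDistribution f₁)
    (hf₂ : IsGSDistribution f₂) : IsGSDistribution (stftDist f₁ f₂) := by
  have hg := gaussWindow_mem (V := Rd d)
  have hG := stftFun2_mem hg hg
  have hne := tfNorm_ne_zero hG (stftFun2_gaussWindow_ne_zero 0)
  obtain ⟨G, hGd⟩ : ∃ G, G = stftFun2 (gaussWindow (Rd d)) (gaussWindow (Rd d)) := ⟨_, rfl⟩
  obtain ⟨W, hW⟩ : ∃ W : R2d d × R2d d → ℂ, ∀ Z, W Z = stftPair f₁ f₂ (tfShift G Z.1 Z.2) := ⟨_, fun _ => rfl⟩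
  have hWc : Continuous W := by
    rw [funext hW, hGd]
    exact continuous_stftPair_tfShift hf₁ hf₂ hg hg
  have hWb : ∀ b > 0, ∃ C : ℝ, 0 ≤ C ∧ ∀ Z, ‖W Z‖ ≤ C * Real.exp (b * (‖Z.1‖ ^ 2 + ‖Z.2‖ ^ 2)) := by
    intro b hb
    simp_rw [hW, hGd]
    exact norm_stftPair_tfShift_le hf₁ hf₂ hg hg hb
  have key : ∀ Θ : GelfandShilov (R2d d), stftDist f₁ f₂ Θ = (tfNorm G)⁻¹ * ∫ Z, tfCoeff Θ G Z * W Z := by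
    intro Θ
    have := tfNorm_mul_stftPair hf₁ hf₂ hg hg Θ.2 hne
    simp_rw [← hGd, ← hW] at this
    rw [← this, inv_mul_cancel_left₀ (hGd ▸ hne)]
    rfl
  rw [← hGd] at hG hne
  have hint : ∀ Θ : GelfandShilov (R2d d), Integrable fun Z => tfCoeff Θ G Z * W Z := by
    intro Θ
    obtain ⟨b, hb, n⟩ := integrable_tfCoeff_exp Θ.2 hG
    obtain ⟨C, hC, h⟩ := hWb b hb
    refine (n.const_mul C).mono' ((aestronglyMeasurable_tfCoeff Θ.2.1.continuous hG.1.continuous).mul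
      hWc.aestronglyMeasurable) (Eventually.of_forall fun Z => ?_)
    rw [norm_mul]
    exact (mul_le_mul_of_nonneg_left (h Z) (norm_nonneg _)).trans (le_of_eq (by ring))
  refine ⟨⟨fun Θ Θ' => ?_, fun c Θ => ?_⟩, fun h hh => ?_⟩
  · rw [key, key, key, ← mul_add, ← integral_add (hint Θ) (hint Θ')]
    congr 1
    refine integral_congr_ae (Eventually.of_forall fun Z => ?_)
    simp only [Submodule.coe_add]
    rw [tfCoeff_add Θ.2 Θ'.2 hG, add_mul]
  · rw [key, key, smul_eq_mul, mul_left_comm c, ← integral_const_mul c]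
    congr 1
    refine integral_congr_ae (Eventually.of_forall fun Z => ?_)
    simp only [Submodule.coe_smul, tfCoeff, cFourier, Pi.smul_apply, smul_eq_mul]
    simp_rw [mul_assoc]
    rw [integral_const_mul, mul_assoc]
  · rw [mem_gelfandShilov_iff] at hG
    obtain ⟨hGs, a, ha, h', hh', M', H'⟩ := hG
    have ha' : 0 < min a (4 * h ^ 2)⁻¹ := by positivity
    obtain ⟨δ, hδ, C, hC, hb⟩ := norm_tfCoeff_le (V := R2d d) ha' (lt_max_of_lt_left hh' : 0 < max h' h)
    -- The decay rate δ of the coefficients is fixed first; the growth of W is then taken at half of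
    -- it.
    obtain ⟨D, hD, hWD⟩ := hWb (δ / 2) (half_pos hδ)
    refine ⟨‖(tfNorm G)⁻¹‖ * (C * 2 * M' * D * ∫ Z : R2d d × R2d d, Real.exp (-(δ / 2) * (‖Z.1‖ ^ 2 + ‖Z.2‖ ^ 2))),
      fun Θ M hM => ?_⟩
    have hM2 := (hM.gaussBound hh).mono hh.le (min_le_right a _) (le_max_right h' h) le_rfl
    have hG2 := H'.mono hh'.le (min_le_left a (4 * h ^ 2)⁻¹) (le_max_left h' h) le_rfl
    rw [key, norm_mul, mul_assoc]
    refine mul_le_mul_of_nonneg_left ?_ (norm_nonneg _)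
    have hb' := hb Θ G (2 * M) M' Θ.2.1 hGs hM2 hG2
    have hpt : ∀ Z : R2d d × R2d d, ‖tfCoeff Θ G Z * W Z‖ ≤ (C * 2 * M' * D * M) *
        Real.exp (-(δ / 2) * (‖Z.1‖ ^ 2 + ‖Z.2‖ ^ 2)) := by
      intro Z
      rw [norm_mul]
      have h0 := mul_nonneg hC (mul_nonneg hM2.nonneg hG2.nonneg)
      refine (mul_le_mul (hb' Z) (hWD Z) (norm_nonneg _) (by positivity)).trans (le_of_eq ?_)
      have e : Real.exp (-(δ / 2) * (‖Z.1‖ ^ 2 + ‖Z.2‖ ^ 2)) = Real.exp (-δ * (‖Z.1‖ ^ 2 + ‖Z.2‖ ^ 2)) *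
          Real.exp (δ / 2 * (‖Z.1‖ ^ 2 + ‖Z.2‖ ^ 2)) := by
        rw [← Real.exp_add]
        congr 1
        ring
      rw [e]
      ring
    calc ‖∫ Z, tfCoeff Θ G Z * W Z‖ ≤ ∫ Z : R2d d × R2d d, (C * 2 * M' * D * M) *
          Real.exp (-(δ / 2) * (‖Z.1‖ ^ 2 + ‖Z.2‖ ^ 2)) :=
          norm_integral_le_of_norm_le ((integrable_gauss_prod (half_pos hδ)).const_mul _) (Eventually.of_forall hpt)
      _ = _ := by
        rw [integral_const_mul]
        ring

end STFTDistribution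

/-! ### Change of windows in the mixed norms. -/

section WindowNorms

variable {d : ℕ}

/-- The identification of `ℝ^{4d}` with the phase space of `ℝ^{2d}`. -/
def toPhase (X : Rd d × Rd d × Rd d × Rd d) : R2d d × R2d d :=
  (WithLp.toLp 2 (X.1, X.2.1), WithLp.toLp 2 (X.2.2.1, X.2.2.2))

theorem measurePreserving_toPhase : MeasurePreserving (toPhase (d := d)) := by
  have h1 : MeasurePreserving (WithLp.toLp 2 : Rd d × Rd d → R2d d) := WithLp.volume_preserving_toLp _ _
  exact (h1.prod h1).comp (measurePreserving_prodAssoc (volume : Measure (Rd d)) (volume : Measure (Rd d))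
    (volume : Measure (Rd d × Rd d))).symm

theorem toPhase_sub (X Y : Rd d × Rd d × Rd d × Rd d) : toPhase (X - Y) = toPhase X - toPhase Y := rfl

theorem phaseSq_toPhase (X : Rd d × Rd d × Rd d × Rd d) : phaseSq (toPhase X) = sq4 X := by
  rw [phaseSq, toPhase, norm_sq_toLp, norm_sq_toLp, sq4]
  ring

theorem mixedNorm4_eq_orlicz4 (Φ₁ Φ₂ Ψ₁ Ψ₂ : ℝ≥0∞ → ℝ≥0∞) (ω : Rd d × Rd d × Rd d × Rd d → ℝ)
    (F : R2d d → R2d d → ℂ) : mixedNorm4 Φ₁ Φ₂ Ψ₁ Ψ₂ ω F =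
      orlicz4 Φ₁ Φ₂ Ψ₁ Ψ₂ fun X => ‖F (toPhase X).1 (toPhase X).2‖ₑ * ENNReal.ofReal (ω X) := rfl

/-- Change of windows in the mixed norms. -/
theorem mixedNorm4_stft_le {Φ₁ Φ₂ Ψ₁ Ψ₂ : ℝ≥0∞ → ℝ≥0∞} {p : ℝ} (hp : 0 < p) (hp1 : p ≤ 1)
    (h₁ : IsStarYoung p Φ₁) (h₂ : IsStarYoung p Φ₂) (h₃ : IsStarYoung p Ψ₁) (h₄ : IsStarYoung p Ψ₂)
    {ω : Rd d × Rd d × Rd d × Rd d → ℝ} (hω : IsModerateWeight ω) {G H : R2d d → ℂ} (hG : G ∈ GelfandShilov (R2d d))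
    (hH : H ∈ GelfandShilov (R2d d)) {X₀ : R2d d} (hX₀ : G X₀ ≠ 0) :
    ∃ c : ℝ≥0, ∀ u : GelfandShilov (R2d d) → ℂ, IsGSDistribution u →
      mixedNorm4 Φ₁ Φ₂ Ψ₁ Ψ₂ ω (stft H u) ≤ c * mixedNorm4 Φ₁ Φ₂ Ψ₁ Ψ₂ ω (stft G u) := by
  obtain ⟨δ, hδ, C, hC⟩ := exists_enorm_gsPair_rpow_le_convolution hG hH hX₀ hp hp1
  obtain ⟨c, hc⟩ := orlicz4_moderate_convolution_le hp h₁ h₂ h₃ h₄ hω hδ C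
  refine ⟨c, fun u hu => ?_⟩
  rw [mixedNorm4_eq_orlicz4, mixedNorm4_eq_orlicz4]
  have hcont : Continuous fun Z : R2d d × R2d d => gsPair u (tfShift G Z.1 Z.2) := continuous_gsPair_tfShift hG hu
  refine hc (fun X => ‖stft G u (toPhase X).1 (toPhase X).2‖ₑ) (fun X => ‖stft H u (toPhase X).1 (toPhase X).2‖ₑ)
    ?_ fun X => ?_
  · simp only [stft_eq]
    exact ((continuous_const.mul hcont).enorm.measurable).comp measurePreserving_toPhase.measurable
  · have e : ∀ Z : Rd d × Rd d × Rd d × Rd d, ‖stft G u (toPhase Z).1 (toPhase Z).2‖ₑ ^ p * eGauss sq4 δ (X - Z) =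
        ‖fourierConst (R2d d)‖ₑ ^ p *
          (fun Y : R2d d × R2d d => ‖gsPair u (tfShift G Y.1 Y.2)‖ₑ ^ p * eGauss phaseSq δ (toPhase X - Y)) (toPhase Z) := by
      intro Z
      simp only [stft_eq, enorm_mul, ENNReal.mul_rpow_of_nonneg _ _ hp.le, eGauss, ← toPhase_sub, phaseSq_toPhase]
      ring
    have hm : Measurable fun Y : R2d d × R2d d =>
        ‖gsPair u (tfShift G Y.1 Y.2)‖ₑ ^ p * eGauss phaseSq δ (toPhase X - Y) := by
      refine (hcont.enorm.measurable.pow_const _).mul ?_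
      have : Continuous fun Y : R2d d × R2d d => Real.exp (-δ * phaseSq (toPhase X - Y)) := by
        unfold phaseSq
        simp only [Prod.fst_sub, Prod.snd_sub]
        fun_prop
      exact this.measurable.ennreal_ofReal
    simp_rw [e]
    rw [lintegral_const_mul' _ _ (by finiteness), measurePreserving_toPhase.lintegral_comp hm, stft_eq, enorm_mul,
      ENNReal.mul_rpow_of_nonneg _ _ hp.le, mul_left_comm]
    exact mul_le_mul_right (hC u hu _) _

end WindowNorms

/-! ### Norm estimates and proof of the theorem. -/

section Main

variable {d : ℕ}

theorem fourierConst_R2d (d : ℕ) : fourierConst (R2d d) = fourierConst (Rd d) * fourierConst (Rd d) := by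
  have hf : Module.finrank ℝ (R2d d) = d + d := by
    rw [LinearEquiv.finrank_eq (WithLp.linearEquiv 2 ℝ (Rd d × Rd d)), Module.finrank_prod, finrank_euclideanSpace_fin]
  rw [fourierConst, fourierConst, ← Complex.ofReal_mul, ← Real.rpow_add (by positivity), hf, finrank_euclideanSpace_fin]
  congr 2
  push_cast
  ring

/-- `stftPair_tfShift` in modulus; the normalizing constant of ℝ^{2d} is the product of two
constants of ℝ^d. -/
theorem enorm_stft_stftDist {f₁ f₂ : GelfandShilov (Rd d) → ℂ} (hf₁ : IsGSDistribution f₁) (hf₂ : IsGSDistribution f₂)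
    {φ₁ φ₂ : Rd d → ℂ} (hφ₁ : φ₁ ∈ GelfandShilov (Rd d)) (hφ₂ : φ₂ ∈ GelfandShilov (Rd d)) (x ξ η y : Rd d) :
    ‖stft (stftFun2 φ₁ φ₂) (stftDist f₁ f₂) (WithLp.toLp 2 (x, ξ)) (WithLp.toLp 2 (η, y))‖ₑ =
      ‖stft φ₁ f₁ (-y - x) η‖ₑ * ‖stft φ₂ f₂ (-y) (ξ + η)‖ₑ := by
  have h1 : ∀ z : ℂ, ‖conj z‖ₑ = ‖z‖ₑ := fun z => by rw [← ofReal_norm, RCLike.norm_conj, ofReal_norm]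
  have h2 : ‖expNeg ξ y‖ₑ = 1 := by rw [← ofReal_norm, norm_expNeg, ENNReal.ofReal_one]
  rw [stft_eq, stft_eq, stft_eq, gsPair_stftDist (tfShift_mem (stftFun2_mem hφ₁ hφ₂) _ _),
    stftPair_tfShift hf₁ hf₂ hφ₁ hφ₂, fourierConst_R2d]
  simp only [enorm_mul, h1, h2, one_mul]
  ring

theorem locallyBelow_stft {φ : Rd d → ℂ} (hφ : φ ∈ GelfandShilov (Rd d)) {f : GelfandShilov (Rd d) → ℂ}
    (hf : IsGSDistribution f) {ω : Rd d × Rd d → ℝ} (hω : IsModerateWeight ω) :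
    LocallyBelow fun x ξ => ‖stft φ f x ξ‖ₑ * ENNReal.ofReal (ω (x, ξ)) :=
  locallyBelow_of_continuous (A := fun Z => stft φ f Z.1 Z.2)
    (continuous_const.mul (continuous_gsPair_tfShift hφ hf)) hω

variable {Φ₁ Φ₂ Ψ₁ Ψ₂ : ℝ≥0∞ → ℝ≥0∞} {p : ℝ} {ω₀ : Rd d × Rd d × Rd d × Rd d → ℝ} {ω₁ ω₂ : Rd d × Rd d → ℝ}

theorem orlicz4_stft_mul (hp : 0 ≤ p) (h₁ : IsStarYoung p Φ₁) (h₂ : IsStarYoung p Φ₂) (h₃ : IsStarYoung p Ψ₁)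
    (h₄ : IsStarYoung p Ψ₂) (hω₁ : IsModerateWeight ω₁) (hω₂ : IsModerateWeight ω₂)
    {f₁ f₂ : GelfandShilov (Rd d) → ℂ} (hf₁ : IsGSDistribution f₁) (hf₂ : IsGSDistribution f₂)
    {φ₁ φ₂ : Rd d → ℂ} (hφ₁ : φ₁ ∈ GelfandShilov (Rd d)) (hφ₂ : φ₂ ∈ GelfandShilov (Rd d)) :
    orlicz4 Φ₁ Φ₂ Ψ₁ Ψ₂ (fun X =>
        ‖stft φ₁ f₁ (-X.2.2.2 - X.1) X.2.2.1‖ₑ * ENNReal.ofReal (ω₁ (-X.2.2.2 - X.1, X.2.2.1)) *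
        (‖stft φ₂ f₂ (-X.2.2.2) (X.2.1 + X.2.2.1)‖ₑ * ENNReal.ofReal (ω₂ (-X.2.2.2, X.2.1 + X.2.2.1)))) =
      mixedNorm Φ₁ Ψ₁ ω₁ (stft φ₁ f₁) * mixedNormStar Ψ₂ Φ₂ ω₂ (stft φ₂ f₂) := by
  obtain ⟨P, hP⟩ : ∃ P : Rd d → Rd d → ℝ≥0∞, ∀ x ξ, ‖stft φ₁ f₁ x ξ‖ₑ * ENNReal.ofReal (ω₁ (x, ξ)) = P x ξ :=
    ⟨_, fun _ _ => rfl⟩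
  obtain ⟨Q, hQ⟩ : ∃ Q : Rd d → Rd d → ℝ≥0∞, ∀ x ξ, ‖stft φ₂ f₂ x ξ‖ₑ * ENNReal.ofReal (ω₂ (x, ξ)) = Q x ξ :=
    ⟨_, fun _ _ => rfl⟩
  have lP := locallyBelow_stft hφ₁ hf₁ hω₁
  have lQ := locallyBelow_stft hφ₂ hf₂ hω₂
  simp only [mixedNorm, mixedNormStar, hP, hQ] at lP lQ ⊢
  exact orlicz4_mul hp h₁ h₂ h₃ h₄ lP lQ

theorem mixedNorm4_stftDist_le (hp : 0 ≤ p) (h₁ : IsStarYoung p Φ₁) (h₂ : IsStarYoung p Φ₂) (h₃ : IsStarYoung p Ψ₁)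
    (h₄ : IsStarYoung p Ψ₂) (hω₁ : IsModerateWeight ω₁) (hω₂ : IsModerateWeight ω₂) {C : ℝ} (hC : 0 < C)
    (h : ∀ x y ξ η : Rd d, ω₀ (x, ξ, η, -y) ≤ C * (ω₁ (y - x, η) * ω₂ (y, ξ + η)))
    {f₁ f₂ : GelfandShilov (Rd d) → ℂ} (hf₁ : IsGSDistribution f₁) (hf₂ : IsGSDistribution f₂)
    {φ₁ φ₂ : Rd d → ℂ} (hφ₁ : φ₁ ∈ GelfandShilov (Rd d)) (hφ₂ : φ₂ ∈ GelfandShilov (Rd d)) :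
    mixedNorm4 Φ₁ Φ₂ Ψ₁ Ψ₂ ω₀ (stft (stftFun2 φ₁ φ₂) (stftDist f₁ f₂)) ≤
      ENNReal.ofReal C * (mixedNorm Φ₁ Ψ₁ ω₁ (stft φ₁ f₁) * mixedNormStar Ψ₂ Φ₂ ω₂ (stft φ₂ f₂)) := by
  rw [← orlicz4_stft_mul hp h₁ h₂ h₃ h₄ hω₁ hω₂ hf₁ hf₂ hφ₁ hφ₂, ENNReal.ofReal,
    ← orlicz4_const_mul (Real.toNNReal_pos.2 hC), mixedNorm4_eq_orlicz4]
  refine orlicz4_mono hp h₁ h₂ h₃ h₄ fun X => ?_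
  obtain ⟨x, ξ, η, y⟩ := X
  -- The weight condition is stated at -y, the norm at y.
  have hw := h x (-y) ξ η
  rw [neg_neg] at hw
  have e := enorm_stft_stftDist hf₁ hf₂ hφ₁ hφ₂ x ξ η y
  simp only [toPhase]
  rw [e, mul_mul_mul_comm, mul_left_comm]
  refine mul_le_mul_right ?_ _
  rw [← ENNReal.ofReal_mul (hω₁.weight.pos _).le, ← ENNReal.ofReal, ← ENNReal.ofReal_mul hC.le]
  exact ENNReal.ofReal_le_ofReal hw

theorem le_mixedNorm4_stftDist (hp : 0 ≤ p) (h₁ : IsStarYoung p Φ₁) (h₂ : IsStarYoung p Φ₂) (h₃ : IsStarYoung p Ψ₁)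
    (h₄ : IsStarYoung p Ψ₂) (hω₁ : IsModerateWeight ω₁) (hω₂ : IsModerateWeight ω₂) {C : ℝ} (hC : 0 < C)
    (h : ∀ x y ξ η : Rd d, ω₁ (y - x, η) * ω₂ (y, ξ + η) ≤ C * ω₀ (x, ξ, η, -y))
    {f₁ f₂ : GelfandShilov (Rd d) → ℂ} (hf₁ : IsGSDistribution f₁) (hf₂ : IsGSDistribution f₂)
    {φ₁ φ₂ : Rd d → ℂ} (hφ₁ : φ₁ ∈ GelfandShilov (Rd d)) (hφ₂ : φ₂ ∈ GelfandShilov (Rd d)) :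
    mixedNorm Φ₁ Ψ₁ ω₁ (stft φ₁ f₁) * mixedNormStar Ψ₂ Φ₂ ω₂ (stft φ₂ f₂) ≤
      ENNReal.ofReal C * mixedNorm4 Φ₁ Φ₂ Ψ₁ Ψ₂ ω₀ (stft (stftFun2 φ₁ φ₂) (stftDist f₁ f₂)) := by
  rw [← orlicz4_stft_mul hp h₁ h₂ h₃ h₄ hω₁ hω₂ hf₁ hf₂ hφ₁ hφ₂, mixedNorm4_eq_orlicz4, ENNReal.ofReal,
    ← orlicz4_const_mul (Real.toNNReal_pos.2 hC)]
  refine orlicz4_mono hp h₁ h₂ h₃ h₄ fun X => ?_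
  obtain ⟨x, ξ, η, y⟩ := X
  have hw := h x (-y) ξ η
  rw [neg_neg] at hw
  have e := enorm_stft_stftDist hf₁ hf₂ hφ₁ hφ₂ x ξ η y
  simp only [toPhase]
  rw [e, mul_mul_mul_comm, mul_left_comm (_ : ℝ≥0∞) (_ * _) (ENNReal.ofReal _)]
  refine mul_le_mul_right ?_ _
  rw [← ENNReal.ofReal_mul (hω₁.weight.pos _).le, ← ENNReal.ofReal, ← ENNReal.ofReal_mul hC.le]
  exact ENNReal.ofReal_le_ofReal hw

theorem exists_gsPair_gaussWindow_ne_zero {f : GelfandShilov (Rd d) → ℂ} (hf : IsGSDistribution f) (h0 : f ≠ 0) :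
    ∃ x ξ, gsPair f (tfShift (gaussWindow (Rd d)) x ξ) ≠ 0 := by
  by_contra! h
  exact h0 (hf.eq_zero_of_tfShift gaussWindow_mem (gaussWindow_ne_zero 0) h)

theorem stft_mul_weight_ne_zero {φ : Rd d → ℂ} {f : GelfandShilov (Rd d) → ℂ} {ω : Rd d × Rd d → ℝ}
    (hω : IsModerateWeight ω) {x ξ : Rd d} (h : gsPair f (tfShift φ x ξ) ≠ 0) :
    ‖stft φ f x ξ‖ₑ * ENNReal.ofReal (ω (x, ξ)) ≠ 0 := by
  refine mul_ne_zero ?_ (by simpa using hω.weight.pos _)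
  rw [stft_eq, enorm_ne_zero]
  exact mul_ne_zero (fourierConst_ne_zero _) h

/-- Some value of the transform is nonzero, and near it the weighted transform is bounded below on
an open product set. -/
theorem modNorm_ne_zero (hp : 0 ≤ p) (h₁ : IsStarYoung p Φ₁) (h₃ : IsStarYoung p Ψ₁) (hω₁ : IsModerateWeight ω₁)
    {f : GelfandShilov (Rd d) → ℂ} (hf : IsGSDistribution f) (h0 : f ≠ 0) : modNorm Φ₁ Ψ₁ ω₁ f ≠ 0 := by
  obtain ⟨x, ξ, h⟩ := exists_gsPair_gaussWindow_ne_zero hf h0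
  exact (locallyBelow_stft gaussWindow_mem hf hω₁).norm_norm_ne_zero hp h₁ h₃ (stft_mul_weight_ne_zero hω₁ h)

theorem wienerNorm_ne_zero (hp : 0 ≤ p) (h₂ : IsStarYoung p Φ₂) (h₄ : IsStarYoung p Ψ₂) (hω₂ : IsModerateWeight ω₂)
    {f : GelfandShilov (Rd d) → ℂ} (hf : IsGSDistribution f) (h0 : f ≠ 0) : wienerNorm Ψ₂ Φ₂ ω₂ f ≠ 0 := by
  obtain ⟨x, ξ, h⟩ := exists_gsPair_gaussWindow_ne_zero hf h0
  exact (locallyBelow_stft gaussWindow_mem hf hω₂).swap.norm_norm_ne_zero hp h₂ h₄ (stft_mul_weight_ne_zero hω₂ h)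

/-- The factorization holds for the window V_g g, whereas `modNorm4` uses the Gaussian of ℝ^{2d}.
Both are nonzero elements of the space, so a change of windows in either direction makes the norms
comparable. -/
theorem exists_modNorm4_stftDist_equiv (hp : 0 < p) (hp1 : p ≤ 1) (h₁ : IsStarYoung p Φ₁) (h₂ : IsStarYoung p Φ₂)
    (h₃ : IsStarYoung p Ψ₁) (h₄ : IsStarYoung p Ψ₂) (hω₀ : IsModerateWeight ω₀) (hω₁ : IsModerateWeight ω₁)
    (hω₂ : IsModerateWeight ω₂) {C : ℝ} (hC : 0 < C)
    (ha : ∀ x y ξ η : Rd d, ω₀ (x, ξ, η, -y) ≤ C * (ω₁ (y - x, η) * ω₂ (y, ξ + η)))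
    (hb : ∀ x y ξ η : Rd d, ω₁ (y - x, η) * ω₂ (y, ξ + η) ≤ C * ω₀ (x, ξ, η, -y)) :
    ∃ c : ℝ≥0, 0 < c ∧ ∀ f₁ f₂ : GelfandShilov (Rd d) → ℂ, IsGSDistribution f₁ → IsGSDistribution f₂ →
      modNorm4 Φ₁ Φ₂ Ψ₁ Ψ₂ ω₀ (stftDist f₁ f₂) ≤ c * (modNorm Φ₁ Ψ₁ ω₁ f₁ * wienerNorm Ψ₂ Φ₂ ω₂ f₂) ∧
      modNorm Φ₁ Ψ₁ ω₁ f₁ * wienerNorm Ψ₂ Φ₂ ω₂ f₂ ≤ c * modNorm4 Φ₁ Φ₂ Ψ₁ Ψ₂ ω₀ (stftDist f₁ f₂) := by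
  have hg := gaussWindow_mem (V := Rd d)
  obtain ⟨c₁, hc₁⟩ := mixedNorm4_stft_le hp hp1 h₁ h₂ h₃ h₄ hω₀ (stftFun2_mem hg hg) (gaussWindow_mem (V := R2d d))
    (stftFun2_gaussWindow_ne_zero 0)
  obtain ⟨c₂, hc₂⟩ := mixedNorm4_stft_le hp hp1 h₁ h₂ h₃ h₄ hω₀ (gaussWindow_mem (V := R2d d)) (stftFun2_mem hg hg)
    (gaussWindow_ne_zero 0)
  have hC' := Real.toNNReal_pos.2 hC
  refine ⟨(c₁ + c₂ + 1) * C.toNNReal, by positivity, fun f₁ f₂ hf₁ hf₂ => ⟨?_, ?_⟩⟩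
  · refine (hc₁ _ (isGSDistribution_stftDist hf₁ hf₂)).trans ((mul_le_mul_right
      (mixedNorm4_stftDist_le hp.le h₁ h₂ h₃ h₄ hω₁ hω₂ hC ha hf₁ hf₂ hg hg) _).trans ?_)
    rw [← mul_assoc]
    refine mul_le_mul_left ?_ _
    rw [ENNReal.ofReal]
    norm_cast
    refine mul_le_mul_left ?_ _
    rw [add_assoc]
    exact le_self_add
  · refine (le_mixedNorm4_stftDist hp.le h₁ h₂ h₃ h₄ hω₁ hω₂ hC hb hf₁ hf₂ hg hg).trans ((mul_le_mul_right
      (hc₂ _ (isGSDistribution_stftDist hf₁ hf₂)) _).trans ?_)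
    rw [← mul_assoc]
    refine mul_le_mul_left ?_ _
    rw [ENNReal.ofReal, mul_comm]
    norm_cast
    refine mul_le_mul_left ?_ _
    rw [add_comm c₁, add_assoc]
    exact le_self_add

end Main

theorem mainTheorem6 (d : ℕ) (Φ₁ Φ₂ Ψ₁ Ψ₂ : ℝ≥0∞ → ℝ≥0∞)
    (hΦ₁ : IsQuasiYoung Φ₁) (hΦ₂ : IsQuasiYoung Φ₂)
    (hΨ₁ : IsQuasiYoung Ψ₁) (hΨ₂ : IsQuasiYoung Ψ₂)
    (ω₀ : Rd d × Rd d × Rd d × Rd d → ℝ) (ω₁ ω₂ : Rd d × Rd d → ℝ)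
    (hω₀ : IsModerateWeight ω₀) (hω₁ : IsModerateWeight ω₁) (hω₂ : IsModerateWeight ω₂)
    (C : ℝ) (hC : 0 < C) :
    ((∀ x y ξ η : Rd d, ω₀ (x, ξ, η, -y) ≤ C * (ω₁ (y - x, η) * ω₂ (y, ξ + η))) →
      ∀ f₁ f₂ : GelfandShilov (Rd d) → ℂ, IsGSDistribution f₁ → IsGSDistribution f₂ →
      ∀ φ₁ φ₂ : Rd d → ℂ, φ₁ ∈ GelfandShilov (Rd d) → φ₂ ∈ GelfandShilov (Rd d) →
        mixedNorm4 Φ₁ Φ₂ Ψ₁ Ψ₂ ω₀ (stft (stftFun2 φ₁ φ₂) (stftDist f₁ f₂)) ≤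
          ENNReal.ofReal C *
            (mixedNorm Φ₁ Ψ₁ ω₁ (stft φ₁ f₁) * mixedNormStar Ψ₂ Φ₂ ω₂ (stft φ₂ f₂))) ∧
    ((∀ x y ξ η : Rd d, ω₁ (y - x, η) * ω₂ (y, ξ + η) ≤ C * ω₀ (x, ξ, η, -y)) →
      ∀ f₁ f₂ : GelfandShilov (Rd d) → ℂ, IsGSDistribution f₁ → IsGSDistribution f₂ →
      ∀ φ₁ φ₂ : Rd d → ℂ, φ₁ ∈ GelfandShilov (Rd d) → φ₂ ∈ GelfandShilov (Rd d) →
        mixedNorm Φ₁ Ψ₁ ω₁ (stft φ₁ f₁) * mixedNormStar Ψ₂ Φ₂ ω₂ (stft φ₂ f₂) ≤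
          ENNReal.ofReal C *
            mixedNorm4 Φ₁ Φ₂ Ψ₁ Ψ₂ ω₀ (stft (stftFun2 φ₁ φ₂) (stftDist f₁ f₂))) ∧
    ((∀ x y ξ η : Rd d, ω₀ (x, ξ, η, -y) ≤ C * (ω₁ (y - x, η) * ω₂ (y, ξ + η))) →
      (∀ x y ξ η : Rd d, ω₁ (y - x, η) * ω₂ (y, ξ + η) ≤ C * ω₀ (x, ξ, η, -y)) →
      (∀ f₁ f₂ : GelfandShilov (Rd d) → ℂ, IsGSDistribution f₁ → IsGSDistribution f₂ →
        (f₁ ∈ ModSpace Φ₁ Ψ₁ ω₁ ∧ f₂ ∈ WienerSpace Ψ₂ Φ₂ ω₂ →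
          stftDist f₁ f₂ ∈ ModSpace4 Φ₁ Φ₂ Ψ₁ Ψ₂ ω₀) ∧
        (f₁ ≠ 0 → f₂ ≠ 0 →
          (f₁ ∈ ModSpace Φ₁ Ψ₁ ω₁ ∧ f₂ ∈ WienerSpace Ψ₂ Φ₂ ω₂ ↔
            stftDist f₁ f₂ ∈ ModSpace4 Φ₁ Φ₂ Ψ₁ Ψ₂ ω₀))) ∧
      ∃ c : ℝ≥0, 0 < c ∧
        ∀ f₁ f₂ : GelfandShilov (Rd d) → ℂ, IsGSDistribution f₁ → IsGSDistribution f₂ →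
          modNorm4 Φ₁ Φ₂ Ψ₁ Ψ₂ ω₀ (stftDist f₁ f₂) ≤
            c * (modNorm Φ₁ Ψ₁ ω₁ f₁ * wienerNorm Ψ₂ Φ₂ ω₂ f₂) ∧
          modNorm Φ₁ Ψ₁ ω₁ f₁ * wienerNorm Ψ₂ Φ₂ ω₂ f₂ ≤
            c * modNorm4 Φ₁ Φ₂ Ψ₁ Ψ₂ ω₀ (stftDist f₁ f₂)) := by

  obtain ⟨p₁, hp₁, hp₁', s₁⟩ := hΦ₁.isStarYoung
  obtain ⟨p₂, hp₂, hp₂', s₂⟩ := hΦ₂.isStarYoung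
  obtain ⟨p₃, hp₃, hp₃', s₃⟩ := hΨ₁.isStarYoung
  obtain ⟨p₄, hp₄, hp₄', s₄⟩ := hΨ₂.isStarYoung
  -- A common order: the scaling inequality only weakens as p decreases.
  obtain ⟨p, hp, hp1, h₁, h₂, h₃, h₄⟩ : ∃ p : ℝ, 0 < p ∧ p ≤ 1 ∧ IsStarYoung p Φ₁ ∧ IsStarYoung p Φ₂ ∧
      IsStarYoung p Ψ₁ ∧ IsStarYoung p Ψ₂ :=
    ⟨min (min p₁ p₂) (min p₃ p₄), by positivity, ((min_le_left _ _).trans (min_le_left _ _)).trans hp₁',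
      s₁.anti ((min_le_left _ _).trans (min_le_left _ _)), s₂.anti ((min_le_left _ _).trans (min_le_right _ _)),
      s₃.anti ((min_le_right _ _).trans (min_le_left _ _)), s₄.anti ((min_le_right _ _).trans (min_le_right _ _))⟩
  refine ⟨fun ha f₁ f₂ hf₁ hf₂ φ₁ φ₂ hφ₁ hφ₂ => mixedNorm4_stftDist_le hp.le h₁ h₂ h₃ h₄ hω₁ hω₂ hC ha hf₁ hf₂ hφ₁ hφ₂,
    fun hb f₁ f₂ hf₁ hf₂ φ₁ φ₂ hφ₁ hφ₂ => le_mixedNorm4_stftDist hp.le h₁ h₂ h₃ h₄ hω₁ hω₂ hC hb hf₁ hf₂ hφ₁ hφ₂,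
    fun ha hb => ?_⟩
  obtain ⟨c, hc, H⟩ := exists_modNorm4_stftDist_equiv hp hp1 h₁ h₂ h₃ h₄ hω₀ hω₁ hω₂ hC ha hb
  refine ⟨fun f₁ f₂ hf₁ hf₂ => ?_, c, hc, H⟩
  obtain ⟨H₁, H₂⟩ := H f₁ f₂ hf₁ hf₂
  have hdir : f₁ ∈ ModSpace Φ₁ Ψ₁ ω₁ ∧ f₂ ∈ WienerSpace Ψ₂ Φ₂ ω₂ → stftDist f₁ f₂ ∈ ModSpace4 Φ₁ Φ₂ Ψ₁ Ψ₂ ω₀ :=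
    fun ⟨m₁, m₂⟩ => ⟨isGSDistribution_stftDist hf₁ hf₂,
      H₁.trans_lt (ENNReal.mul_lt_top ENNReal.coe_lt_top (ENNReal.mul_lt_top m₁.2 m₂.2))⟩
  refine ⟨hdir, fun n₁ n₂ => ⟨hdir, fun m => ?_⟩⟩
  have hfin := H₂.trans_lt (ENNReal.mul_lt_top ENNReal.coe_lt_top m.2)
  -- In [0,∞] a product is also finite when one factor is 0; nonzero distributions exclude this.
  rcases ENNReal.mul_lt_top_iff.1 hfin with h | h | h
  · exact ⟨⟨hf₁, h.1⟩, ⟨hf₂, h.2⟩⟩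
  · exact absurd h (modNorm_ne_zero hp.le h₁ h₃ hω₁ hf₁ n₁)
  · exact absurd h (wienerNorm_ne_zero hp.le h₂ h₄ hω₂ hf₂ n₂)
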